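/- For $x=(x_1,x_2,x_3)\in\mathbb R^3$ write $x_h=(x_1,x_2)$. Let $\alpha\in[0,1]$ and, for $R\ge 1$, let $$\mathcal O_R=\{x\in\mathbb R^3 : R\le |x_h|\le 2R,\ |x_3|\le |x_h|^{\alpha}\}.$$ There is a constant $C_\alpha>0$, depending only on $\alpha$, such that for every $R\ge 1$ and every real-valued $f\in L^2(\mathcal O_R)$ with $\int_{\mathcal O_R} f\,dx=0$ there is a vector field $V=(V^1,V^2,V^3)$ with $$\nabla\cdot V=f\ \text{ a.e. in }\mathcal O_R,\qquad V\in W^{1,2}_0(\mathcal O_R;\mathbb R^3),\qquad \|\nabla V\|_{L^2(\mathcal O_R)}\le C_\alpha R^{1-\alpha}\|f\|_{L^2(\mathcal O_R)}.$$ Here $W^{1,2}_0(\mathcal O_R;\mathbb R^3)$ is the closure of the smooth vector fields with compact support in the interior of $\mathcal O_R$ in the $W^{1,2}$ norm, $\nabla V$ is the weak gradient, and $\|\nabla V\|_{L^2(\mathcal O_R)}^2=\sum_{i,j=1}^{3}\int_{\mathcal O_R}|\partial_i V^j|^2\,dx$. -/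

import Mathlib

open MeasureTheory Filter Topology
open scoped ENNReal ContDiff

/-- `φ ∈ C_c^∞(Ω)`, for a real-valued function on `ℝⁿ`. -/
def IsTestFunction {n : ℕ} (Ω : Set (EuclideanSpace ℝ (Fin n)))
    (φ : EuclideanSpace ℝ (Fin n) → ℝ) : Prop :=
  ContDiff ℝ ∞ φ ∧ HasCompactSupport φ ∧ tsupport φ ⊆ Ω

/-- The classical partial derivative `∂_i φ (x)`. -/
noncomputable def partialDeriv {n : ℕ} (i : Fin n)
    (φ : EuclideanSpace ℝ (Fin n) → ℝ) (x : EuclideanSpace ℝ (Fin n)) : ℝ :=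
  fderiv ℝ φ x (EuclideanSpace.single i 1)

/-- On the open set `Ω`, the locally integrable function `g` is the weak partial derivative
`∂_i u` of the locally integrable function `u`. -/
def HasWeakPartial {n : ℕ} (Ω : Set (EuclideanSpace ℝ (Fin n))) (i : Fin n)
    (u g : EuclideanSpace ℝ (Fin n) → ℝ) : Prop :=
  LocallyIntegrableOn u Ω volume ∧ LocallyIntegrableOn g Ω volume ∧
    ∀ φ : EuclideanSpace ℝ (Fin n) → ℝ, IsTestFunction Ω φ →
      ∫ x in Ω, u x * partialDeriv i φ x = - ∫ x in Ω, g x * φ x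

/-- `u ∈ W^{1,p}_0(Ω)`, for `Ω` open and `1 ≤ p < ∞`: `u` and its weak first partial derivatives
lie in `L^p(Ω)`, and `u` is a limit of functions in `C_c^∞(Ω)` in the norm of `W^{1,p}(Ω)`. -/
def MemSobolevZero {n : ℕ} (p : ℝ≥0∞) (Ω : Set (EuclideanSpace ℝ (Fin n)))
    (u : EuclideanSpace ℝ (Fin n) → ℝ) : Prop :=
  MemLp u p (volume.restrict Ω) ∧
    ∃ g : Fin n → EuclideanSpace ℝ (Fin n) → ℝ,
      (∀ i, MemLp (g i) p (volume.restrict Ω) ∧ HasWeakPartial Ω i u (g i)) ∧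
      ∃ φ : ℕ → EuclideanSpace ℝ (Fin n) → ℝ,
        (∀ k, IsTestFunction Ω (φ k)) ∧
        Tendsto (fun k => eLpNorm (fun x => φ k x - u x) p (volume.restrict Ω)) atTop (𝓝 0) ∧
        ∀ i, Tendsto
          (fun k => eLpNorm (fun x => partialDeriv i (φ k) x - g i x) p (volume.restrict Ω))
          atTop (𝓝 0)

/-- On the open set `Ω`, the matrix field `D` is the weak Jacobian of the vector field `V`:
`D x j i` is `∂_i V^j (x)`. -/
def HasWeakJacobian {n : ℕ} (Ω : Set (EuclideanSpace ℝ (Fin n)))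
    (V : EuclideanSpace ℝ (Fin n) → EuclideanSpace ℝ (Fin n))
    (D : EuclideanSpace ℝ (Fin n) → Matrix (Fin n) (Fin n) ℝ) : Prop :=
  ∀ i j, HasWeakPartial Ω i (fun x => V x j) (fun x => D x j i)

/-- The Euclidean (Frobenius) length of a matrix, `(∑_{j,i} |A_{ji}|²)^{1/2}`. -/
noncomputable def matrixLength {n : ℕ} (A : Matrix (Fin n) (Fin n) ℝ) : ℝ :=
  Real.sqrt (∑ j, ∑ i, A j i ^ 2)

/-- `|x_h|`, where `x_h = (x_1, x_2)` is the horizontal part of `x ∈ ℝ³`. -/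
noncomputable def horizontalNorm (x : EuclideanSpace ℝ (Fin 3)) : ℝ :=
  Real.sqrt (x 0 ^ 2 + x 1 ^ 2)

/-- The set `{x ∈ ℝ³ : R ≤ |x_h| ≤ 2R, |x_3| ≤ |x_h|^α}`. -/
def apertureDomain (α R : ℝ) : Set (EuclideanSpace ℝ (Fin 3)) :=
  {x | R ≤ horizontalNorm x ∧ horizontalNorm x ≤ 2 * R ∧ |x 2| ≤ horizontalNorm x ^ α}

/-! The divergence equation moves between domains by the Piola transform. If `Ψ` is a change of
variables and `V` a field on its target, pulling `V` back with the columns of the adjugate of `DΨ`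
gives a field whose divergence is `det DΨ` times `(div V) ∘ Ψ`, because these columns are divergence
free. This reduces the theorem to one explicit model, the flat torus, where `V = ∇Δ⁻¹g` is given by
Fourier multipliers bounded by one (`exists_periodic_divergence`).

The boundary condition comes from folding. Data on a quarter of the period cell is extended by zero
to the torus and solved there. Weighted Piola pullbacks of the solution under nine maps are then
added. The maps and weights are such that on the faces `y 0 ∈ {0, 1/2}` and `y 2 ∈ {0, 1/2}` the
terms cancel in all components, while inside the quarter cell every map but the identity lands where
the extended datum is zero, so the divergence is unchanged (`exists_quarterCell_divergence`). A
smooth field vanishing on these faces is approximated by its products with cutoffs.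

Cylindrical coordinates identify the domain with `R = 1`, up to null sets, with this quarter cell,
the angle being the remaining periodic variable (`exists_unitAperture_divergence`). For general `R`,
the scaling by `(R, R, R^α)` maps the domain with `R = 1` exactly onto the one for `R`. Under the
field `V^j = d_j U^j(x / d)` divergences are preserved and `∂_i V^j` acquires the factor `d_j / d_i
≤ R^(1-α)`, which is the whole dependence on `R` (`exists_aperture_divergence`).

Throughout, a Sobolev field is represented by smooth fields whose jets converge in `L²`. The Piola
transform acts linearly and pointwise on jets, so it passes to the limit without any calculus of
weak derivatives; these appear only at the end. -/

/-! ### Jets of vector fields and the Piola transform. -/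

/-- The values and the first partial derivatives of a vector field at a point; the entry
`p.2 i j` stands for `∂_i V^j`. -/
abbrev Jet : Type := (Fin 3 → ℝ) × (Fin 3 → Fin 3 → ℝ)

/-- The first jet of a vector field on `ℝ³`. -/
noncomputable def jet (V : EuclideanSpace ℝ (Fin 3) → Fin 3 → ℝ) (x : EuclideanSpace ℝ (Fin 3)) :
    Jet :=
  (V x, fun i j => partialDeriv i (fun y => V y j) x)

/-- The divergence of a jet. -/
def jetDiv (p : Jet) : ℝ := ∑ i, p.2 i i

lemma jetDiv_sum {ι : Type*} (s : Finset ι) (p : ι → Jet) :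
    jetDiv (∑ k ∈ s, p k) = ∑ k ∈ s, jetDiv (p k) := by
  simp only [jetDiv, Prod.snd_sum, Finset.sum_apply]
  exact Finset.sum_comm

lemma abs_fst_le_norm (p : Jet) (j : Fin 3) : |p.1 j| ≤ ‖p‖ :=
  (norm_le_pi_norm p.1 j).trans (norm_fst_le p)

lemma abs_snd_le_norm (p : Jet) (i j : Fin 3) : |p.2 i j| ≤ ‖p‖ :=
  ((norm_le_pi_norm (p.2 i) j).trans (norm_le_pi_norm p.2 i)).trans (norm_snd_le p)

lemma jet_norm_le {p : Jet} {c : ℝ} (hc : 0 ≤ c) (h1 : ∀ j, |p.1 j| ≤ c)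
    (h2 : ∀ i j, |p.2 i j| ≤ c) : ‖p‖ ≤ c := by
  refine norm_prod_le_iff.2 ⟨(pi_norm_le_iff_of_nonneg hc).2 h1, (pi_norm_le_iff_of_nonneg hc).2
    fun i => (pi_norm_le_iff_of_nonneg hc).2 (h2 i)⟩

/-- The jet of `∑ m, V^m ∘ Ψ • B_m`, where `P n i = ∂_i Ψ^n`, `b m` is the jet of `B_m`, and `p`
is the jet of `V` at the image point. -/
def piolaJet (P : Fin 3 → Fin 3 → ℝ) (b : Fin 3 → Jet) (p : Jet) : Jet :=
  (fun j => ∑ m, (b m).1 j * p.1 m,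
    fun i j => ∑ m, ((b m).2 i j * p.1 m + (b m).1 j * ∑ n, P n i * p.2 n m))

lemma piolaJet_sub (P : Fin 3 → Fin 3 → ℝ) (b : Fin 3 → Jet) (p q : Jet) :
    piolaJet P b (p - q) = piolaJet P b p - piolaJet P b q := by
  refine Prod.ext ?_ ?_
  · ext j
    simp [piolaJet, Fin.sum_univ_three]
    ring
  · ext i j
    simp [piolaJet, Fin.sum_univ_three]
    ring

/-- The terms with undifferentiated `p.1` collect the divergences of the columns `b m`, which vanish
(the Piola identity). In the remaining terms the product of `P` with the columns is `d` times the
identity, as for a matrix and its adjugate, so only the trace of `p.2` survives. -/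
lemma jetDiv_piolaJet {P : Fin 3 → Fin 3 → ℝ} {b : Fin 3 → Jet} {d : ℝ}
    (hb : ∀ m, jetDiv (b m) = 0)
    (hP : ∀ n m, ∑ i, P n i * (b m).1 i = if n = m then d else 0) (p : Jet) :
    jetDiv (piolaJet P b p) = d * jetDiv p := by
  have h : jetDiv (piolaJet P b p) = ∑ m, jetDiv (b m) * p.1 m +
      ∑ n, ∑ m, (∑ i, P n i * (b m).1 i) * p.2 n m := by
    simp [jetDiv, piolaJet, Fin.sum_univ_three]
    ring
  rw [h]
  simp only [hb, hP]
  simp [jetDiv, Finset.mul_sum]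

lemma norm_piolaJet_le {P : Fin 3 → Fin 3 → ℝ} {b : Fin 3 → Jet} {c : ℝ} (hc : 0 ≤ c)
    (hP : ∀ n i, |P n i| ≤ c) (hb : ∀ m, ‖b m‖ ≤ c) (p : Jet) :
    ‖piolaJet P b p‖ ≤ (3 * c + 9 * c ^ 2) * ‖p‖ := by
  have hp := norm_nonneg p
  refine jet_norm_le (by positivity) (fun j => ?_) fun i j => ?_
  · change |∑ m, (b m).1 j * p.1 m| ≤ _
    refine (Finset.abs_sum_le_sum_abs _ _).trans ?_
    have : ∀ m ∈ Finset.univ, |(b m).1 j * p.1 m| ≤ c * ‖p‖ := fun m _ => by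
      rw [abs_mul]
      exact mul_le_mul ((abs_fst_le_norm _ j).trans (hb m)) (abs_fst_le_norm _ m) (abs_nonneg _) hc
    refine (Finset.sum_le_sum this).trans ?_
    simp
    nlinarith [mul_nonneg (sq_nonneg c) hp]
  · change |∑ m, ((b m).2 i j * p.1 m + (b m).1 j * ∑ n, P n i * p.2 n m)| ≤ _
    refine (Finset.abs_sum_le_sum_abs _ _).trans ?_
    have : ∀ m ∈ Finset.univ, |(b m).2 i j * p.1 m + (b m).1 j * ∑ n, P n i * p.2 n m| ≤
        c * ‖p‖ + c * (3 * (c * ‖p‖)) := fun m _ => by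
      refine (abs_add_le _ _).trans (add_le_add ?_ ?_)
      · rw [abs_mul]
        exact mul_le_mul ((abs_snd_le_norm _ i j).trans (hb m)) (abs_fst_le_norm _ m)
          (abs_nonneg _) hc
      · rw [abs_mul]
        refine mul_le_mul ((abs_fst_le_norm _ j).trans (hb m)) ?_ (abs_nonneg _) hc
        refine (Finset.abs_sum_le_sum_abs _ _).trans ?_
        have : ∀ n ∈ Finset.univ, |P n i * p.2 n m| ≤ c * ‖p‖ := fun n _ => by
          rw [abs_mul]
          exact mul_le_mul (hP n i) (abs_snd_le_norm _ n m) (abs_nonneg _) hc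
        refine (Finset.sum_le_sum this).trans ?_
        simp
    refine (Finset.sum_le_sum this).trans ?_
    simp
    nlinarith

lemma partialDeriv_eq_of_hasFDerivAt {φ : EuclideanSpace ℝ (Fin 3) → ℝ}
    {L : EuclideanSpace ℝ (Fin 3) →L[ℝ] ℝ} {x : EuclideanSpace ℝ (Fin 3)} (h : HasFDerivAt φ L x)
    (i : Fin 3) : partialDeriv i φ x = L (EuclideanSpace.single i 1) := by
  rw [partialDeriv, h.fderiv]

lemma fderiv_apply_eq_sum (φ : EuclideanSpace ℝ (Fin 3) → ℝ) (x v : EuclideanSpace ℝ (Fin 3)) :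
    fderiv ℝ φ x v = ∑ i, v i * partialDeriv i φ x := by
  have hv : v = ∑ i, v i • EuclideanSpace.single i (1 : ℝ) := by
    ext j
    simp [Fin.sum_univ_three]
    fin_cases j <;> simp
  conv_lhs => rw [hv]
  simp [partialDeriv]

/-- Product and chain rule. It turns transformations of smooth fields into pointwise linear algebra
on jets, which also makes sense for `L²` limits of jets. -/
lemma jet_piola {V : EuclideanSpace ℝ (Fin 3) → Fin 3 → ℝ}
    {Ψ : EuclideanSpace ℝ (Fin 3) → EuclideanSpace ℝ (Fin 3)}
    {Ψ' : EuclideanSpace ℝ (Fin 3) →L[ℝ] EuclideanSpace ℝ (Fin 3)}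
    {B : Fin 3 → EuclideanSpace ℝ (Fin 3) → Fin 3 → ℝ} {x : EuclideanSpace ℝ (Fin 3)}
    (hΨ : HasFDerivAt Ψ Ψ' x) (hV : ∀ m, DifferentiableAt ℝ (fun y => V y m) (Ψ x))
    (hB : ∀ m j, DifferentiableAt ℝ (fun y => B m y j) x) :
    jet (fun y j => ∑ m, B m y j * V (Ψ y) m) x =
      piolaJet (fun n i => Ψ' (EuclideanSpace.single i 1) n) (fun m => jet (B m) x)
        (jet V (Ψ x)) := by
  refine Prod.ext rfl ?_
  ext i j
  have hsum : HasFDerivAt (fun y => ∑ m, B m y j * V (Ψ y) m)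
      (∑ m, (B m x j • ((fderiv ℝ (fun y => V y m) (Ψ x)).comp Ψ') +
        V (Ψ x) m • fderiv ℝ (fun y => B m y j) x)) x :=
    HasFDerivAt.fun_sum fun m _ =>
      (hB m j).hasFDerivAt.mul ((hV m).hasFDerivAt.comp x hΨ)
  simp only [jet, piolaJet]
  rw [partialDeriv_eq_of_hasFDerivAt hsum]
  simp only [_root_.sum_apply, _root_.add_apply,
    _root_.smul_apply, ContinuousLinearMap.comp_apply, smul_eq_mul]
  refine Finset.sum_congr rfl fun m _ => ?_
  rw [fderiv_apply_eq_sum _ (Ψ x)]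
  simp only [partialDeriv]
  ring

lemma jet_sum {ι : Type*} (s : Finset ι) {V : ι → EuclideanSpace ℝ (Fin 3) → Fin 3 → ℝ}
    {x : EuclideanSpace ℝ (Fin 3)}
    (hV : ∀ k ∈ s, ∀ j, DifferentiableAt ℝ (fun y => V k y j) x) :
    jet (fun y j => ∑ k ∈ s, V k y j) x = ∑ k ∈ s, jet (V k) x := by
  refine Prod.ext ?_ ?_
  · ext j
    simp [jet, Prod.fst_sum]
  · ext i j
    have : HasFDerivAt (fun y => ∑ k ∈ s, V k y j) (∑ k ∈ s, fderiv ℝ (fun y => V k y j) x) x :=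
      HasFDerivAt.fun_sum fun k hk => (hV k hk j).hasFDerivAt
    simp only [jet, Prod.snd_sum, Finset.sum_apply]
    rw [partialDeriv_eq_of_hasFDerivAt this, _root_.sum_apply]
    rfl

lemma measurable_partialDeriv (i : Fin 3) (φ : EuclideanSpace ℝ (Fin 3) → ℝ) :
    Measurable (partialDeriv i φ) :=
  measurable_fderiv_apply_const ℝ φ _

lemma continuous_partialDeriv (i : Fin 3) {φ : EuclideanSpace ℝ (Fin 3) → ℝ}
    (h : ContDiff ℝ ∞ φ) : Continuous (partialDeriv i φ) :=
  (h.continuous_fderiv (by simp)).clm_apply continuous_const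

lemma continuous_jet {V : EuclideanSpace ℝ (Fin 3) → Fin 3 → ℝ}
    (h : ∀ j, ContDiff ℝ ∞ fun y => V y j) : Continuous (jet V) :=
  (continuous_pi fun j => (h j).continuous).prodMk
    (continuous_pi fun i => continuous_pi fun j => continuous_partialDeriv i (h j))

lemma measurable_jet {V : EuclideanSpace ℝ (Fin 3) → Fin 3 → ℝ} (h : Measurable V) :
    Measurable (jet V) :=
  h.prodMk (measurable_pi_lambda _ fun i => measurable_pi_lambda _ fun _ =>
    measurable_partialDeriv i _)

lemma measurable_piolaJet {P : EuclideanSpace ℝ (Fin 3) → Fin 3 → Fin 3 → ℝ}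
    {b : Fin 3 → EuclideanSpace ℝ (Fin 3) → Jet} {p : EuclideanSpace ℝ (Fin 3) → Jet}
    (hP : Measurable P) (hb : ∀ m, Measurable (b m)) (hp : Measurable p) :
    Measurable fun x => piolaJet (P x) (fun m => b m x) (p x) := by
  unfold piolaJet
  fun_prop

/-- The norm of a jet is a maximum, hence at most the sum of its `3 + 9` entries; this is the source
of the constant `12` on the torus. -/
lemma eLpNorm_jet_le {μ : Measure (EuclideanSpace ℝ (Fin 3))} {p : EuclideanSpace ℝ (Fin 3) → Jet}
    (hp : AEStronglyMeasurable p μ) :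
    eLpNorm p 2 μ ≤ ∑ j, eLpNorm (fun x => (p x).1 j) 2 μ +
      ∑ i, ∑ j, eLpNorm (fun x => (p x).2 i j) 2 μ := by
  have h1 : ∀ j, AEStronglyMeasurable (fun x => |(p x).1 j|) μ := fun j =>
    (by fun_prop : Continuous fun q : Jet => |q.1 j|).comp_aestronglyMeasurable hp
  have h2 : ∀ i j, AEStronglyMeasurable (fun x => |(p x).2 i j|) μ := fun i j =>
    (by fun_prop : Continuous fun q : Jet => |q.2 i j|).comp_aestronglyMeasurable hp
  have h3 : eLpNorm p 2 μ ≤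
      eLpNorm ((∑ j, fun x => |(p x).1 j|) + ∑ i, ∑ j, fun x => |(p x).2 i j|) 2 μ := by
    refine eLpNorm_mono_real fun x => ?_
    simp only [Pi.add_apply, Finset.sum_apply]
    have hnn : 0 ≤ ∑ i, ∑ j, |(p x).2 i j| :=
      Finset.sum_nonneg fun i _ => Finset.sum_nonneg fun j _ => abs_nonneg _
    have hnn' : 0 ≤ ∑ j, |(p x).1 j| := Finset.sum_nonneg fun j _ => abs_nonneg _
    refine jet_norm_le (by positivity) (fun j => ?_) fun i j => ?_
    · exact (Finset.single_le_sum (f := fun j => |(p x).1 j|) (fun j _ => abs_nonneg _)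
        (Finset.mem_univ j)).trans (le_add_of_nonneg_right hnn)
    · refine le_trans ?_ (le_add_of_nonneg_left hnn')
      refine (Finset.single_le_sum (f := fun j => |(p x).2 i j|) (fun j _ => abs_nonneg _)
        (Finset.mem_univ j)).trans ?_
      exact Finset.single_le_sum (f := fun i => ∑ j, |(p x).2 i j|)
        (fun i _ => Finset.sum_nonneg fun j _ => abs_nonneg _) (Finset.mem_univ i)
  refine h3.trans ((eLpNorm_add_le (Finset.aestronglyMeasurable_sum _ fun j _ => h1 j)
    (Finset.aestronglyMeasurable_sum _ fun i _ =>
      Finset.aestronglyMeasurable_sum _ fun j _ => h2 i j) one_le_two).trans ?_)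
  refine add_le_add ((eLpNorm_sum_le (fun j _ => h1 j) one_le_two).trans ?_)
    ((eLpNorm_sum_le (fun i _ => Finset.aestronglyMeasurable_sum _ fun j _ => h2 i j)
      one_le_two).trans ?_)
  · refine Finset.sum_le_sum fun j _ => ?_
    exact eLpNorm_mono fun x => by simp
  · refine Finset.sum_le_sum fun i _ => (eLpNorm_sum_le (fun j _ => h2 i j) one_le_two).trans ?_
    refine Finset.sum_le_sum fun j _ => ?_
    exact eLpNorm_mono fun x => by simp

/-! ### The torus, trigonometric polynomials and Fourier multipliers. -/

section Torus

attribute [local instance] instMeasureSpaceUnitAddCircle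

/-- The period cell `(-1/2, 1/2]³`. -/
def periodCell : Set (EuclideanSpace ℝ (Fin 3)) :=
  {y | ∀ i, y i ∈ Set.Ioc (-(1 / 2) : ℝ) (-(1 / 2) + 1)}

/-- The projection of `ℝ³` to the torus `ℝ³ / ℤ³`. -/
def toTorus (y : EuclideanSpace ℝ (Fin 3)) : UnitAddTorus (Fin 3) := fun i => (y i : UnitAddCircle)

/-- The representative of a point of the torus in the period cell. -/
noncomputable def fromTorus (t : UnitAddTorus (Fin 3)) : EuclideanSpace ℝ (Fin 3) :=
  WithLp.toLp 2 (UnitAddTorus.measurableEquivPiIoc (fun _ => -(1 / 2)) t).1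

lemma fromTorus_toTorus {y : EuclideanSpace ℝ (Fin 3)} (hy : y ∈ periodCell) :
    fromTorus (toTorus y) = y := by
  have := (UnitAddTorus.measurableEquivPiIoc (ι := Fin 3) (fun _ => -(1 / 2))).apply_symm_apply
    ⟨fun i => y i, hy⟩
  rw [UnitAddTorus.coe_symm_measurableEquivPiIoc_apply] at this
  change WithLp.toLp 2 (UnitAddTorus.measurableEquivPiIoc (ι := Fin 3) (fun _ => -(1 / 2))
    fun i => (y i : UnitAddCircle)).1 = y
  rw [this]

lemma measurableSet_periodCell : MeasurableSet periodCell := by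
  unfold periodCell
  simp only [Set.ofPred_forall]
  exact MeasurableSet.iInter fun i => measurableSet_Ioc.preimage (by fun_prop)

lemma measurePreserving_toTorus :
    MeasurePreserving toTorus (volume.restrict periodCell) volume := by
  have h1 : MeasurePreserving (@WithLp.ofLp 2 (Fin 3 → ℝ)) (volume.restrict periodCell)
      (volume.restrict (Set.univ.pi fun _ => Set.Ioc (-(1 / 2) : ℝ) (-(1 / 2) + 1))) := by
    have hset : periodCell = @WithLp.ofLp 2 (Fin 3 → ℝ) ⁻¹'
        (Set.univ.pi fun _ => Set.Ioc (-(1 / 2) : ℝ) (-(1 / 2) + 1)) := by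
      ext y
      simp [periodCell]
    rw [hset]
    exact (PiLp.volume_preserving_ofLp (Fin 3)).restrict_preimage
      (MeasurableSet.univ_pi fun _ => measurableSet_Ioc)
  have h2 : MeasurePreserving (fun (x : Fin 3 → ℝ) i => (x i : UnitAddCircle))
      (volume.restrict (Set.univ.pi fun _ => Set.Ioc (-(1 / 2) : ℝ) (-(1 / 2) + 1)))
      (volume : Measure (UnitAddTorus (Fin 3))) := by
    have := measurePreserving_pi _ _ (fun _ : Fin 3 => AddCircle.measurePreserving_mk 1 (-(1 / 2)))
    rw [← Measure.restrict_pi_pi] at this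
    convert! this
    simp [volume, AddCircle.haarAddCircle]
  exact h2.comp h1

lemma measurable_fromTorus : Measurable fromTorus :=
  (PiLp.volume_preserving_toLp (Fin 3)).measurable.comp
    (measurable_subtype_coe.comp (MeasurableEquiv.measurable _))

lemma measurePreserving_fromTorus :
    MeasurePreserving fromTorus volume (volume.restrict periodCell) := by
  refine ⟨measurable_fromTorus, ?_⟩
  rw [← measurePreserving_toTorus.map_eq, Measure.map_map measurable_fromTorus
    measurePreserving_toTorus.measurable]
  have : fromTorus ∘ toTorus =ᵐ[volume.restrict periodCell] id := by
    filter_upwards [ae_restrict_mem measurableSet_periodCell] with y hy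
    exact fromTorus_toTorus hy
  rw [Measure.map_congr this, Measure.map_id]

lemma mFourier_toTorus (k : Fin 3 → ℤ) (y : EuclideanSpace ℝ (Fin 3)) :
    UnitAddTorus.mFourier k (toTorus y) =
      Complex.exp (2 * Real.pi * Complex.I * ∑ i, (k i : ℂ) * y i) := by
  rw [Finset.mul_sum, Complex.exp_sum]
  change ∏ i, fourier (k i) (toTorus y i) = _
  refine Finset.prod_congr rfl fun i _ => ?_
  rw [toTorus, fourier_coe_apply]
  congr 1
  push_cast
  ring

lemma toTorus_add_int (y : EuclideanSpace ℝ (Fin 3)) (k : Fin 3 → ℤ) :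
    toTorus (y + WithLp.toLp 2 fun i => (k i : ℝ)) = toTorus y := by
  ext i
  simp [toTorus]

/-- The real part of a trigonometric polynomial on `ℝ³`. -/
noncomputable def reTrigPoly (s : Finset (Fin 3 → ℤ)) (d : (Fin 3 → ℤ) → ℂ)
    (y : EuclideanSpace ℝ (Fin 3)) : ℝ :=
  (∑ k ∈ s, d k * UnitAddTorus.mFourier k (toTorus y)).re

lemma contDiff_reTrigPoly (s : Finset (Fin 3 → ℤ)) (d : (Fin 3 → ℤ) → ℂ) :
    ContDiff ℝ ∞ (reTrigPoly s d) := by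
  unfold reTrigPoly
  simp only [mFourier_toTorus]
  refine Complex.reCLM.contDiff.comp (ContDiff.sum fun k _ => contDiff_const.mul ?_)
  refine ContDiff.cexp (contDiff_const.mul (ContDiff.sum fun i _ => contDiff_const.mul ?_))
  exact Complex.ofRealCLM.contDiff.comp (EuclideanSpace.proj i : _ →L[ℝ] ℝ).contDiff

lemma partialDeriv_reTrigPoly (s : Finset (Fin 3 → ℤ)) (d : (Fin 3 → ℤ) → ℂ) (i : Fin 3)
    (y : EuclideanSpace ℝ (Fin 3)) :
    partialDeriv i (reTrigPoly s d) y =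
      reTrigPoly s (fun k => 2 * Real.pi * Complex.I * k i * d k) y := by
  have hexp : ∀ k : Fin 3 → ℤ, HasFDerivAt (fun y => UnitAddTorus.mFourier k (toTorus y))
      (UnitAddTorus.mFourier k (toTorus y) • ((2 * Real.pi * Complex.I) • ∑ i, (k i : ℂ) •
        (Complex.ofRealCLM.comp (EuclideanSpace.proj i : EuclideanSpace ℝ (Fin 3) →L[ℝ] ℝ)))) y := by
    intro k
    simp only [mFourier_toTorus]
    refine HasFDerivAt.cexp (HasFDerivAt.const_mul ?_ _)
    refine HasFDerivAt.fun_sum fun i _ => HasFDerivAt.const_mul ?_ _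
    exact (Complex.ofRealCLM.comp (EuclideanSpace.proj i :
      EuclideanSpace ℝ (Fin 3) →L[ℝ] ℝ)).hasFDerivAt
  have := Complex.reCLM.hasFDerivAt.comp y
    (HasFDerivAt.fun_sum fun k (_ : k ∈ s) => (hexp k).const_mul (d k))
  have h2 := partialDeriv_eq_of_hasFDerivAt (φ := reTrigPoly s d) this i
  rw [h2, reTrigPoly]
  simp only [ContinuousLinearMap.comp_apply, Complex.reCLM_apply, _root_.sum_apply,
    _root_.smul_apply, smul_eq_mul]
  congr 1
  refine Finset.sum_congr rfl fun k _ => ?_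
  have : ∑ x, (k x : ℂ) * Complex.ofRealCLM ((EuclideanSpace.proj x :
      EuclideanSpace ℝ (Fin 3) →L[ℝ] ℝ) (EuclideanSpace.single i 1)) = k i := by
    fin_cases i <;> simp [Fin.sum_univ_three]
  rw [this]
  ring

lemma eLpNorm_re_comp_toTorus_le (h : UnitAddTorus (Fin 3) → ℂ)
    (hh : AEStronglyMeasurable h volume) :
    eLpNorm (fun y => (h (toTorus y)).re) 2 (volume.restrict periodCell) ≤
      eLpNorm h 2 volume := by
  rw [← eLpNorm_comp_measurePreserving hh measurePreserving_toTorus]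
  exact eLpNorm_mono fun y => by simpa using Complex.abs_re_le_norm _

/-- `L²` convergence on the torus descends to the period cell, since `toTorus` preserves measure and
taking real parts does not increase the norm. -/
lemma tendsto_reTrigPoly {d : (Fin 3 → ℤ) → ℂ} {h : Lp ℂ 2 (volume : Measure (UnitAddTorus (Fin 3)))}
    (hd : HasSum (fun k => d k • UnitAddTorus.mFourierLp 2 k) h) {s : ℕ → Finset (Fin 3 → ℤ)}
    (hs : Tendsto s atTop atTop) :
    Tendsto (fun n => eLpNorm (fun y => reTrigPoly (s n) d y - (h (toTorus y)).re) 2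
      (volume.restrict periodCell)) atTop (𝓝 0) := by
  have h1 : Tendsto (fun n => eLpNorm
      (⇑(∑ k ∈ s n, d k • UnitAddTorus.mFourierLp (d := Fin 3) 2 k) - ⇑h) 2 volume)
      atTop (𝓝 0) := by
    have := (tendsto_iff_edist_tendsto_0.1 (hd.comp hs))
    simpa only [Function.comp_apply, Lp.edist_def] using this
  refine tendsto_of_tendsto_of_tendsto_of_le_of_le tendsto_const_nhds h1 (fun _ => zero_le)
    fun n => ?_
  have h2 : ⇑(∑ k ∈ s n, d k • UnitAddTorus.mFourierLp (d := Fin 3) 2 k) =ᵐ[volume]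
      fun t => ∑ k ∈ s n, d k * UnitAddTorus.mFourier k t := by
    have h3 : ∀ᵐ t ∂(volume : Measure (UnitAddTorus (Fin 3))), ∀ k ∈ s n,
        (d k • UnitAddTorus.mFourierLp (d := Fin 3) 2 k : Lp ℂ 2 _) t =
          d k * UnitAddTorus.mFourier k t := by
      refine (ae_ball_iff (s n).countable_toSet).2 fun k _ => ?_
      filter_upwards [Lp.coeFn_smul (d k) (UnitAddTorus.mFourierLp (d := Fin 3) 2 k),
        UnitAddTorus.coeFn_mFourierLp (d := Fin 3) 2 k] with t h4 h5
      rw [h4, Pi.smul_apply, h5, smul_eq_mul]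
    filter_upwards [Lp.coeFn_fun_finsetSum (s n) fun k =>
      d k • UnitAddTorus.mFourierLp (d := Fin 3) 2 k, h3] with t h4 h5
    rw [h4]
    exact Finset.sum_congr rfl h5
  have h6 := eLpNorm_re_comp_toTorus_le
    (fun t => ∑ k ∈ s n, d k * UnitAddTorus.mFourier k t - h t)
    ((Continuous.aestronglyMeasurable (by fun_prop)).sub (Lp.aestronglyMeasurable h))
  refine (le_of_eq ?_).trans (h6.trans (le_of_eq (eLpNorm_congr_ae ?_)))
  · simp [reTrigPoly]
  · filter_upwards [h2] with t ht
    rw [Pi.sub_apply, ht]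

/-- Fourier multipliers bounded by one act as contractions on the square integrable functions
of the torus. -/
lemma exists_multiplier (G : Lp ℂ 2 (volume : Measure (UnitAddTorus (Fin 3))))
    {M : (Fin 3 → ℤ) → ℂ} (hM : ∀ k, ‖M k‖ ≤ 1) :
    ∃ h : Lp ℂ 2 (volume : Measure (UnitAddTorus (Fin 3))),
      HasSum (fun k => (M k * UnitAddTorus.mFourierCoeff G k) • UnitAddTorus.mFourierLp 2 k) h ∧
      ‖h‖ ≤ ‖G‖ := by
  set c := UnitAddTorus.mFourierBasis.repr G with hc
  have hle : ∀ k, ‖M k * c k‖ ≤ ‖c k‖ := fun k => by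
    rw [norm_mul]
    exact mul_le_of_le_one_left (norm_nonneg _) (hM k)
  -- By Parseval it suffices to dominate the new coefficients by those of `G`.
  have hmem : Memℓp (fun k => M k * c k) 2 :=
    memℓp_gen <| (lp.memℓp c).summable (by simp) |>.of_nonneg_of_le (fun k => by positivity)
      fun k => by
        have := hle k
        simp only [ENNReal.toReal_ofNat]
        gcongr
  set d : lp (fun _ : Fin 3 → ℤ => ℂ) 2 := ⟨fun k => M k * c k, hmem⟩ with hd
  refine ⟨UnitAddTorus.mFourierBasis.repr.symm d, ?_, ?_⟩
  · have := UnitAddTorus.mFourierBasis.hasSum_repr_symm d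
    simpa [hd, hc, UnitAddTorus.mFourierBasis_repr] using this
  · rw [LinearIsometryEquiv.norm_map, ← UnitAddTorus.mFourierBasis.repr.norm_map G]
    exact lp.norm_mono (by simp) fun k => hle k

end Torus

/-! ### The divergence equation on the torus. -/

section Torus

attribute [local instance] instMeasureSpaceUnitAddCircle

/-- The Fourier multiplier of `∂_j Δ⁻¹`. -/
noncomputable def gradPotentialSymbol (j : Fin 3) (k : Fin 3 → ℤ) : ℂ :=
  k j / (2 * Real.pi * Complex.I * ∑ i, (k i : ℂ) ^ 2)

/-- The Fourier multiplier of `∂_i ∂_j Δ⁻¹`. -/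
noncomputable def rieszSymbol (i j : Fin 3) (k : Fin 3 → ℤ) : ℂ :=
  k i * k j / ∑ i, (k i : ℂ) ^ 2

lemma norm_sum_sq (k : Fin 3 → ℤ) : ‖∑ i, (k i : ℂ) ^ 2‖ = ∑ i, (k i : ℝ) ^ 2 := by
  have : ∑ i, (k i : ℂ) ^ 2 = ((∑ i, (k i : ℝ) ^ 2 : ℝ) : ℂ) := by push_cast; rfl
  rw [this, Complex.norm_real, Real.norm_of_nonneg (Finset.sum_nonneg fun _ _ => sq_nonneg _)]

lemma sq_le_sum_sq (k : Fin 3 → ℤ) (j : Fin 3) : (k j : ℝ) ^ 2 ≤ ∑ i, (k i : ℝ) ^ 2 :=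
  Finset.single_le_sum (f := fun i => (k i : ℝ) ^ 2) (fun _ _ => sq_nonneg _) (Finset.mem_univ j)

/-- `2|k_i k_j| ≤ k_i² + k_j²`; at frequency zero the quotient is `0 / 0 = 0`. -/
lemma norm_rieszSymbol_le (i j : Fin 3) (k : Fin 3 → ℤ) : ‖rieszSymbol i j k‖ ≤ 1 := by
  rw [rieszSymbol, norm_div, norm_sum_sq, norm_mul, Complex.norm_intCast, Complex.norm_intCast]
  refine div_le_one_of_le₀ ?_ (Finset.sum_nonneg fun i _ => sq_nonneg _)
  nlinarith [sq_le_sum_sq k i, sq_le_sum_sq k j, sq_nonneg (|(k i : ℝ)| - |(k j : ℝ)|),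
    sq_abs (k i : ℝ), sq_abs (k j : ℝ)]

/-- Frequencies are integers, so `|k_j| ≤ k_j²`: the gap between frequency zero and the others is
what bounds the field itself, as in Poincaré's inequality. -/
lemma norm_gradPotentialSymbol_le (j : Fin 3) (k : Fin 3 → ℤ) :
    ‖gradPotentialSymbol j k‖ ≤ 1 := by
  rw [gradPotentialSymbol, norm_div, norm_mul, norm_sum_sq, Complex.norm_intCast]
  have h0 : ‖(2 * Real.pi * Complex.I : ℂ)‖ = 2 * Real.pi := by
    simp [abs_of_pos Real.pi_pos]
  rw [h0]
  refine div_le_one_of_le₀ ?_ (by positivity)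
  have h1 : |(k j : ℝ)| ≤ (k j : ℝ) ^ 2 := by
    have := Int.le_self_sq |k j|
    rw [sq_abs] at this
    exact_mod_cast this
  have h2 := sq_le_sum_sq k j
  have h3 : 0 ≤ ∑ i, (k i : ℝ) ^ 2 := Finset.sum_nonneg fun i _ => sq_nonneg _
  nlinarith [Real.pi_gt_three]

lemma mul_gradPotentialSymbol (i j : Fin 3) (k : Fin 3 → ℤ) :
    2 * Real.pi * Complex.I * k i * gradPotentialSymbol j k = rieszSymbol i j k := by
  have : (2 * Real.pi * Complex.I : ℂ) ≠ 0 := by simp [Real.pi_ne_zero]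
  rw [gradPotentialSymbol, rieszSymbol, mul_div_assoc', mul_assoc, mul_div_mul_left _ _ this]

lemma sum_rieszSymbol {k : Fin 3 → ℤ} (hk : k ≠ 0) : ∑ i, rieszSymbol i i k = 1 := by
  have h : ∑ i, (k i : ℂ) ^ 2 ≠ 0 := by
    rw [← norm_ne_zero_iff, norm_sum_sq]
    obtain ⟨j, hj⟩ := Function.ne_iff.1 hk
    have h1 : (0 : ℝ) < (k j : ℝ) ^ 2 := by
      have : (k j : ℝ) ≠ 0 := by exact_mod_cast hj
      positivity
    exact (h1.trans_le (sq_le_sum_sq k j)).ne'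
  simp only [rieszSymbol, ← sq]
  rw [← Finset.sum_div, div_self h]

/-- On the torus every square integrable function of mean zero is the divergence of a field with
square integrable derivatives, which is a limit of smooth periodic fields. -/
theorem exists_periodic_divergence {g : EuclideanSpace ℝ (Fin 3) → ℝ}
    (hg : MemLp g 2 (volume.restrict periodCell)) (h0 : ∫ y in periodCell, g y = 0) :
    ∃ (V : ℕ → EuclideanSpace ℝ (Fin 3) → Fin 3 → ℝ) (p : EuclideanSpace ℝ (Fin 3) → Jet),
      (∀ n m, ContDiff ℝ ∞ fun y => V n y m) ∧
      (∀ n (k : Fin 3 → ℤ) y, V n (y + WithLp.toLp 2 fun i => (k i : ℝ)) = V n y) ∧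
      Measurable p ∧
      Tendsto (fun n => eLpNorm (fun y => jet (V n) y - p y) 2 (volume.restrict periodCell))
        atTop (𝓝 0) ∧
      (∀ᵐ y ∂(volume.restrict periodCell), jetDiv (p y) = g y) ∧
      eLpNorm p 2 (volume.restrict periodCell) ≤
        12 * eLpNorm g 2 (volume.restrict periodCell) := by
  set μ := volume.restrict periodCell with hμ
  have hg' : MemLp (fun t => (g (fromTorus t) : ℂ)) 2
      (volume : Measure (UnitAddTorus (Fin 3))) :=
    (hg.comp_measurePreserving measurePreserving_fromTorus).ofReal
  set G := hg'.toLp with hG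
  have hGcoe : ⇑G =ᵐ[volume] fun t => (g (fromTorus t) : ℂ) := hg'.coeFn_toLp
  have hGnorm : ENNReal.ofReal ‖G‖ = eLpNorm g 2 μ := by
    rw [hG, Lp.norm_toLp, ENNReal.ofReal_toReal hg'.2.ne,
      ← eLpNorm_comp_measurePreserving hg.1 measurePreserving_fromTorus]
    exact eLpNorm_congr_norm_ae (Eventually.of_forall fun t => by simp)
  -- Mean zero enters here: frequency zero is the only one at which the diagonal Riesz symbols do
  -- not sum to one.
  have hc0 : UnitAddTorus.mFourierCoeff G 0 = 0 := by
    rw [UnitAddTorus.mFourierCoeff]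
    simp only [neg_zero, UnitAddTorus.mFourier_zero, ContinuousMap.one_apply, one_smul]
    rw [integral_congr_ae hGcoe, integral_complex_ofReal]
    have : ∫ t : UnitAddTorus (Fin 3), g (fromTorus t) = ∫ y in periodCell, g y := by
      rw [← integral_map measurable_fromTorus.aemeasurable, measurePreserving_fromTorus.map_eq]
      rw [measurePreserving_fromTorus.map_eq]
      exact hg.1
    rw [this, h0]
    simp
  choose h hsum hle using fun j => exists_multiplier G (norm_gradPotentialSymbol_le j)
  choose H Hsum Hle using fun i j => exists_multiplier G (norm_rieszSymbol_le i j)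
  -- One exhaustion of the frequencies serves all components and derivatives, so the truncated
  -- fields and their gradients converge together.
  obtain ⟨s, hs⟩ := exists_seq_tendsto (atTop : Filter (Finset (Fin 3 → ℤ)))
  set V : ℕ → EuclideanSpace ℝ (Fin 3) → Fin 3 → ℝ := fun n y m =>
    reTrigPoly (s n) (fun k => gradPotentialSymbol m k * UnitAddTorus.mFourierCoeff G k) y with hV
  set p : EuclideanSpace ℝ (Fin 3) → Jet := fun y =>
    (fun m => (h m (toTorus y)).re, fun i m => (H i m (toTorus y)).re) with hp
  have hVs : ∀ n m, ContDiff ℝ ∞ fun y => V n y m := fun n m => contDiff_reTrigPoly _ _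
  have hre : ∀ f : Lp ℂ 2 (volume : Measure (UnitAddTorus (Fin 3))),
      Measurable (fun y => (f (toTorus y)).re) := fun f =>
    Complex.measurable_re.comp
      ((Lp.stronglyMeasurable f).measurable.comp measurePreserving_toTorus.measurable)
  have hpm : Measurable p :=
    (measurable_pi_lambda _ fun m => hre _).prodMk
      (measurable_pi_lambda _ fun i => measurable_pi_lambda _ fun m => hre _)
  have hpart : ∀ n i m y, (jet (V n) y).2 i m = reTrigPoly (s n)
      (fun k => rieszSymbol i m k * UnitAddTorus.mFourierCoeff G k) y := fun n i m y => by
    simp only [jet, hV]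
    rw [partialDeriv_reTrigPoly]
    simp only [← mul_assoc, mul_gradPotentialSymbol]
  refine ⟨V, p, hVs, fun n k y => ?_, hpm, ?_, ?_, ?_⟩
  · simp only [hV, reTrigPoly, toTorus_add_int]
  · refine tendsto_of_tendsto_of_tendsto_of_le_of_le tendsto_const_nhds
      (h := fun n => ∑ j, eLpNorm (fun y => (jet (V n) y - p y).1 j) 2 μ +
        ∑ i, ∑ j, eLpNorm (fun y => (jet (V n) y - p y).2 i j) 2 μ) ?_ (fun _ => zero_le)
      fun n => eLpNorm_jet_le ((continuous_jet (hVs n)).aestronglyMeasurable.sub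
        hpm.aestronglyMeasurable)
    have : (0 : ℝ≥0∞) = ∑ _j : Fin 3, 0 + ∑ _i : Fin 3, ∑ _j : Fin 3, 0 := by simp
    rw [this]
    refine Tendsto.add (tendsto_finsetSum _ fun j _ => tendsto_reTrigPoly (hsum j) hs)
      (tendsto_finsetSum _ fun i _ => tendsto_finsetSum _ fun j _ => ?_)
    simp only [Prod.snd_sub, Pi.sub_apply, hpart]
    exact tendsto_reTrigPoly (Hsum i j) hs
  -- The trace of the matrix of Riesz transforms is the identity on functions without zero mode.
  · have hdiv : ∑ i, H i i = G := by
      have h1 := hasSum_sum fun i (_ : i ∈ Finset.univ) => Hsum i i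
      refine h1.unique ?_
      convert UnitAddTorus.hasSum_mFourier_series_L2 G using 2 with k
      rw [← Finset.sum_smul, ← Finset.sum_mul]
      by_cases hk : k = 0
      · simp [hk, hc0]
      · rw [sum_rieszSymbol hk, one_mul]
    have h2 : ∀ᵐ t ∂(volume : Measure (UnitAddTorus (Fin 3))),
        ∑ i, (H i i t).re = g (fromTorus t) := by
      filter_upwards [Lp.coeFn_fun_finsetSum Finset.univ fun i => H i i, hGcoe] with t h3 h4
      rw [hdiv, h4] at h3
      have := congrArg Complex.re h3
      simpa using this.symm
    have h5 := measurePreserving_toTorus.quasiMeasurePreserving.ae h2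
    filter_upwards [h5, ae_restrict_mem measurableSet_periodCell] with y h6 hy
    rw [fromTorus_toTorus hy] at h6
    exact h6
  · have hb : ∀ f : Lp ℂ 2 (volume : Measure (UnitAddTorus (Fin 3))), ‖f‖ ≤ ‖G‖ →
        eLpNorm (fun y => (f (toTorus y)).re) 2 μ ≤ eLpNorm g 2 μ := fun f hf => by
      refine (eLpNorm_re_comp_toTorus_le f (Lp.aestronglyMeasurable f)).trans ?_
      rw [← hGnorm, ← ENNReal.ofReal_toReal (Lp.memLp f).2.ne, ← Lp.norm_def]
      exact ENNReal.ofReal_le_ofReal hf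
    refine (eLpNorm_jet_le hpm.aestronglyMeasurable).trans ?_
    refine (add_le_add (Finset.sum_le_sum fun j _ => hb _ (hle j))
      (Finset.sum_le_sum fun i _ => Finset.sum_le_sum fun j _ => hb _ (Hle i j))).trans ?_
    simp only [Finset.sum_const, Finset.card_univ, Fintype.card_fin, nsmul_eq_mul]
    refine le_of_eq ?_
    push_cast
    ring

end Torus

/-! ### Boxes and the effect of changes of variables on `L²` norms. -/

/-- The open box with corners `a` and `b`. -/
def openBox (a b : Fin 3 → ℝ) : Set (EuclideanSpace ℝ (Fin 3)) := {y | ∀ i, y i ∈ Set.Ioo (a i) (b i)}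

/-- The closed box with corners `a` and `b`. -/
def closedBox (a b : Fin 3 → ℝ) : Set (EuclideanSpace ℝ (Fin 3)) :=
  {y | ∀ i, y i ∈ Set.Icc (a i) (b i)}

lemma openBox_subset_closedBox (a b : Fin 3 → ℝ) : openBox a b ⊆ closedBox a b :=
  fun _ hy i => Set.Ioo_subset_Icc_self (hy i)

lemma isOpen_openBox (a b : Fin 3 → ℝ) : IsOpen (openBox a b) := by
  unfold openBox
  simp only [Set.ofPred_forall]
  exact isOpen_iInter_of_finite fun i => isOpen_Ioo.preimage (by fun_prop)

lemma measurableSet_openBox (a b : Fin 3 → ℝ) : MeasurableSet (openBox a b) :=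
  (isOpen_openBox a b).measurableSet

lemma closedBox_eq_image (a b : Fin 3 → ℝ) :
    closedBox a b = (WithLp.toLp 2) '' (Set.univ.pi fun i => Set.Icc (a i) (b i)) := by
  ext y
  simp only [closedBox, Set.mem_image, Set.mem_univ_pi]
  exact ⟨fun h => ⟨WithLp.ofLp y, h, rfl⟩, by rintro ⟨x, hx, rfl⟩; exact hx⟩

lemma isCompact_closedBox (a b : Fin 3 → ℝ) : IsCompact (closedBox a b) := by
  rw [closedBox_eq_image]
  exact (isCompact_univ_pi fun i => isCompact_Icc).image (PiLp.continuous_toLp 2 _)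

lemma convex_closedBox (a b : Fin 3 → ℝ) : Convex ℝ (closedBox a b) := by
  intro x hx y hy s t hs ht hst i
  exact (convex_Icc (a i) (b i)) (hx i) (hy i) hs ht hst

lemma closedBox_ae_eq_openBox (a b : Fin 3 → ℝ) : closedBox a b =ᵐ[volume] openBox a b := by
  have h := (PiLp.volume_preserving_ofLp (Fin 3)).quasiMeasurePreserving.preimage_ae_eq
    ((Measure.univ_pi_Ioo_ae_eq_Icc (μ := fun _ : Fin 3 => (volume : Measure ℝ))
      (f := a) (g := b)).symm)
  have h1 : closedBox a b = @WithLp.ofLp 2 (Fin 3 → ℝ) ⁻¹' Set.Icc a b := by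
    ext y
    simp [closedBox, Set.mem_Icc, Pi.le_def, forall_and]
  have h2 : openBox a b = @WithLp.ofLp 2 (Fin 3 → ℝ) ⁻¹'
      Set.univ.pi fun i => Set.Ioo (a i) (b i) := by
    ext y
    simp [openBox]
  rw [h1, h2]
  exact h

/-- By the area formula an injective map with `|det| ≥ c⁻¹` shrinks volumes at most by the factor
`c`, applied here to the preimages of measurable sets. -/
lemma map_le_smul_of_det_ge {D D' : Set (EuclideanSpace ℝ (Fin 3))} (hD : MeasurableSet D)
    {S : EuclideanSpace ℝ (Fin 3) → EuclideanSpace ℝ (Fin 3)} (hS : Measurable S)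
    {S' : EuclideanSpace ℝ (Fin 3) → EuclideanSpace ℝ (Fin 3) →L[ℝ] EuclideanSpace ℝ (Fin 3)}
    (hS' : ∀ y ∈ D, HasFDerivAt S (S' y) y) (hinj : Set.InjOn S D) (hmaps : Set.MapsTo S D D')
    {c : ℝ} (hc : 0 < c) (hdet : ∀ y ∈ D, c⁻¹ ≤ |(S' y).det|) :
    Measure.map S (volume.restrict D) ≤ ENNReal.ofReal c • volume.restrict D' := by
  refine Measure.le_iff.2 fun A hA => ?_
  rw [Measure.map_apply hS hA, Measure.restrict_apply (hS hA), Measure.smul_apply,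
    Measure.restrict_apply hA, smul_eq_mul]
  have h1 := lintegral_abs_det_fderiv_eq_addHaar_image volume ((hS hA).inter hD)
    (fun y hy => (hS' y hy.2).hasFDerivWithinAt) (hinj.mono Set.inter_subset_right)
  have h2 : S '' (S ⁻¹' A ∩ D) ⊆ A ∩ D' := by
    rintro _ ⟨y, hy, rfl⟩
    exact ⟨hy.1, hmaps hy.2⟩
  have h3 : ENNReal.ofReal c⁻¹ * volume (S ⁻¹' A ∩ D) ≤ volume (A ∩ D') := by
    refine le_trans ?_ (h1.le.trans (measure_mono h2))
    rw [← setLIntegral_const]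
    exact setLIntegral_mono' ((hS hA).inter hD) fun y hy => ENNReal.ofReal_le_ofReal (hdet y hy.2)
  calc volume (S ⁻¹' A ∩ D) = ENNReal.ofReal c * (ENNReal.ofReal c⁻¹ * volume (S ⁻¹' A ∩ D)) := by
        rw [← mul_assoc, ← ENNReal.ofReal_mul hc.le, mul_inv_cancel₀ hc.ne', ENNReal.ofReal_one,
          one_mul]
    _ ≤ _ := by gcongr

/-- The natural factor is `c ^ (1/2)`; the assumption `1 ≤ c` allows replacing it by `c`. -/
lemma eLpNorm_comp_le_of_map_le {F : Type*} [NormedAddCommGroup F]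
    {μ ν : Measure (EuclideanSpace ℝ (Fin 3))}
    {S : EuclideanSpace ℝ (Fin 3) → EuclideanSpace ℝ (Fin 3)} (hS : Measurable S) {c : ℝ}
    (hc : 1 ≤ c) (h : Measure.map S μ ≤ ENNReal.ofReal c • ν) {f : EuclideanSpace ℝ (Fin 3) → F}
    (hf : AEStronglyMeasurable f ν) :
    eLpNorm (fun y => f (S y)) 2 μ ≤ ENNReal.ofReal c * eLpNorm f 2 ν := by
  have hac : Measure.map S μ ≪ ν :=
    (Measure.absolutelyContinuous_of_le h).trans Measure.smul_absolutelyContinuous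
  have h1 : eLpNorm (fun y => f (S y)) 2 μ = eLpNorm f 2 (Measure.map S μ) :=
    (eLpNorm_map_measure (hf.mono_ac hac) hS.aemeasurable).symm
  rw [h1]
  refine (eLpNorm_mono_measure f h).trans ?_
  rw [eLpNorm_smul_measure_of_ne_top (by simp)]
  rw [smul_eq_mul]
  gcongr
  calc ENNReal.ofReal c ^ (1 / (2 : ℝ≥0∞)).toReal ≤ ENNReal.ofReal c ^ (1 : ℝ) := by
        refine ENNReal.rpow_le_rpow_of_exponent_le (by simpa using hc) ?_
        norm_num
    _ = _ := ENNReal.rpow_one _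

/-- The linear map of `ℝ³` with matrix `M`. -/
noncomputable def matrixCLM (M : Fin 3 → Fin 3 → ℝ) :
    EuclideanSpace ℝ (Fin 3) →L[ℝ] EuclideanSpace ℝ (Fin 3) :=
  LinearMap.toContinuousLinearMap (Matrix.toEuclideanLin (Matrix.of M))

lemma matrixCLM_single (M : Fin 3 → Fin 3 → ℝ) (i n : Fin 3) :
    matrixCLM M (EuclideanSpace.single i 1) n = M n i := by
  simp [matrixCLM, Matrix.toEuclideanLin, Matrix.toLpLin_apply]

lemma det_matrixCLM (M : Fin 3 → Fin 3 → ℝ) : (matrixCLM M).det = (Matrix.of M).det := by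
  rw [ContinuousLinearMap.det, matrixCLM, LinearMap.coe_toContinuousLinearMap]
  rw [Matrix.toEuclideanLin_eq_toLin_orthonormal, LinearMap.det_toLin]

/-- The linear form on `ℝ³` with coefficients `m`. -/
noncomputable def rowCLM (m : Fin 3 → ℝ) : EuclideanSpace ℝ (Fin 3) →L[ℝ] ℝ :=
  ∑ j, m j • (EuclideanSpace.proj j : EuclideanSpace ℝ (Fin 3) →L[ℝ] ℝ)

lemma rowCLM_apply (m : Fin 3 → ℝ) (v : EuclideanSpace ℝ (Fin 3)) :
    rowCLM m v = ∑ j, m j * v j := by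
  simp [rowCLM]

lemma hasFDerivAt_matrixCLM {Ψ : EuclideanSpace ℝ (Fin 3) → EuclideanSpace ℝ (Fin 3)}
    {M : Fin 3 → Fin 3 → ℝ} {x : EuclideanSpace ℝ (Fin 3)}
    (h : ∀ n, HasFDerivAt (fun y => Ψ y n) (rowCLM (M n)) x) :
    HasFDerivAt Ψ (matrixCLM M) x := by
  rw [← hasFDerivWithinAt_univ, hasFDerivWithinAt_euclidean]
  intro n
  rw [hasFDerivWithinAt_univ]
  have e : (EuclideanSpace.proj n : EuclideanSpace ℝ (Fin 3) →L[ℝ] ℝ).comp (matrixCLM M) =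
      rowCLM (M n) := by
    ext v
    simp [matrixCLM, Matrix.toEuclideanLin, Matrix.toLpLin_apply, rowCLM_apply]
    rfl
  have := h n
  rw [← e] at this
  exact this

/-! ### Folding a periodic field so that it vanishes on the faces of the quarter cell. -/

/-- The identity and two orientation reversing maps of `[-1/2, 1/2]` that fix `0` and exchange the
endpoints. -/
noncomputable def foldMap (k : Fin 3) (a : ℝ) : ℝ :=
  ![a, -a, -a - Real.sin (4 * Real.pi * a) / (8 * Real.pi)] k

/-- The derivative of `foldMap k`. -/
noncomputable def foldDeriv (k : Fin 3) (a : ℝ) : ℝ :=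
  ![1, -1, -1 - Real.cos (4 * Real.pi * a) / 2] k

/-- Weights for which `∑ k, foldCoeff k` and `∑ k, foldCoeff k * foldDeriv k a`, for `a` equal to
`0` or `1/2`, vanish. -/
def foldCoeff : Fin 3 → ℝ := ![1, -5, 4]

lemma hasDerivAt_foldMap (k : Fin 3) (a : ℝ) : HasDerivAt (foldMap k) (foldDeriv k a) a := by
  fin_cases k
  · exact hasDerivAt_id a
  · exact (hasDerivAt_id a).neg
  · have h1 : HasDerivAt (fun a : ℝ => 4 * Real.pi * a) (4 * Real.pi) a := by
      simpa using (hasDerivAt_id a).const_mul (4 * Real.pi)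
    have h2 := (hasDerivAt_id a).neg.sub (h1.sin.div_const (8 * Real.pi))
    convert! h2 using 1
    have := Real.pi_ne_zero
    simp [foldDeriv]
    field_simp
    ring

lemma contDiff_foldMap (k : Fin 3) : ContDiff ℝ ∞ (foldMap k) := by
  fin_cases k
  · exact contDiff_id
  · exact contDiff_id.neg
  · exact contDiff_id.neg.sub
      ((Real.contDiff_sin.comp (contDiff_const.mul contDiff_id)).div_const _)

lemma contDiff_foldDeriv (k : Fin 3) : ContDiff ℝ ∞ (foldDeriv k) := by
  fin_cases k
  · exact contDiff_const
  · exact contDiff_const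
  · exact contDiff_const.sub
      ((Real.contDiff_cos.comp (contDiff_const.mul contDiff_id)).div_const _)

lemma half_le_abs_foldDeriv (k : Fin 3) (a : ℝ) : 1 / 2 ≤ |foldDeriv k a| := by
  fin_cases k
  · norm_num [foldDeriv]
  · norm_num [foldDeriv]
  · have := Real.neg_one_le_cos (4 * Real.pi * a)
    simp only [foldDeriv]
    rw [abs_of_nonpos] <;> simp <;> linarith

lemma foldDeriv_neg {k : Fin 3} (hk : k ≠ 0) (a : ℝ) : foldDeriv k a < 0 := by
  fin_cases k
  · exact absurd rfl hk
  · norm_num [foldDeriv]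
  · have := Real.neg_one_le_cos (4 * Real.pi * a)
    simp [foldDeriv]
    linarith

lemma foldMap_strictAnti {k : Fin 3} (hk : k ≠ 0) : StrictAnti (foldMap k) :=
  strictAnti_of_deriv_neg fun a => by
    rw [(hasDerivAt_foldMap k a).deriv]
    exact foldDeriv_neg hk a

lemma foldMap_zero (k : Fin 3) : foldMap k 0 = 0 := by
  fin_cases k <;> simp [foldMap]

lemma sin_two_pi' : Real.sin (4 * Real.pi * (1 / 2)) = 0 := by
  rw [show 4 * Real.pi * (1 / 2) = 2 * Real.pi by ring, Real.sin_two_pi]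

lemma foldMap_half {k : Fin 3} (hk : k ≠ 0) : foldMap k (1 / 2) = -(1 / 2) := by
  fin_cases k
  · exact absurd rfl hk
  · simp [foldMap]
  · simp only [foldMap, sin_two_pi']
    simp

lemma foldMap_neg_half {k : Fin 3} (hk : k ≠ 0) : foldMap k (-(1 / 2)) = 1 / 2 := by
  fin_cases k
  · exact absurd rfl hk
  · simp [foldMap]
  · have : Real.sin (4 * Real.pi * (-(1 / 2))) = 0 := by
      rw [mul_neg, Real.sin_neg, sin_two_pi', neg_zero]
    simp only [foldMap, this]
    simp

lemma foldMap_injective (k : Fin 3) : Function.Injective (foldMap k) := by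
  by_cases hk : k = 0
  · subst hk
    exact fun a b h => h
  · exact (foldMap_strictAnti hk).injective

lemma foldMap_mem {k : Fin 3} {a : ℝ} (ha : a ∈ Set.Ioo (-(1 / 2) : ℝ) (1 / 2)) :
    foldMap k a ∈ Set.Ioo (-(1 / 2) : ℝ) (1 / 2) := by
  by_cases hk : k = 0
  · subst hk
    exact ha
  · have h1 := foldMap_strictAnti hk ha.1
    have h2 := foldMap_strictAnti hk ha.2
    rw [foldMap_neg_half hk] at h1
    rw [foldMap_half hk] at h2
    exact ⟨h2, h1⟩

lemma foldMap_nonpos {k : Fin 3} (hk : k ≠ 0) {a : ℝ} (ha : 0 < a) : foldMap k a < 0 := by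
  have := foldMap_strictAnti hk ha
  rwa [foldMap_zero] at this

lemma sum_foldCoeff : ∑ k, foldCoeff k = 0 := by
  simp [foldCoeff, Fin.sum_univ_three]
  norm_num

/-- At these points the slopes are `1, -1, -3/2`, and `1 + 5 - 6 = 0`. The identity and the
reflection alone would force zero weights, since both the weights and the weights times slopes have
to sum to zero; hence a third map with a different slope. -/
lemma sum_foldCoeff_mul_foldDeriv {a : ℝ} (ha : a = 0 ∨ a = 1 / 2) :
    ∑ k, foldCoeff k * foldDeriv k a = 0 := by
  have : Real.cos (4 * Real.pi * a) = 1 := by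
    rcases ha with rfl | rfl
    · simp
    · rw [show 4 * Real.pi * (1 / 2) = 2 * Real.pi by ring, Real.cos_two_pi]
  simp only [foldCoeff, foldDeriv, Fin.sum_univ_three, this]
  simp
  norm_num

/-- At the points `0` and `1/2` all the maps `foldMap k` agree up to periods. -/
lemma exists_foldMap_eq {a : ℝ} (ha : a = 0 ∨ a = 1 / 2) (k : Fin 3) :
    ∃ n : ℤ, foldMap k a = a + n := by
  rcases ha with rfl | rfl
  · exact ⟨0, by simp [foldMap_zero]⟩
  · by_cases hk : k = 0
    · exact ⟨0, by subst hk; simp [foldMap]⟩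
    · exact ⟨-1, by rw [foldMap_half hk]; norm_num⟩

/-- The simultaneous action of two of the maps `foldMap` on the first and the third coordinate. -/
noncomputable def foldPair (q : Fin 3 × Fin 3) (y : EuclideanSpace ℝ (Fin 3)) :
    EuclideanSpace ℝ (Fin 3) :=
  !₂[foldMap q.1 (y 0), y 1, foldMap q.2 (y 2)]

/-- The Jacobian matrix of `foldPair`. -/
noncomputable def foldJacobian (q : Fin 3 × Fin 3) (y : EuclideanSpace ℝ (Fin 3)) :
    Fin 3 → Fin 3 → ℝ :=
  ![![foldDeriv q.1 (y 0), 0, 0], ![0, 1, 0], ![0, 0, foldDeriv q.2 (y 2)]]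

/-- The columns of the cofactor matrix of `foldPair`, with weights. -/
noncomputable def foldCofactor (q : Fin 3 × Fin 3) (m : Fin 3) (y : EuclideanSpace ℝ (Fin 3)) :
    Fin 3 → ℝ :=
  fun j => foldCoeff q.1 * foldCoeff q.2 *
    ![![foldDeriv q.2 (y 2), 0, 0], ![0, foldDeriv q.1 (y 0) * foldDeriv q.2 (y 2), 0],
      ![0, 0, foldDeriv q.1 (y 0)]] m j

lemma hasFDerivAt_coord (i : Fin 3) (x : EuclideanSpace ℝ (Fin 3)) :
    HasFDerivAt (fun y : EuclideanSpace ℝ (Fin 3) => y i)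
      (EuclideanSpace.proj i : EuclideanSpace ℝ (Fin 3) →L[ℝ] ℝ) x :=
  (EuclideanSpace.proj i : EuclideanSpace ℝ (Fin 3) →L[ℝ] ℝ).hasFDerivAt

lemma contDiff_coord (i : Fin 3) :
    ContDiff ℝ ∞ (fun y : EuclideanSpace ℝ (Fin 3) => y i) :=
  (EuclideanSpace.proj i : EuclideanSpace ℝ (Fin 3) →L[ℝ] ℝ).contDiff

lemma hasFDerivAt_foldPair (q : Fin 3 × Fin 3) (y : EuclideanSpace ℝ (Fin 3)) :
    HasFDerivAt (foldPair q) (matrixCLM (foldJacobian q y)) y := by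
  refine hasFDerivAt_matrixCLM fun n => ?_
  fin_cases n
  · convert! (hasDerivAt_foldMap q.1 (y 0)).comp_hasFDerivAt y (hasFDerivAt_coord 0 y) using 1
    ext v
    simp [rowCLM_apply, foldJacobian, Fin.sum_univ_three]
  · convert! hasFDerivAt_coord 1 y using 1
    ext v
    simp [rowCLM_apply, foldJacobian, Fin.sum_univ_three]
  · convert! (hasDerivAt_foldMap q.2 (y 2)).comp_hasFDerivAt y (hasFDerivAt_coord 2 y) using 1
    ext v
    simp [rowCLM_apply, foldJacobian, Fin.sum_univ_three]

lemma contDiff_foldPair (q : Fin 3 × Fin 3) : ContDiff ℝ ∞ (foldPair q) := by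
  rw [contDiff_euclidean]
  intro i
  fin_cases i
  · exact (contDiff_foldMap q.1).comp (contDiff_coord 0)
  · exact contDiff_coord 1
  · exact (contDiff_foldMap q.2).comp (contDiff_coord 2)

lemma contDiff_foldCofactor (q : Fin 3 × Fin 3) (m j : Fin 3) :
    ContDiff ℝ ∞ fun y => foldCofactor q m y j := by
  have h0 := (contDiff_foldDeriv q.1).comp (contDiff_coord 0)
  have h2 := (contDiff_foldDeriv q.2).comp (contDiff_coord 2)
  refine contDiff_const.mul ?_
  fin_cases m <;> fin_cases j <;>
    first
    | exact contDiff_const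
    | exact h0
    | exact h2
    | exact h0.mul h2

/-- Column `m` has only its entry `m` nonzero, and this entry does not depend on the coordinate `y
m`. -/
lemma jetDiv_foldCofactor (q : Fin 3 × Fin 3) (m : Fin 3) (y : EuclideanSpace ℝ (Fin 3)) :
    jetDiv (jet (foldCofactor q m) y) = 0 := by
  have hD : ∀ k i (z : EuclideanSpace ℝ (Fin 3)), DifferentiableAt ℝ
      (fun y : EuclideanSpace ℝ (Fin 3) => foldDeriv k (y i)) z := fun k i z =>
    (((contDiff_foldDeriv k).comp (contDiff_coord i)).differentiable (by simp)) z
  have hz : ∀ k i j, i ≠ j → ∀ z, fderiv ℝ (fun y : EuclideanSpace ℝ (Fin 3) => foldDeriv k (y i)) z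
      (EuclideanSpace.single j 1) = 0 := by
    intro k i j hij z
    have h1 : DifferentiableAt ℝ (foldDeriv k) (z i) :=
      ((contDiff_foldDeriv k).differentiable (by simp)) _
    have h2 := HasDerivAt.comp_hasFDerivAt (f := fun y : EuclideanSpace ℝ (Fin 3) => y i) z
      h1.hasDerivAt (hasFDerivAt_coord i z)
    change fderiv ℝ (foldDeriv k ∘ fun y : EuclideanSpace ℝ (Fin 3) => y i) z _ = 0
    rw [h2.fderiv]
    simp [hij]
  simp only [jetDiv, jet, partialDeriv, Fin.sum_univ_three, foldCofactor]
  fin_cases m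
  · simp [fderiv_const_mul, hD, hz]
  · simp [fderiv_const_mul, fderiv_fun_mul, hD, hz]
  · simp [fderiv_const_mul, hD, hz]

lemma sum_foldJacobian_mul (q : Fin 3 × Fin 3) (y : EuclideanSpace ℝ (Fin 3)) (n m : Fin 3) :
    ∑ i, foldJacobian q y n i * (jet (foldCofactor q m) y).1 i =
      if n = m then foldCoeff q.1 * foldCoeff q.2 * foldDeriv q.1 (y 0) * foldDeriv q.2 (y 2)
        else 0 := by
  fin_cases n <;> fin_cases m <;>
    simp [foldJacobian, foldCofactor, jet, Fin.sum_univ_three] <;> ring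

/-- The interior of the period cell. -/
def openCell : Set (EuclideanSpace ℝ (Fin 3)) := openBox (fun _ => -(1 / 2)) (fun _ => 1 / 2)

/-- The part of the open period cell where the first and the third coordinate are positive. -/
def quarterCell : Set (EuclideanSpace ℝ (Fin 3)) :=
  openBox ![0, -(1 / 2), 0] (fun _ => 1 / 2)

lemma quarterCell_subset_openCell : quarterCell ⊆ openCell := by
  intro y hy i
  have h := hy i
  fin_cases i
  · exact ⟨by have := h.1; simp at this ⊢; linarith, h.2⟩
  · exact h
  · exact ⟨by have := h.1; simp at this ⊢; linarith, h.2⟩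

lemma openCell_subset_periodCell : openCell ⊆ periodCell := fun y hy i =>
  ⟨(hy i).1, (hy i).2.le.trans (by norm_num)⟩

lemma restrict_periodCell :
    (volume.restrict periodCell : Measure (EuclideanSpace ℝ (Fin 3))) = volume.restrict openCell := by
  refine Measure.restrict_congr_set (EventuallyLE.antisymm ?_
    openCell_subset_periodCell.eventuallyLE)
  have h : periodCell ⊆ closedBox (fun _ => -(1 / 2)) (fun _ => 1 / 2) := fun y hy i =>
    ⟨(hy i).1.le, (hy i).2.trans (by norm_num)⟩
  exact h.eventuallyLE.trans (closedBox_ae_eq_openBox _ _).le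

lemma foldPair_mapsTo (q : Fin 3 × Fin 3) : Set.MapsTo (foldPair q) openCell openCell := by
  intro y hy i
  fin_cases i
  · exact foldMap_mem (hy 0)
  · exact hy 1
  · exact foldMap_mem (hy 2)

lemma foldPair_injective (q : Fin 3 × Fin 3) : Function.Injective (foldPair q) := by
  intro x y h
  ext i
  fin_cases i
  · exact foldMap_injective q.1 (congrArg (fun z : EuclideanSpace ℝ (Fin 3) => z 0) h)
  · have h1 : foldPair q x 1 = foldPair q y 1 :=
      congrArg (fun z : EuclideanSpace ℝ (Fin 3) => z 1) h
    exact h1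
  · exact foldMap_injective q.2 (congrArg (fun z : EuclideanSpace ℝ (Fin 3) => z 2) h)

lemma foldPair_zero (y : EuclideanSpace ℝ (Fin 3)) : foldPair (0, 0) y = y := by
  ext i
  fin_cases i <;> rfl

/-- A nontrivial fold makes a positive first or third coordinate negative. Hence a datum supported
in the quarter cell is seen there only through the identity. -/
lemma foldPair_notMem {q : Fin 3 × Fin 3} (hq : q ≠ (0, 0)) {y : EuclideanSpace ℝ (Fin 3)}
    (hy : y ∈ quarterCell) : foldPair q y ∉ quarterCell := by
  intro h
  by_cases h1 : q.1 = 0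
  · have h2 : q.2 ≠ 0 := fun h2 => hq (Prod.ext h1 h2)
    exact absurd (h 2).1 (not_lt.2 (foldMap_nonpos h2 (hy 2).1).le)
  · exact absurd (h 0).1 (not_lt.2 (foldMap_nonpos h1 (hy 0).1).le)

/-- The Jacobian is a product of two slopes of modulus at least `1/2`, hence the constant `4`. -/
lemma map_foldPair_le (q : Fin 3 × Fin 3) :
    Measure.map (foldPair q) (volume.restrict openCell) ≤
      ENNReal.ofReal 4 • volume.restrict openCell := by
  refine map_le_smul_of_det_ge (measurableSet_openBox _ _)
    (contDiff_foldPair q).continuous.measurable (fun y _ => hasFDerivAt_foldPair q y)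
    (foldPair_injective q).injOn (foldPair_mapsTo q) (by norm_num) fun y _ => ?_
  rw [det_matrixCLM]
  have : (Matrix.of (foldJacobian q y)).det = foldDeriv q.1 (y 0) * foldDeriv q.2 (y 2) := by
    rw [Matrix.det_fin_three]
    simp [foldJacobian]
  rw [this, abs_mul]
  have h1 := half_le_abs_foldDeriv q.1 (y 0)
  have h2 := half_le_abs_foldDeriv q.2 (y 2)
  nlinarith

/-- The action of the folding on jets. -/
noncomputable def foldJet (p : EuclideanSpace ℝ (Fin 3) → Jet) (y : EuclideanSpace ℝ (Fin 3)) :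
    Jet :=
  ∑ q : Fin 3 × Fin 3, piolaJet (foldJacobian q y) (fun m => jet (foldCofactor q m) y)
    (p (foldPair q y))

/-- The folding of a periodic vector field, which makes it vanish on the boundary of the quarter
cell. -/
noncomputable def foldField (V : EuclideanSpace ℝ (Fin 3) → Fin 3 → ℝ)
    (y : EuclideanSpace ℝ (Fin 3)) (j : Fin 3) : ℝ :=
  ∑ q : Fin 3 × Fin 3, ∑ m, foldCofactor q m y j * V (foldPair q y) m

lemma continuous_foldJacobian (q : Fin 3 × Fin 3) (n i : Fin 3) :
    Continuous fun y => foldJacobian q y n i := by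
  have h0 := ((contDiff_foldDeriv q.1).comp (contDiff_coord 0)).continuous
  have h2 := ((contDiff_foldDeriv q.2).comp (contDiff_coord 2)).continuous
  fin_cases n <;> fin_cases i <;>
    first
    | exact continuous_const
    | exact h0
    | exact h2

lemma measurable_foldJet {p : EuclideanSpace ℝ (Fin 3) → Jet} (hp : Measurable p) :
    Measurable (foldJet p) :=
  Finset.measurable_sum _ fun q _ => measurable_piolaJet
    (measurable_pi_lambda _ fun n => measurable_pi_lambda _ fun i =>
      (continuous_foldJacobian q n i).measurable)
    (fun m => (continuous_jet (contDiff_foldCofactor q m)).measurable)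
    (hp.comp (contDiff_foldPair q).continuous.measurable)

lemma foldJet_sub (p p' : EuclideanSpace ℝ (Fin 3) → Jet) (y : EuclideanSpace ℝ (Fin 3)) :
    foldJet p y - foldJet p' y = foldJet (fun z => p z - p' z) y := by
  simp only [foldJet, piolaJet_sub, Finset.sum_sub_distrib]

lemma contDiff_foldField {V : EuclideanSpace ℝ (Fin 3) → Fin 3 → ℝ}
    (hV : ∀ m, ContDiff ℝ ∞ fun y => V y m) (j : Fin 3) :
    ContDiff ℝ ∞ fun y => foldField V y j :=
  ContDiff.sum fun q _ => ContDiff.sum fun m _ =>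
    (contDiff_foldCofactor q m j).mul ((hV m).comp (contDiff_foldPair q))

lemma jet_foldField {V : EuclideanSpace ℝ (Fin 3) → Fin 3 → ℝ}
    (hV : ∀ m, ContDiff ℝ ∞ fun y => V y m) (y : EuclideanSpace ℝ (Fin 3)) :
    jet (foldField V) y = foldJet (jet V) y := by
  have h1 := jet_sum Finset.univ (x := y)
    (V := fun (q : Fin 3 × Fin 3) y j => ∑ m, foldCofactor q m y j * V (foldPair q y) m)
    fun q _ j => (ContDiff.sum fun m _ => (contDiff_foldCofactor q m j).mul
      ((hV m).comp (contDiff_foldPair q))).differentiable (by simp) y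
  refine h1.trans (Finset.sum_congr rfl fun q _ => ?_)
  rw [jet_piola (hasFDerivAt_foldPair q y) (fun m => (hV m).differentiable (by simp) _)
    fun m j => (contDiff_foldCofactor q m j).differentiable (by simp) _]
  simp only [matrixCLM_single]

lemma jetDiv_foldJet (p : EuclideanSpace ℝ (Fin 3) → Jet) (y : EuclideanSpace ℝ (Fin 3)) :
    jetDiv (foldJet p y) = ∑ q : Fin 3 × Fin 3, foldCoeff q.1 * foldCoeff q.2 *
      foldDeriv q.1 (y 0) * foldDeriv q.2 (y 2) * jetDiv (p (foldPair q y)) := by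
  rw [foldJet, jetDiv_sum]
  exact Finset.sum_congr rfl fun q _ =>
    jetDiv_piolaJet (fun m => jetDiv_foldCofactor q m y) (sum_foldJacobian_mul q y) _

lemma exists_norm_piolaJet_fold_le : ∃ C : ℝ, 0 ≤ C ∧ ∀ q, ∀ y ∈ openCell, ∀ p : Jet,
    ‖piolaJet (foldJacobian q y) (fun m => jet (foldCofactor q m) y) p‖ ≤ C * ‖p‖ := by
  have hK := isCompact_closedBox (fun _ => -(1 / 2)) (fun _ => 1 / 2)
  choose c1 hc1 using fun t : (Fin 3 × Fin 3) × Fin 3 × Fin 3 =>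
    hK.exists_bound_of_continuousOn (continuous_foldJacobian t.1 t.2.1 t.2.2).continuousOn
  choose c2 hc2 using fun t : (Fin 3 × Fin 3) × Fin 3 =>
    hK.exists_bound_of_continuousOn (continuous_jet (contDiff_foldCofactor t.1 t.2)).continuousOn
  set c := ∑ t, |c1 t| + ∑ t, |c2 t| with hc
  have hs1 : 0 ≤ ∑ t, |c1 t| := Finset.sum_nonneg fun _ _ => abs_nonneg _
  have hs2 : 0 ≤ ∑ t, |c2 t| := Finset.sum_nonneg fun _ _ => abs_nonneg _
  have h1 : ∀ t, c1 t ≤ c := fun t => (le_abs_self _).trans <|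
    (Finset.single_le_sum (f := fun t => |c1 t|) (fun _ _ => abs_nonneg _)
      (Finset.mem_univ t)).trans (le_add_of_nonneg_right hs2)
  have h2 : ∀ t, c2 t ≤ c := fun t => (le_abs_self _).trans <|
    (Finset.single_le_sum (f := fun t => |c2 t|) (fun _ _ => abs_nonneg _)
      (Finset.mem_univ t)).trans (le_add_of_nonneg_left hs1)
  have hc0 : 0 ≤ c := add_nonneg hs1 hs2
  refine ⟨3 * c + 9 * c ^ 2, by positivity, fun q y hy p => ?_⟩
  have hy' := openBox_subset_closedBox _ _ hy
  exact norm_piolaJet_le hc0 (fun n i => (hc1 (q, n, i) y hy').trans (h1 _))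
    (fun m => (hc2 (q, m) y hy').trans (h2 _)) p

lemma exists_eLpNorm_foldJet_le : ∃ C : ℝ, 1 ≤ C ∧ ∀ p : EuclideanSpace ℝ (Fin 3) → Jet,
    Measurable p → eLpNorm (foldJet p) 2 (volume.restrict openCell) ≤
      ENNReal.ofReal C * eLpNorm p 2 (volume.restrict openCell) := by
  obtain ⟨C, hC, h⟩ := exists_norm_piolaJet_fold_le
  refine ⟨9 * (C * 4) + 1, by linarith, fun p hp => ?_⟩
  have hq : ∀ q : Fin 3 × Fin 3, eLpNorm (fun y => piolaJet (foldJacobian q y)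
      (fun m => jet (foldCofactor q m) y) (p (foldPair q y))) 2 (volume.restrict openCell) ≤
      ENNReal.ofReal (C * 4) * eLpNorm p 2 (volume.restrict openCell) := fun q => by
    refine (eLpNorm_le_mul_eLpNorm_of_ae_le_mul (g := fun y => p (foldPair q y)) (c := C) ?_ 2).trans
      ?_
    · filter_upwards [ae_restrict_mem (measurableSet_openBox _ _)] with y hy
      exact h q y hy _
    · rw [ENNReal.ofReal_mul hC, mul_assoc]
      gcongr
      exact eLpNorm_comp_le_of_map_le (contDiff_foldPair q).continuous.measurable (by norm_num)
        (map_foldPair_le q) hp.aestronglyMeasurable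
  have hsum : foldJet p = ∑ q : Fin 3 × Fin 3, fun y => piolaJet (foldJacobian q y)
      (fun m => jet (foldCofactor q m) y) (p (foldPair q y)) := by
    ext1 y
    simp [foldJet]
  rw [hsum]
  refine (eLpNorm_sum_le (fun q _ => (measurable_piolaJet
    (measurable_pi_lambda _ fun n => measurable_pi_lambda _ fun i =>
      (continuous_foldJacobian q n i).measurable)
    (fun m => (continuous_jet (contDiff_foldCofactor q m)).measurable)
    (hp.comp (contDiff_foldPair q).continuous.measurable)).aestronglyMeasurable)
    one_le_two).trans ?_
  refine (Finset.sum_le_sum fun q _ => hq q).trans ?_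
  rw [Finset.sum_const, Finset.card_univ, Fintype.card_prod, Fintype.card_fin, nsmul_eq_mul,
    ← mul_assoc]
  gcongr
  rw [show (((3 * 3 : ℕ) : ℝ≥0∞)) = ENNReal.ofReal 9 by norm_num,
    ← ENNReal.ofReal_mul (by norm_num)]
  exact ENNReal.ofReal_le_ofReal (by linarith)

/-- On a face the folds in the normal coordinate all give the same point modulo periods, so the
values of `V` factor out of the sum over these folds. What remains is a sum of weights for the
component normal to the face and of weights times slopes for the tangential ones; both vanish. -/
lemma foldField_eq_zero {V : EuclideanSpace ℝ (Fin 3) → Fin 3 → ℝ}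
    (hV : ∀ (k : Fin 3 → ℤ) y, V (y + WithLp.toLp 2 fun i => (k i : ℝ)) = V y)
    {y : EuclideanSpace ℝ (Fin 3)} (hy : (y 0 = 0 ∨ y 0 = 1 / 2) ∨ y 2 = 0 ∨ y 2 = 1 / 2) :
    foldField V y = 0 := by
  ext j
  rw [foldField, Fintype.sum_prod_type, Pi.zero_apply]
  rcases hy with h | h
  · have hper : ∀ k l, V (foldPair (k, l) y) = V (foldPair (0, l) y) := fun k l => by
      obtain ⟨n, hn⟩ := exists_foldMap_eq h k
      rw [← hV ![n, 0, 0] (foldPair (0, l) y)]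
      congr 1
      ext i
      fin_cases i <;> simp [foldPair, hn, show ∀ a, foldMap 0 a = a from fun _ => rfl]
    simp only [hper]
    rw [Finset.sum_comm]
    refine Finset.sum_eq_zero fun l _ => ?_
    rw [Finset.sum_comm]
    refine Finset.sum_eq_zero fun m _ => ?_
    rw [← Finset.sum_mul]
    convert zero_mul _
    have h1 := sum_foldCoeff
    have h2 := sum_foldCoeff_mul_foldDeriv h
    simp only [Fin.sum_univ_three] at h1 h2 ⊢
    fin_cases m <;> fin_cases j <;> simp [foldCofactor]
    · linear_combination foldCoeff l * foldDeriv l (y 2) * h1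
    · linear_combination foldCoeff l * foldDeriv l (y 2) * h2
    · linear_combination foldCoeff l * h2
  · have hper : ∀ k l, V (foldPair (k, l) y) = V (foldPair (k, 0) y) := fun k l => by
      obtain ⟨n, hn⟩ := exists_foldMap_eq h l
      rw [← hV ![0, 0, n] (foldPair (k, 0) y)]
      congr 1
      ext i
      fin_cases i <;> simp [foldPair, hn, show ∀ a, foldMap 0 a = a from fun _ => rfl]
    simp only [hper]
    refine Finset.sum_eq_zero fun k _ => ?_
    rw [Finset.sum_comm]
    refine Finset.sum_eq_zero fun m _ => ?_
    rw [← Finset.sum_mul]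
    convert zero_mul _
    have h1 := sum_foldCoeff
    have h2 := sum_foldCoeff_mul_foldDeriv h
    simp only [Fin.sum_univ_three] at h1 h2 ⊢
    fin_cases m <;> fin_cases j <;> simp [foldCofactor]
    · linear_combination foldCoeff k * h2
    · linear_combination foldCoeff k * foldDeriv k (y 0) * h2
    · linear_combination foldCoeff k * foldDeriv k (y 0) * h1

lemma foldField_periodic {V : EuclideanSpace ℝ (Fin 3) → Fin 3 → ℝ}
    (hV : ∀ (k : Fin 3 → ℤ) y, V (y + WithLp.toLp 2 fun i => (k i : ℝ)) = V y) (n : ℤ)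
    (y : EuclideanSpace ℝ (Fin 3)) :
    foldField V (y + EuclideanSpace.single 1 (n : ℝ)) = foldField V y := by
  have h1 : ∀ q, foldPair q (y + EuclideanSpace.single 1 (n : ℝ)) =
      foldPair q y + WithLp.toLp 2 fun i => ((![0, n, 0] : Fin 3 → ℤ) i : ℝ) := fun q => by
    ext i
    fin_cases i <;> simp [foldPair]
  ext j
  simp only [foldField, h1, hV]
  simp [foldCofactor]

/-- Functions of mean zero on the quarter cell are divergences of limits of smooth fields vanishing
on those faces of the quarter cell which are not identified by periodicity. -/
theorem exists_quarterCell_divergence : ∃ C : ℝ, 1 ≤ C ∧ ∀ g : EuclideanSpace ℝ (Fin 3) → ℝ,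
    MemLp g 2 (volume.restrict quarterCell) → ∫ y in quarterCell, g y = 0 →
    ∃ (W : ℕ → EuclideanSpace ℝ (Fin 3) → Fin 3 → ℝ) (p : EuclideanSpace ℝ (Fin 3) → Jet),
      (∀ n m, ContDiff ℝ ∞ fun y => W n y m) ∧
      (∀ n (k : ℤ) y, W n (y + EuclideanSpace.single 1 (k : ℝ)) = W n y) ∧
      (∀ n (y : EuclideanSpace ℝ (Fin 3)), ((y 0 = 0 ∨ y 0 = 1 / 2) ∨ y 2 = 0 ∨ y 2 = 1 / 2) →
        W n y = 0) ∧
      Measurable p ∧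
      Tendsto (fun n => eLpNorm (fun y => jet (W n) y - p y) 2 (volume.restrict quarterCell))
        atTop (𝓝 0) ∧
      (∀ᵐ y ∂(volume.restrict quarterCell), jetDiv (p y) = g y) ∧
      eLpNorm p 2 (volume.restrict quarterCell) ≤
        ENNReal.ofReal C * eLpNorm g 2 (volume.restrict quarterCell) := by
  obtain ⟨C, hC, hfold⟩ := exists_eLpNorm_foldJet_le
  refine ⟨C * 12, by linarith, fun g hg h0 => ?_⟩
  have hm : MeasurableSet quarterCell := measurableSet_openBox _ _
  have hle : (volume.restrict quarterCell : Measure (EuclideanSpace ℝ (Fin 3))) ≤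
      volume.restrict openCell := Measure.restrict_mono quarterCell_subset_openCell le_rfl
  have hrr : (volume.restrict openCell : Measure (EuclideanSpace ℝ (Fin 3))).restrict quarterCell =
      volume.restrict quarterCell :=
    Measure.restrict_restrict_of_subset quarterCell_subset_openCell
  -- The datum is extended by zero to the period cell, which preserves its norm and its mean.
  have hg1 : MemLp (quarterCell.indicator g) 2 (volume.restrict periodCell) := by
    rw [restrict_periodCell, memLp_indicator_iff_restrict hm, hrr]
    exact hg
  have hg2 : ∫ y in periodCell, quarterCell.indicator g y = 0 := by
    rw [restrict_periodCell, integral_indicator hm, hrr, h0]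
  obtain ⟨V, p, hVs, hVper, hpm, htend, hdiv, hbound⟩ := exists_periodic_divergence hg1 hg2
  rw [restrict_periodCell] at htend hdiv hbound
  refine ⟨fun n => foldField (V n), foldJet p, fun n m => contDiff_foldField (hVs n) m,
    fun n k y => foldField_periodic (hVper n) k y, fun n y hy => foldField_eq_zero (hVper n) hy,
    measurable_foldJet hpm, ?_, ?_, ?_⟩
  · have h1 : Tendsto (fun n => ENNReal.ofReal C *
        eLpNorm (fun y => jet (V n) y - p y) 2 (volume.restrict openCell)) atTop (𝓝 0) := by
      have := ENNReal.Tendsto.const_mul htend (Or.inr (ENNReal.ofReal_ne_top (r := C)))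
      rwa [mul_zero] at this
    refine tendsto_of_tendsto_of_tendsto_of_le_of_le tendsto_const_nhds h1 (fun _ => zero_le)
      fun n => ?_
    simp only [jet_foldField (hVs n), foldJet_sub]
    exact (eLpNorm_mono_measure _ hle).trans
      (hfold _ ((continuous_jet (hVs n)).measurable.sub hpm))
  · have hq : ∀ᵐ y ∂(volume.restrict openCell), ∀ q,
        jetDiv (p (foldPair q y)) = quarterCell.indicator g (foldPair q y) := by
      refine ae_all_iff.2 fun q => ?_
      have hqmp : Measure.QuasiMeasurePreserving (foldPair q) (volume.restrict openCell)
          (volume.restrict openCell) := ⟨(contDiff_foldPair q).continuous.measurable,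
        (Measure.absolutelyContinuous_of_le (map_foldPair_le q)).trans
          Measure.smul_absolutelyContinuous⟩
      exact hqmp.ae hdiv
    filter_upwards [ae_mono hle hq, ae_restrict_mem hm] with y h1 hy
    -- Only the identity fold contributes, with weight `1` and Jacobian `1`.
    rw [jetDiv_foldJet, Finset.sum_eq_single (0, 0)]
    · rw [h1, foldPair_zero, Set.indicator_of_mem hy]
      simp [foldCoeff, foldDeriv]
    · intro q _ hq
      rw [h1, Set.indicator_of_notMem (foldPair_notMem hq hy), mul_zero]
    · simp
  · refine (eLpNorm_mono_measure _ hle).trans ((hfold p hpm).trans ?_)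
    rw [ENNReal.ofReal_mul (by linarith), mul_assoc]
    gcongr
    refine hbound.trans ?_
    rw [eLpNorm_indicator_eq_eLpNorm_restrict hm, hrr]
    simp

/-! ### Cutting off fields that vanish on the faces. -/

lemma deriv_smoothTransition_of_one_lt {u : ℝ} (hu : 1 < u) : deriv Real.smoothTransition u = 0 := by
  have : Real.smoothTransition =ᶠ[𝓝 u] fun _ => 1 := by
    filter_upwards [lt_mem_nhds hu] with v hv
    exact Real.smoothTransition.one_of_one_le hv.le
  rw [this.deriv_eq, deriv_const]

lemma deriv_smoothTransition_of_neg {u : ℝ} (hu : u < 0) : deriv Real.smoothTransition u = 0 := by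
  have : Real.smoothTransition =ᶠ[𝓝 u] fun _ => 0 := by
    filter_upwards [gt_mem_nhds hu] with v hv
    exact Real.smoothTransition.zero_of_nonpos hv.le
  rw [this.deriv_eq, deriv_const]

lemma exists_deriv_smoothTransition_bound :
    ∃ M : ℝ, 0 ≤ M ∧ ∀ u, |deriv Real.smoothTransition u| ≤ M := by
  have hc : Continuous (deriv Real.smoothTransition) :=
    (Real.smoothTransition.contDiff (n := 1)).continuous_deriv le_rfl
  obtain ⟨M, hM⟩ := (isCompact_Icc (a := (0 : ℝ)) (b := 1)).exists_bound_of_continuousOn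
    hc.continuousOn
  refine ⟨|M|, abs_nonneg _, fun u => ?_⟩
  rcases lt_or_ge u 0 with h | h
  · rw [deriv_smoothTransition_of_neg h, abs_zero]
    exact abs_nonneg _
  rcases lt_or_ge 1 u with h' | h'
  · rw [deriv_smoothTransition_of_one_lt h', abs_zero]
    exact abs_nonneg _
  exact (hM u ⟨h, h'⟩).trans (le_abs_self _)

/-- A cutoff function supported in `[1 / n, 1 / 2 - 1 / n]`. -/
noncomputable def intervalCutoff (n : ℕ) (a : ℝ) : ℝ :=
  Real.smoothTransition (n * a - 1) * Real.smoothTransition (n * (1 / 2 - a) - 1)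

lemma contDiff_intervalCutoff (n : ℕ) : ContDiff ℝ ∞ (intervalCutoff n) :=
  (Real.smoothTransition.contDiff.comp (by fun_prop)).mul
    (Real.smoothTransition.contDiff.comp (by fun_prop))

lemma abs_intervalCutoff_le (n : ℕ) (a : ℝ) : |intervalCutoff n a| ≤ 1 := by
  rw [intervalCutoff, abs_mul, abs_of_nonneg (Real.smoothTransition.nonneg _),
    abs_of_nonneg (Real.smoothTransition.nonneg _)]
  exact mul_le_one₀ (Real.smoothTransition.le_one _) (Real.smoothTransition.nonneg _)
    (Real.smoothTransition.le_one _)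

lemma intervalCutoff_eq_zero {n : ℕ} (hn : 0 < n) {a : ℝ}
    (ha : a < 1 / n ∨ 1 / 2 - 1 / n < a) : intervalCutoff n a = 0 := by
  have hn' : (0 : ℝ) < n := by exact_mod_cast hn
  rcases ha with h | h
  · rw [intervalCutoff, Real.smoothTransition.zero_of_nonpos, zero_mul]
    rw [lt_div_iff₀ hn'] at h
    linarith
  · rw [intervalCutoff, mul_comm, Real.smoothTransition.zero_of_nonpos, zero_mul]
    have h1 : 1 / 2 - a < 1 / n := by linarith
    rw [lt_div_iff₀ hn'] at h1
    linarith

lemma eventually_intervalCutoff_eq_one {a : ℝ} (ha : a ∈ Set.Ioo (0 : ℝ) (1 / 2)) :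
    ∀ᶠ n : ℕ in atTop, ∀ᶠ b in 𝓝 a, intervalCutoff n b = 1 := by
  have hmin : 0 < min a (1 / 2 - a) := lt_min ha.1 (by linarith [ha.2])
  -- Both factors equal one at distance at least `2 / n` from the endpoints. On the neighbourhood of
  -- `a` used below, the distance to each endpoint exceeds half the distance from `a`.
  obtain ⟨N, hN⟩ := exists_nat_gt (4 / min a (1 / 2 - a))
  filter_upwards [eventually_ge_atTop N] with n hn
  have hn' : 4 / min a (1 / 2 - a) < n := hN.trans_le (by exact_mod_cast hn)
  rw [div_lt_iff₀ hmin] at hn'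
  have hn0 : (0 : ℝ) ≤ n := Nat.cast_nonneg n
  filter_upwards [lt_mem_nhds (show a / 2 < a by linarith [ha.1]),
    gt_mem_nhds (show a < a / 2 + 1 / 4 by linarith [ha.2])] with b h1 h2
  have h3 := min_le_left a (1 / 2 - a)
  have h4 := min_le_right a (1 / 2 - a)
  rw [intervalCutoff, Real.smoothTransition.one_of_one_le, Real.smoothTransition.one_of_one_le,
    one_mul]
  · nlinarith
  · nlinarith

/-- The derivative of the cutoff has size `n`, but it lives within distance `2 / n` of the
endpoints, where `|w|` is at most `2 * L / n`. The product is therefore bounded uniformly in `n`. -/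
lemma exists_deriv_intervalCutoff_bound : ∃ M : ℝ, 0 ≤ M ∧ ∀ (n : ℕ) (a w : ℝ),
    a ∈ Set.Ioo (0 : ℝ) (1 / 2) → ∀ L : ℝ, 0 ≤ L → |w| ≤ L * a → |w| ≤ L * (1 / 2 - a) →
      |deriv (intervalCutoff n) a * w| ≤ M * L := by
  obtain ⟨M, hM0, hM⟩ := exists_deriv_smoothTransition_bound
  refine ⟨4 * M, by positivity, fun n a w ha L hL h1 h2 => ?_⟩
  have hd : ∀ u, HasDerivAt Real.smoothTransition (deriv Real.smoothTransition u) u := fun u =>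
    ((Real.smoothTransition.contDiff (n := 1)).differentiable (by simp) u).hasDerivAt
  have hn0 : (0 : ℝ) ≤ n := Nat.cast_nonneg n
  have e1 : HasDerivAt (fun a : ℝ => Real.smoothTransition (n * a - 1))
      (deriv Real.smoothTransition (n * a - 1) * n) a := by
    refine (hd _).comp a ?_
    simpa using ((hasDerivAt_id a).const_mul (n : ℝ)).sub_const 1
  have e2 : HasDerivAt (fun a : ℝ => Real.smoothTransition (n * (1 / 2 - a) - 1))
      (deriv Real.smoothTransition (n * (1 / 2 - a) - 1) * (-n)) a := by
    refine (hd _).comp a ?_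
    simpa using (((hasDerivAt_id a).const_sub (1 / 2 : ℝ)).const_mul (n : ℝ)).sub_const 1
  have key : ∀ t, 0 ≤ t → |w| ≤ L * t →
      |deriv Real.smoothTransition (n * t - 1) * n * w| ≤ 2 * M * L := by
    intro t ht hw
    -- Either the transition is already constant, or `n * t ≤ 2`.
    rcases lt_or_ge 1 (n * t - 1) with h | h
    · rw [deriv_smoothTransition_of_one_lt h]
      simp
      positivity
    · rw [abs_mul, abs_mul, abs_of_nonneg hn0]
      calc |deriv Real.smoothTransition (n * t - 1)| * n * |w|
          ≤ M * n * (L * t) := by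
            gcongr
            exact hM _
        _ = M * L * (n * t) := by ring
        _ ≤ M * L * 2 := by
            gcongr
            linarith
        _ = _ := by ring
  have hprod := e1.mul e2
  rw [show intervalCutoff n = (fun a : ℝ => Real.smoothTransition (n * a - 1)) *
    fun a : ℝ => Real.smoothTransition (n * (1 / 2 - a) - 1) from rfl, hprod.deriv]
  have k1 := key a ha.1.le h1
  have k2 := key (1 / 2 - a) (by linarith [ha.2]) h2
  have s1 : |Real.smoothTransition (n * a - 1)| ≤ 1 := by
    rw [abs_of_nonneg (Real.smoothTransition.nonneg _)]
    exact Real.smoothTransition.le_one _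
  have s2 : |Real.smoothTransition (n * (1 / 2 - a) - 1)| ≤ 1 := by
    rw [abs_of_nonneg (Real.smoothTransition.nonneg _)]
    exact Real.smoothTransition.le_one _
  calc _ = |deriv Real.smoothTransition (n * a - 1) * n * w *
          Real.smoothTransition (n * (1 / 2 - a) - 1) +
        -(deriv Real.smoothTransition (n * (1 / 2 - a) - 1) * n * w *
          Real.smoothTransition (n * a - 1))| := by
        congr 1
        ring
    _ ≤ 2 * M * L * 1 + 2 * M * L * 1 := by
        refine (abs_add_le _ _).trans (add_le_add ?_ ?_)
        · rw [abs_mul]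
          exact mul_le_mul k1 s2 (abs_nonneg _) (by positivity)
        · rw [abs_neg, abs_mul]
          exact mul_le_mul k2 s1 (abs_nonneg _) (by positivity)
    _ = 4 * M * L := by ring

/-- The field `W` multiplied by cutoffs in the first and the third coordinate. -/
noncomputable def cutoffField (n : ℕ) (W : EuclideanSpace ℝ (Fin 3) → Fin 3 → ℝ)
    (y : EuclideanSpace ℝ (Fin 3)) (j : Fin 3) : ℝ :=
  intervalCutoff n (y 0) * intervalCutoff n (y 2) * W y j

lemma contDiff_cutoff (n : ℕ) : ContDiff ℝ ∞ fun y : EuclideanSpace ℝ (Fin 3) =>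
    intervalCutoff n (y 0) * intervalCutoff n (y 2) :=
  ((contDiff_intervalCutoff n).comp (contDiff_coord 0)).mul
    ((contDiff_intervalCutoff n).comp (contDiff_coord 2))

lemma contDiff_cutoffField (n : ℕ) {W : EuclideanSpace ℝ (Fin 3) → Fin 3 → ℝ}
    (hW : ∀ m, ContDiff ℝ ∞ fun y => W y m) (j : Fin 3) :
    ContDiff ℝ ∞ fun y => cutoffField n W y j :=
  (contDiff_cutoff n).mul (hW j)

lemma partialDeriv_cutoffField (n : ℕ) {W : EuclideanSpace ℝ (Fin 3) → Fin 3 → ℝ}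
    (hW : ∀ m, ContDiff ℝ ∞ fun y => W y m) (i j : Fin 3) (y : EuclideanSpace ℝ (Fin 3)) :
    partialDeriv i (fun y => cutoffField n W y j) y =
      ![deriv (intervalCutoff n) (y 0) * W y j * intervalCutoff n (y 2), 0,
        deriv (intervalCutoff n) (y 2) * W y j * intervalCutoff n (y 0)] i +
      intervalCutoff n (y 0) * intervalCutoff n (y 2) * partialDeriv i (fun y => W y j) y := by
  have hd : ∀ a, HasDerivAt (intervalCutoff n) (deriv (intervalCutoff n) a) a := fun a =>
    ((contDiff_intervalCutoff n).differentiable (by simp) a).hasDerivAt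
  have h0 := HasDerivAt.comp_hasFDerivAt (f := fun y : EuclideanSpace ℝ (Fin 3) => y 0) y
    (hd (y 0)) (hasFDerivAt_coord 0 y)
  have h2 := HasDerivAt.comp_hasFDerivAt (f := fun y : EuclideanSpace ℝ (Fin 3) => y 2) y
    (hd (y 2)) (hasFDerivAt_coord 2 y)
  have h := (h0.mul h2).mul ((hW j).differentiable (by simp) y).hasFDerivAt
  refine (partialDeriv_eq_of_hasFDerivAt h i).trans ?_
  simp only [partialDeriv]
  fin_cases i <;> simp <;> ring

/-- A smooth field is Lipschitz on the closed box; compare its value at `y` with its value zero at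
the projection of `y` to a face along the coordinate `i`. -/
lemma exists_bound_of_vanishing {W : EuclideanSpace ℝ (Fin 3) → Fin 3 → ℝ}
    (hW : ∀ m, ContDiff ℝ ∞ fun y => W y m)
    (h0 : ∀ y : EuclideanSpace ℝ (Fin 3), ((y 0 = 0 ∨ y 0 = 1 / 2) ∨ y 2 = 0 ∨ y 2 = 1 / 2) →
      W y = 0) :
    ∃ L : ℝ, 0 ≤ L ∧ ∀ y ∈ quarterCell, ∀ j, ∀ i, i = 0 ∨ i = 2 →
      |W y j| ≤ L * y i ∧ |W y j| ≤ L * (1 / 2 - y i) := by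
  have hWc : ContDiff ℝ ∞ W := contDiff_pi.2 hW
  obtain ⟨L, hL⟩ := hWc.contDiffOn.exists_lipschitzOnWith (by simp)
    (convex_closedBox ![0, -(1 / 2), 0] fun _ => 1 / 2) (isCompact_closedBox _ _)
  refine ⟨L, L.2, fun y hy j i hi => ?_⟩
  have hy' := openBox_subset_closedBox _ _ hy
  have hlow : ∀ k, (![0, -(1 / 2), 0] : Fin 3 → ℝ) k ≤ 1 / 2 := fun k =>
    (hy' k).1.trans (hy' k).2
  have hi0 : (![0, -(1 / 2), 0] : Fin 3 → ℝ) i = 0 := by rcases hi with rfl | rfl <;> rfl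
  have hyi := hy i
  rw [hi0] at hyi
  have key : ∀ a : ℝ, a = 0 ∨ a = 1 / 2 → |W y j| ≤ L * |y i - a| := by
    intro a ha
    have hz : y + EuclideanSpace.single i (a - y i) ∈
        closedBox ![0, -(1 / 2), 0] fun _ => 1 / 2 := by
      intro k
      by_cases hk : k = i
      · subst hk
        have : (y + EuclideanSpace.single k (a - y k)) k = a := by simp
        rw [this, hi0]
        rcases ha with rfl | rfl <;> norm_num
      · have : (y + EuclideanSpace.single i (a - y i)) k = y k := by simp [hk]
        rw [this]
        exact hy' k
    have hz0 : W (y + EuclideanSpace.single i (a - y i)) = 0 := by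
      refine h0 _ ?_
      have : (y + EuclideanSpace.single i (a - y i)) i = a := by simp
      rcases hi with rfl | rfl
      · left
        rwa [this]
      · right
        rwa [this]
    have h1 := hL.dist_le_mul y hy' _ hz
    rw [hz0, dist_zero_right, dist_eq_norm, sub_add_cancel_left, norm_neg,
      PiLp.norm_single, Real.norm_eq_abs, abs_sub_comm] at h1
    exact (norm_le_pi_norm (W y) j).trans h1
  constructor
  · have := key 0 (Or.inl rfl)
    rwa [sub_zero, abs_of_pos hyi.1] at this
  · have := key (1 / 2) (Or.inr rfl)
    rwa [abs_sub_comm, abs_of_pos (sub_pos.2 hyi.2)] at this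

lemma exists_norm_jet_cutoffField_le {W : EuclideanSpace ℝ (Fin 3) → Fin 3 → ℝ}
    (hW : ∀ m, ContDiff ℝ ∞ fun y => W y m)
    (h0 : ∀ y : EuclideanSpace ℝ (Fin 3), ((y 0 = 0 ∨ y 0 = 1 / 2) ∨ y 2 = 0 ∨ y 2 = 1 / 2) →
      W y = 0) :
    ∃ C : ℝ, ∀ n, ∀ y ∈ quarterCell, ‖jet (cutoffField n W) y - jet W y‖ ≤ C := by
  obtain ⟨L, hL0, hL⟩ := exists_bound_of_vanishing hW h0
  obtain ⟨M, hM0, hM⟩ := exists_deriv_intervalCutoff_bound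
  obtain ⟨C, hC⟩ := (isCompact_closedBox ![0, -(1 / 2), 0] fun _ => 1 / 2).exists_bound_of_continuousOn
    (continuous_jet hW).continuousOn
  refine ⟨(M * L + |C|) + |C|, fun n y hy => ?_⟩
  have hCy : ‖jet W y‖ ≤ |C| := (hC y (openBox_subset_closedBox _ _ hy)).trans (le_abs_self _)
  refine (norm_sub_le _ _).trans (add_le_add ?_ hCy)
  have hc : |intervalCutoff n (y 0) * intervalCutoff n (y 2)| ≤ 1 := by
    rw [abs_mul]
    exact mul_le_one₀ (abs_intervalCutoff_le _ _) (abs_nonneg _) (abs_intervalCutoff_le _ _)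
  have hML : 0 ≤ M * L := mul_nonneg hM0 hL0
  have hmul : ∀ w, |w| ≤ ‖jet W y‖ →
      |intervalCutoff n (y 0) * intervalCutoff n (y 2) * w| ≤ |C| := fun w hw => by
    rw [abs_mul]
    exact (mul_le_of_le_one_left (abs_nonneg _) hc).trans (hw.trans hCy)
  refine jet_norm_le (by positivity) (fun j => ?_) fun i j => ?_
  · exact (hmul _ (abs_fst_le_norm (jet W y) j)).trans (le_add_of_nonneg_left hML)
  · change |partialDeriv i (fun y => cutoffField n W y j) y| ≤ _
    rw [partialDeriv_cutoffField n hW]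
    refine (abs_add_le _ _).trans (add_le_add ?_ (hmul _ (abs_snd_le_norm (jet W y) i j)))
    have hb : ∀ a b : ℝ, |a| ≤ M * L → |b| ≤ 1 → |a * b| ≤ M * L := fun a b ha hb => by
      rw [abs_mul]
      exact (mul_le_of_le_one_right (abs_nonneg _) hb).trans ha
    fin_cases i
    · exact hb _ _ (hM n _ _ (hy 0) L hL0 (hL y hy j 0 (Or.inl rfl)).1
        (hL y hy j 0 (Or.inl rfl)).2) (abs_intervalCutoff_le _ _)
    · simpa using hML
    · exact hb _ _ (hM n _ _ (hy 2) L hL0 (hL y hy j 2 (Or.inr rfl)).1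
        (hL y hy j 2 (Or.inr rfl)).2) (abs_intervalCutoff_le _ _)

lemma eventually_jet_cutoffField_eq (W : EuclideanSpace ℝ (Fin 3) → Fin 3 → ℝ)
    {y : EuclideanSpace ℝ (Fin 3)} (hy : y ∈ quarterCell) :
    ∀ᶠ n in atTop, jet (cutoffField n W) y = jet W y := by
  filter_upwards [eventually_intervalCutoff_eq_one (hy 0), eventually_intervalCutoff_eq_one (hy 2)]
    with n h0 h2
  have c0 : ContinuousAt (fun z : EuclideanSpace ℝ (Fin 3) => z 0) y :=
    (contDiff_coord 0).continuous.continuousAt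
  have c2 : ContinuousAt (fun z : EuclideanSpace ℝ (Fin 3) => z 2) y :=
    (contDiff_coord 2).continuous.continuousAt
  have h : ∀ᶠ z in 𝓝 y, cutoffField n W z = W z := by
    filter_upwards [c0.eventually h0, c2.eventually h2] with z h0 h2
    ext j
    rw [cutoffField, h0, h2, one_mul, one_mul]
  refine Prod.ext h.self_of_nhds ?_
  ext i j
  have hj : (fun z => cutoffField n W z j) =ᶠ[𝓝 y] fun z => W z j := by
    filter_upwards [h] with z hz
    rw [hz]
  simp only [jet, partialDeriv, hj.fderiv_eq]

lemma volume_openBox_lt_top (a b : Fin 3 → ℝ) : volume (openBox a b) < ⊤ :=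
  (measure_mono (openBox_subset_closedBox a b)).trans_lt (isCompact_closedBox a b).measure_lt_top

/-- Dominated convergence: the difference of jets is bounded uniformly in `n` and, at each point of
the cell, eventually zero. -/
lemma tendsto_jet_cutoffField {W : EuclideanSpace ℝ (Fin 3) → Fin 3 → ℝ}
    (hW : ∀ m, ContDiff ℝ ∞ fun y => W y m)
    (h0 : ∀ y : EuclideanSpace ℝ (Fin 3), ((y 0 = 0 ∨ y 0 = 1 / 2) ∨ y 2 = 0 ∨ y 2 = 1 / 2) →
      W y = 0) :
    Tendsto (fun n => eLpNorm (fun y => jet (cutoffField n W) y - jet W y) 2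
      (volume.restrict quarterCell)) atTop (𝓝 0) := by
  obtain ⟨C, hC⟩ := exists_norm_jet_cutoffField_le hW h0
  have hmem := ae_restrict_mem (μ := (volume : Measure (EuclideanSpace ℝ (Fin 3))))
    (measurableSet_openBox ![0, -(1 / 2), 0] fun _ => 1 / 2)
  have key : Tendsto (fun n => ∫⁻ y, ‖jet (cutoffField n W) y - jet W y‖ₑ ^ (2 : ℝ)
      ∂(volume.restrict quarterCell)) atTop (𝓝 0) := by
    have := tendsto_lintegral_of_dominated_convergence (μ := volume.restrict quarterCell)
      (F := fun n y => ‖jet (cutoffField n W) y - jet W y‖ₑ ^ (2 : ℝ)) (f := fun _ => 0)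
      (fun _ => ENNReal.ofReal C ^ (2 : ℝ)) (fun n => ?_) (fun n => ?_) ?_ ?_
    · simpa using this
    · exact (((continuous_jet (contDiff_cutoffField n hW)).sub
        (continuous_jet hW)).measurable.enorm).pow_const _
    · filter_upwards [hmem] with y hy
      refine ENNReal.rpow_le_rpow ?_ (by norm_num)
      rw [← ofReal_norm]
      exact ENNReal.ofReal_le_ofReal (hC n y hy)
    · rw [lintegral_const, Measure.restrict_apply_univ]
      exact ENNReal.mul_ne_top (by simp) (volume_openBox_lt_top _ _).ne
    · filter_upwards [hmem] with y hy
      refine tendsto_const_nhds.congr' ?_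
      filter_upwards [eventually_jet_cutoffField_eq W hy] with n hn
      rw [hn]
      simp
  have h2 : Tendsto (fun t : ℝ≥0∞ => t ^ (1 / 2 : ℝ)) (𝓝 0) (𝓝 0) := by
    have := (ENNReal.continuous_rpow_const (y := 1 / 2)).tendsto 0
    simpa using this
  refine (h2.comp key).congr fun n => ?_
  rw [eLpNorm_eq_lintegral_rpow_enorm_toReal (by simp) (by simp)]
  simp

/-- Functions of mean zero on the quarter cell are divergences of limits of smooth fields with
support away from those faces of the quarter cell which are not identified by periodicity. -/
theorem exists_quarterCell_divergence_of_support : ∃ C : ℝ, 1 ≤ C ∧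
    ∀ g : EuclideanSpace ℝ (Fin 3) → ℝ,
    MemLp g 2 (volume.restrict quarterCell) → ∫ y in quarterCell, g y = 0 →
    ∃ (W : ℕ → EuclideanSpace ℝ (Fin 3) → Fin 3 → ℝ) (p : EuclideanSpace ℝ (Fin 3) → Jet),
      (∀ n m, ContDiff ℝ ∞ fun y => W n y m) ∧
      (∀ n (k : ℤ) y, W n (y + EuclideanSpace.single 1 (k : ℝ)) = W n y) ∧
      (∀ n, ∃ δ > 0, ∀ y : EuclideanSpace ℝ (Fin 3),
        ((y 0 < δ ∨ 1 / 2 - δ < y 0) ∨ y 2 < δ ∨ 1 / 2 - δ < y 2) → W n y = 0) ∧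
      Measurable p ∧
      Tendsto (fun n => eLpNorm (fun y => jet (W n) y - p y) 2 (volume.restrict quarterCell))
        atTop (𝓝 0) ∧
      (∀ᵐ y ∂(volume.restrict quarterCell), jetDiv (p y) = g y) ∧
      eLpNorm p 2 (volume.restrict quarterCell) ≤
        ENNReal.ofReal C * eLpNorm g 2 (volume.restrict quarterCell) := by
  obtain ⟨C, hC, h⟩ := exists_quarterCell_divergence
  refine ⟨C, hC, fun g hg h0 => ?_⟩
  obtain ⟨W, p, hWs, hper, hzero, hpm, htend, hdiv, hbound⟩ := h g hg h0
  -- A diagonal choice: the cutoff error of the `n`-th field is made at most `1 / (n + 1)`.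
  -- Positivity of `N` makes `1 / N` an admissible margin `δ`.
  have hN : ∀ n : ℕ, ∃ N : ℕ, 0 < N ∧
      eLpNorm (fun y => jet (cutoffField N (W n)) y - jet (W n) y) 2
        (volume.restrict quarterCell) ≤ ((n : ℝ≥0∞) + 1)⁻¹ := fun n => by
    have hev := (tendsto_order.1 (tendsto_jet_cutoffField (hWs n) (hzero n))).2 ((n : ℝ≥0∞) + 1)⁻¹
      (ENNReal.inv_pos.2 (by finiteness))
    obtain ⟨N, h1, h2⟩ := (hev.and (eventually_gt_atTop 0)).exists
    exact ⟨N, h2, h1.le⟩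
  choose N hN0 hN using hN
  refine ⟨fun n => cutoffField (N n) (W n), p, fun n m => contDiff_cutoffField _ (hWs n) m,
    fun n k y => ?_, fun n => ⟨1 / N n, by have := hN0 n; positivity, fun y hy => ?_⟩, hpm, ?_,
    hdiv, hbound⟩
  · ext j
    simp [cutoffField, hper]
  · ext j
    change intervalCutoff (N n) (y 0) * intervalCutoff (N n) (y 2) * W n y j = 0
    rcases hy with hy | hy
    · rw [intervalCutoff_eq_zero (hN0 n) hy, zero_mul, zero_mul]
    · rw [intervalCutoff_eq_zero (hN0 n) hy, mul_zero, zero_mul]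
  · have hlim : Tendsto (fun n : ℕ => ((n : ℝ≥0∞) + 1)⁻¹ +
        eLpNorm (fun y => jet (W n) y - p y) 2 (volume.restrict quarterCell)) atTop (𝓝 0) := by
      have h1 : Tendsto (fun n : ℕ => ((n : ℝ≥0∞) + 1)⁻¹) atTop (𝓝 0) := by
        have := (tendsto_add_atTop_iff_nat 1).2 ENNReal.tendsto_inv_nat_nhds_zero
        simpa using this
      simpa using h1.add htend
    refine tendsto_of_tendsto_of_tendsto_of_le_of_le tendsto_const_nhds hlim (fun _ => zero_le)
      fun n => ?_
    have hc := continuous_jet (contDiff_cutoffField (N n) (hWs n))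
    have hc' := continuous_jet (hWs n)
    have := eLpNorm_add_le (μ := volume.restrict quarterCell) (p := 2)
      (f := fun y => jet (cutoffField (N n) (W n)) y - jet (W n) y)
      (g := fun y => jet (W n) y - p y) (hc.sub hc').aestronglyMeasurable
      (hc'.measurable.sub hpm).aestronglyMeasurable one_le_two
    refine le_trans (le_of_eq ?_) (this.trans (add_le_add (hN n) le_rfl))
    congr 1
    ext1 y
    simp

/-! ### Cylindrical coordinates adapted to the aperture. -/

lemma horizontalNorm_nonneg (x : EuclideanSpace ℝ (Fin 3)) : 0 ≤ horizontalNorm x := Real.sqrt_nonneg _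

lemma horizontalNorm_sq (x : EuclideanSpace ℝ (Fin 3)) :
    horizontalNorm x ^ 2 = x 0 ^ 2 + x 1 ^ 2 := Real.sq_sqrt (by positivity)

lemma continuous_horizontalNorm : Continuous horizontalNorm := by
  unfold horizontalNorm
  fun_prop

lemma contDiffAt_horizontalNorm_rpow {x : EuclideanSpace ℝ (Fin 3)} (hx : 0 < horizontalNorm x)
    (β : ℝ) : ContDiffAt ℝ ∞ (fun y => horizontalNorm y ^ β) x := by
  refine ContDiffAt.rpow_const_of_ne ?_ hx.ne'
  refine ContDiffAt.sqrt (((contDiff_coord 0).pow 2).add ((contDiff_coord 1).pow 2)).contDiffAt ?_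
  rw [← horizontalNorm_sq]
  positivity

lemma rpow_sub_one_mul {r : ℝ} (hr : 0 < r) (β : ℝ) : r ^ (β - 1) * r = r ^ β := by
  rw [← Real.rpow_add_one hr.ne']
  congr 1
  ring

lemma rpow_sub_two_mul {r : ℝ} (hr : 0 < r) (β : ℝ) : r ^ (β - 2) * r ^ 2 = r ^ β := by
  rw [← Real.rpow_natCast, ← Real.rpow_add hr]
  congr 1
  push_cast
  ring

lemma hasFDerivAt_horizontalNorm_rpow {x : EuclideanSpace ℝ (Fin 3)} (hx : 0 < horizontalNorm x)
    (β : ℝ) : HasFDerivAt (fun y => horizontalNorm y ^ β)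
      (rowCLM ![β * horizontalNorm x ^ (β - 2) * x 0, β * horizontalNorm x ^ (β - 2) * x 1, 0]) x := by
  have hq : x 0 ^ 2 + x 1 ^ 2 ≠ 0 := by
    rw [← horizontalNorm_sq]
    positivity
  have h1 := (((hasFDerivAt_coord 0 x).pow 2).add ((hasFDerivAt_coord 1 x).pow 2)).sqrt hq
  have h2 := h1.rpow_const (p := β) (Or.inl hx.ne')
  convert! h2 using 1
  ext v
  have h3 := rpow_sub_one_mul hx (β - 1)
  have e : √(x 0 ^ 2 + x 1 ^ 2) = horizontalNorm x := rfl
  simp only [Pi.add_apply, e, rowCLM_apply, Fin.sum_univ_three]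
  rw [show β - 1 - 1 = β - 2 by ring] at h3
  simp
  rw [← h3]
  field_simp

/-- Cylindrical coordinates on the aperture domain with `R = 1`. -/
noncomputable def cylMap (α : ℝ) (y : EuclideanSpace ℝ (Fin 3)) : EuclideanSpace ℝ (Fin 3) :=
  !₂[(1 + 2 * y 0) * Real.cos (2 * Real.pi * y 1), (1 + 2 * y 0) * Real.sin (2 * Real.pi * y 1),
    (1 + 2 * y 0) ^ α * (4 * y 2 - 1)]

/-- The Jacobian matrix of `cylMap`. -/
noncomputable def cylMapJacobian (α : ℝ) (y : EuclideanSpace ℝ (Fin 3)) : Fin 3 → Fin 3 → ℝ :=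
  ![![2 * Real.cos (2 * Real.pi * y 1),
      -((1 + 2 * y 0) * (2 * Real.pi) * Real.sin (2 * Real.pi * y 1)), 0],
    ![2 * Real.sin (2 * Real.pi * y 1),
      (1 + 2 * y 0) * (2 * Real.pi) * Real.cos (2 * Real.pi * y 1), 0],
    ![2 * α * (1 + 2 * y 0) ^ (α - 1) * (4 * y 2 - 1), 0, 4 * (1 + 2 * y 0) ^ α]]

/-- The inverse of `cylMap`. -/
noncomputable def cylCoord (α : ℝ) (x : EuclideanSpace ℝ (Fin 3)) : EuclideanSpace ℝ (Fin 3) :=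
  !₂[(horizontalNorm x - 1) / 2, Complex.arg ⟨x 0, x 1⟩ / (2 * Real.pi),
    (x 2 * horizontalNorm x ^ (-α) + 1) / 4]

/-- Another branch of the inverse of `cylMap`. -/
noncomputable def cylCoordOpp (α : ℝ) (x : EuclideanSpace ℝ (Fin 3)) : EuclideanSpace ℝ (Fin 3) :=
  !₂[(horizontalNorm x - 1) / 2, Complex.arg (-⟨x 0, x 1⟩) / (2 * Real.pi) + 1 / 2,
    (x 2 * horizontalNorm x ^ (-α) + 1) / 4]

/-- The Jacobian matrix of `cylCoord`. -/
noncomputable def cylCoordJacobian (α : ℝ) (x : EuclideanSpace ℝ (Fin 3)) : Fin 3 → Fin 3 → ℝ :=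
  ![![x 0 * horizontalNorm x ^ (-1 : ℝ) / 2, x 1 * horizontalNorm x ^ (-1 : ℝ) / 2, 0],
    ![-(x 1 * horizontalNorm x ^ (-2 : ℝ) / (2 * Real.pi)),
      x 0 * horizontalNorm x ^ (-2 : ℝ) / (2 * Real.pi), 0],
    ![-(α * x 2 * horizontalNorm x ^ (-α - 2) * x 0 / 4),
      -(α * x 2 * horizontalNorm x ^ (-α - 2) * x 1 / 4), horizontalNorm x ^ (-α) / 4]]

/-- The columns of the cofactor matrix of `cylCoord`. -/
noncomputable def cylCofactor (α : ℝ) (m : Fin 3) (x : EuclideanSpace ℝ (Fin 3)) : Fin 3 → ℝ :=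
  ![![1 / (8 * Real.pi) * horizontalNorm x ^ (-α - 2) * x 0,
      1 / (8 * Real.pi) * horizontalNorm x ^ (-α - 2) * x 1,
      α / (8 * Real.pi) * horizontalNorm x ^ (-α - 2) * x 2],
    ![-1 / 8 * horizontalNorm x ^ (-α - 1) * x 1, 1 / 8 * horizontalNorm x ^ (-α - 1) * x 0, 0],
    ![0, 0, 1 / (4 * Real.pi) * horizontalNorm x ^ (-1 : ℝ)]] m

/-- The product of the Jacobian matrix with its adjugate; the diagonal value is the Jacobian
determinant of `cylCoord`. -/
lemma sum_cylCoordJacobian_mul (α : ℝ) {x : EuclideanSpace ℝ (Fin 3)} (hx : 0 < horizontalNorm x)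
    (n m : Fin 3) : ∑ i, cylCoordJacobian α x n i * (jet (cylCofactor α m) x).1 i =
      if n = m then horizontalNorm x ^ (-α - 1) / (16 * Real.pi) else 0 := by
  have hπ := Real.pi_ne_zero
  have hsq := horizontalNorm_sq x
  have h1 := rpow_sub_one_mul hx (-α - 1)
  have h2 := rpow_sub_two_mul hx (-α)
  have h3 := rpow_sub_one_mul hx 0
  have h5 := rpow_sub_one_mul hx (-α)
  rw [show -α - 1 - 1 = -α - 2 by ring] at h1
  rw [Real.rpow_zero, zero_sub] at h3
  have hr := hx.ne'
  have h3' : horizontalNorm x ^ (-1 : ℝ) = 1 / horizontalNorm x := by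
    field_simp
    exact h3
  have hq : x 0 ^ 2 + x 1 ^ 2 ≠ 0 := by
    rw [← hsq]
    positivity
  fin_cases n <;> fin_cases m <;>
    simp [cylCoordJacobian, cylCofactor, jet, Fin.sum_univ_three]
  · rw [h3', ← h1]
    field_simp
    linear_combination -16 * hsq
  · ring
  · ring
  · rw [hsq]
    field_simp
    ring
  · rw [← h2]
    linear_combination α * x 2 * horizontalNorm x ^ (-α - 2) * horizontalNorm x ^ (-α - 2) /
      (32 * Real.pi) * hsq
  · ring
  · rw [h3', ← h5]
    field_simp
    norm_num

lemma contDiffAt_cylCofactor (α : ℝ) {x : EuclideanSpace ℝ (Fin 3)} (hx : 0 < horizontalNorm x)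
    (m j : Fin 3) : ContDiffAt ℝ ∞ (fun y => cylCofactor α m y j) x := by
  have h : ∀ (c β : ℝ) (i : Fin 3), ContDiffAt ℝ ∞
      (fun y : EuclideanSpace ℝ (Fin 3) => c * horizontalNorm y ^ β * y i) x := fun c β i =>
    (contDiffAt_const.mul (contDiffAt_horizontalNorm_rpow hx β)).mul (contDiff_coord i).contDiffAt
  fin_cases m <;> fin_cases j
  · exact h _ _ _
  · exact h _ _ _
  · exact h _ _ _
  · exact h _ _ _
  · exact h _ _ _
  · exact contDiffAt_const
  · exact contDiffAt_const
  · exact contDiffAt_const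
  · exact contDiffAt_const.mul (contDiffAt_horizontalNorm_rpow hx _)

/-- In column `0` the horizontal part `r^(-α-2) x_h` has divergence `-α r^(-α-2)`, cancelled by the
vertical part `α r^(-α-2) x_3`. Column `1` is a rotation field times a radial function, and column
`2` is vertical and independent of `x_3`. -/
lemma jetDiv_cylCofactor (α : ℝ) {x : EuclideanSpace ℝ (Fin 3)} (hx : 0 < horizontalNorm x)
    (m : Fin 3) : jetDiv (jet (cylCofactor α m) x) = 0 := by
  have hsq := horizontalNorm_sq x
  have h : ∀ (c β : ℝ) (i k : Fin 3), partialDeriv k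
      (fun y : EuclideanSpace ℝ (Fin 3) => c * horizontalNorm y ^ β * y i) x =
      c * horizontalNorm x ^ β * (if i = k then 1 else 0) + x i * (c * (![β * horizontalNorm x ^ (β - 2) * x 0,
        β * horizontalNorm x ^ (β - 2) * x 1, 0] : Fin 3 → ℝ) k) := fun c β i k => by
    refine (partialDeriv_eq_of_hasFDerivAt
      (((hasFDerivAt_horizontalNorm_rpow hx β).const_mul c).mul (hasFDerivAt_coord i x)) k).trans ?_
    fin_cases k <;> simp [rowCLM_apply]
  have hc : ∀ k, partialDeriv k (fun _ : EuclideanSpace ℝ (Fin 3) => (0 : ℝ)) x = 0 := fun k => by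
    simp [partialDeriv]
  fin_cases m
  · change ∑ i, partialDeriv i (fun y => cylCofactor α 0 y i) x = 0
    rw [Fin.sum_univ_three]
    refine (congrArg₂ _ (congrArg₂ _ (h _ _ 0 0) (h _ _ 1 1)) (h _ _ 2 2)).trans ?_
    rw [← rpow_sub_two_mul hx (-α - 2), hsq]
    simp
    ring
  · change ∑ i, partialDeriv i (fun y => cylCofactor α 1 y i) x = 0
    rw [Fin.sum_univ_three]
    refine (congrArg₂ _ (congrArg₂ _ (h _ _ 1 0) (h _ _ 0 1)) (hc 2)).trans ?_
    simp
    ring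
  · change ∑ i, partialDeriv i (fun y => cylCofactor α 2 y i) x = 0
    rw [Fin.sum_univ_three]
    refine (congrArg₂ _ (congrArg₂ _ (hc 0) (hc 1)) (partialDeriv_eq_of_hasFDerivAt
      ((hasFDerivAt_horizontalNorm_rpow hx (-1)).const_mul (1 / (4 * Real.pi))) 2)).trans ?_
    simp [rowCLM_apply]

lemma hasFDerivAt_cylMap (α : ℝ) {y : EuclideanSpace ℝ (Fin 3)} (hy : 0 < 1 + 2 * y 0) :
    HasFDerivAt (cylMap α) (matrixCLM (cylMapJacobian α y)) y := by
  have h0 : HasFDerivAt (fun y : EuclideanSpace ℝ (Fin 3) => 1 + 2 * y 0)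
      ((2 : ℝ) • (EuclideanSpace.proj 0 : EuclideanSpace ℝ (Fin 3) →L[ℝ] ℝ)) y :=
    ((hasFDerivAt_coord 0 y).const_mul 2).const_add 1
  have h1 : HasFDerivAt (fun y : EuclideanSpace ℝ (Fin 3) => 2 * Real.pi * y 1)
      ((2 * Real.pi) • (EuclideanSpace.proj 1 : EuclideanSpace ℝ (Fin 3) →L[ℝ] ℝ)) y :=
    (hasFDerivAt_coord 1 y).const_mul _
  have h2 : HasFDerivAt (fun y : EuclideanSpace ℝ (Fin 3) => 4 * y 2 - 1)
      ((4 : ℝ) • (EuclideanSpace.proj 2 : EuclideanSpace ℝ (Fin 3) →L[ℝ] ℝ)) y :=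
    ((hasFDerivAt_coord 2 y).const_mul 4).sub_const 1
  refine hasFDerivAt_matrixCLM fun n => ?_
  fin_cases n
  · convert! h0.mul h1.cos using 1
    ext v
    simp [rowCLM_apply, cylMapJacobian, Fin.sum_univ_three]
    ring
  · convert! h0.mul h1.sin using 1
    ext v
    simp [rowCLM_apply, cylMapJacobian, Fin.sum_univ_three]
    ring
  · convert! (h0.rpow_const (p := α) (Or.inl hy.ne')).mul h2 using 1
    ext v
    simp [rowCLM_apply, cylMapJacobian, Fin.sum_univ_three]
    ring

lemma det_cylMapJacobian (α : ℝ) (y : EuclideanSpace ℝ (Fin 3)) :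
    (matrixCLM (cylMapJacobian α y)).det =
      16 * Real.pi * ((1 + 2 * y 0) ^ α * (1 + 2 * y 0)) := by
  rw [det_matrixCLM, Matrix.det_fin_three]
  simp [cylMapJacobian]
  linear_combination 16 * Real.pi * ((1 + 2 * y 0) ^ α * (1 + 2 * y 0)) *
    Real.sin_sq_add_cos_sq (2 * Real.pi * y 1)

lemma horizontalNorm_cylMap (α : ℝ) {y : EuclideanSpace ℝ (Fin 3)} (hy : 0 < 1 + 2 * y 0) :
    horizontalNorm (cylMap α y) = 1 + 2 * y 0 := by
  rw [horizontalNorm, Real.sqrt_eq_iff_mul_self_eq (by positivity) hy.le]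
  simp [cylMap]
  linear_combination (1 + 2 * y 0) ^ 2 * Real.sin_sq_add_cos_sq (2 * Real.pi * y 1)

lemma cylCoord_cylMap (α : ℝ) {y : EuclideanSpace ℝ (Fin 3)} (hy : 0 < 1 + 2 * y 0)
    (hy1 : y 1 ∈ Set.Ioc (-(1 / 2) : ℝ) (1 / 2)) : cylCoord α (cylMap α y) = y := by
  have hr := horizontalNorm_cylMap α hy
  have hπ := Real.pi_pos
  ext i
  fin_cases i
  · change (horizontalNorm (cylMap α y) - 1) / 2 = y 0
    rw [hr]
    ring
  · change Complex.arg ⟨(1 + 2 * y 0) * Real.cos (2 * Real.pi * y 1),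
      (1 + 2 * y 0) * Real.sin (2 * Real.pi * y 1)⟩ / (2 * Real.pi) = y 1
    have : (⟨(1 + 2 * y 0) * Real.cos (2 * Real.pi * y 1),
        (1 + 2 * y 0) * Real.sin (2 * Real.pi * y 1)⟩ : ℂ) = ((1 + 2 * y 0 : ℝ) : ℂ) *
        (Complex.cos ((2 * Real.pi * y 1 : ℝ) : ℂ) +
          Complex.sin ((2 * Real.pi * y 1 : ℝ) : ℂ) * Complex.I) := by
      rw [← Complex.ofReal_cos, ← Complex.ofReal_sin]
      apply Complex.ext
      · simp only [Complex.add_re, Complex.ofReal_re, Complex.mul_re,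
          Complex.ofReal_im, Complex.I_re, Complex.I_im]
        ring
      · simp only [Complex.add_im, Complex.ofReal_re, Complex.mul_im,
          Complex.ofReal_im, Complex.I_re, Complex.I_im]
        ring
    rw [this, Complex.arg_mul_cos_add_sin_mul_I hy ⟨by nlinarith [hy1.1], by nlinarith [hy1.2]⟩]
    field_simp
  · change ((1 + 2 * y 0) ^ α * (4 * y 2 - 1) * horizontalNorm (cylMap α y) ^ (-α) + 1) / 4 = y 2
    rw [hr, Real.rpow_neg hy.le]
    have := (Real.rpow_pos_of_pos hy α).ne'
    field_simp
    ring

lemma cylMap_cylCoord (α : ℝ) {x : EuclideanSpace ℝ (Fin 3)} (hx : 0 < horizontalNorm x) :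
    cylMap α (cylCoord α x) = x := by
  have hr : 1 + 2 * cylCoord α x 0 = horizontalNorm x := by
    change 1 + 2 * ((horizontalNorm x - 1) / 2) = _
    ring
  have ht : 2 * Real.pi * cylCoord α x 1 = Complex.arg ⟨x 0, x 1⟩ := by
    change 2 * Real.pi * (Complex.arg ⟨x 0, x 1⟩ / (2 * Real.pi)) = _
    have := Real.pi_ne_zero
    field_simp
  have hn : ‖(⟨x 0, x 1⟩ : ℂ)‖ = horizontalNorm x := by
    rw [Complex.norm_def, Complex.normSq_mk, horizontalNorm]
    congr 1
    ring
  ext i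
  fin_cases i
  · change (1 + 2 * cylCoord α x 0) * Real.cos (2 * Real.pi * cylCoord α x 1) = x 0
    rw [hr, ht, ← hn, Complex.norm_mul_cos_arg]
  · change (1 + 2 * cylCoord α x 0) * Real.sin (2 * Real.pi * cylCoord α x 1) = x 1
    rw [hr, ht, ← hn, Complex.norm_mul_sin_arg]
  · change (1 + 2 * cylCoord α x 0) ^ α *
      (4 * ((x 2 * horizontalNorm x ^ (-α) + 1) / 4) - 1) = x 2
    rw [hr, Real.rpow_neg hx.le]
    have := (Real.rpow_pos_of_pos hx α).ne'
    field_simp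
    ring

/-- The argument is the imaginary part of the logarithm, whose derivative off the slit is
multiplication by `z⁻¹`. -/
lemma hasFDerivAt_arg {x : EuclideanSpace ℝ (Fin 3)}
    (hx : (⟨x 0, x 1⟩ : ℂ) ∈ Complex.slitPlane) :
    HasFDerivAt (fun y : EuclideanSpace ℝ (Fin 3) => Complex.arg ⟨y 0, y 1⟩)
      (rowCLM ![-(x 1 * horizontalNorm x ^ (-2 : ℝ)), x 0 * horizontalNorm x ^ (-2 : ℝ), 0]) x := by
  set L : EuclideanSpace ℝ (Fin 3) →L[ℝ] ℂ :=
    Complex.ofRealCLM.comp (EuclideanSpace.proj 0 : EuclideanSpace ℝ (Fin 3) →L[ℝ] ℝ) +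
      (Complex.I • Complex.ofRealCLM.comp
        (EuclideanSpace.proj 1 : EuclideanSpace ℝ (Fin 3) →L[ℝ] ℝ)) with hL
  have hLx : ∀ y, L y = ⟨y 0, y 1⟩ := fun y => by
    apply Complex.ext <;> simp [hL]
  have hx' : L x ∈ Complex.slitPlane := by rwa [hLx]
  have h1 : HasFDerivAt (fun y => Complex.log (L y))
      (((L x)⁻¹ • (1 : ℂ →L[ℝ] ℂ)).comp L) x :=
    (Complex.hasStrictFDerivAt_log_real hx').hasFDerivAt.comp x L.hasFDerivAt
  have h2 := Complex.imCLM.hasFDerivAt.comp x h1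
  have h3 : (Complex.imCLM ∘ fun y => Complex.log (L y)) =
      fun y : EuclideanSpace ℝ (Fin 3) => Complex.arg ⟨y 0, y 1⟩ := by
    ext y
    simp [hLx, Complex.log_im]
  rw [h3] at h2
  have hr : (0 : ℝ) < x 0 ^ 2 + x 1 ^ 2 := by
    have := Complex.normSq_pos.2 (Complex.slitPlane_ne_zero hx)
    rw [Complex.normSq_mk] at this
    nlinarith
  have hx0 : 0 < horizontalNorm x := Real.sqrt_pos.2 hr
  have h4 := rpow_sub_two_mul hx0 0
  rw [zero_sub, Real.rpow_zero, horizontalNorm_sq] at h4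
  have h4' : horizontalNorm x ^ (-2 : ℝ) = 1 / (x 0 ^ 2 + x 1 ^ 2) := by
    field_simp
    exact h4
  convert! h2 using 1
  ext v
  rw [rowCLM_apply, h4']
  simp [hLx, Fin.sum_univ_three, Complex.inv_im, Complex.inv_re, Complex.normSq_mk]
  field_simp
  ring

lemma hasFDerivAt_cylCoord (α : ℝ) {x : EuclideanSpace ℝ (Fin 3)} (hx : 0 < horizontalNorm x)
    (hs : (⟨x 0, x 1⟩ : ℂ) ∈ Complex.slitPlane) :
    HasFDerivAt (cylCoord α) (matrixCLM (cylCoordJacobian α x)) x := by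
  refine hasFDerivAt_matrixCLM fun n => ?_
  fin_cases n
  · have h := ((hasFDerivAt_horizontalNorm_rpow hx 1).sub_const 1).mul_const (1 / 2)
    simp only [Real.rpow_one] at h
    have he : (fun y => (cylCoord α y) 0) = fun y => (horizontalNorm y - 1) * (1 / 2) := by
      ext y
      change (horizontalNorm y - 1) / 2 = _
      ring
    change HasFDerivAt (fun y => (cylCoord α y) 0) _ _
    rw [he]
    convert! h using 1
    ext v
    simp [rowCLM_apply, cylCoordJacobian, Fin.sum_univ_three]
    norm_num
    ring
  · have h := (hasFDerivAt_arg hs).mul_const (1 / (2 * Real.pi))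
    have he : (fun y => (cylCoord α y) 1) =
        fun y : EuclideanSpace ℝ (Fin 3) => Complex.arg ⟨y 0, y 1⟩ * (1 / (2 * Real.pi)) := by
      ext y
      change Complex.arg ⟨y 0, y 1⟩ / (2 * Real.pi) = _
      ring
    change HasFDerivAt (fun y => (cylCoord α y) 1) _ _
    rw [he]
    convert! h using 1
    ext v
    simp [rowCLM_apply, cylCoordJacobian, Fin.sum_univ_three]
    ring
  · have h := (((hasFDerivAt_coord 2 x).mul
      (hasFDerivAt_horizontalNorm_rpow hx (-α))).add_const 1).mul_const (1 / 4)
    have he : (fun y => (cylCoord α y) 2) = fun y : EuclideanSpace ℝ (Fin 3) =>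
        (y 2 * horizontalNorm y ^ (-α) + 1) * (1 / 4) := by
      ext y
      change (y 2 * horizontalNorm y ^ (-α) + 1) / 4 = _
      ring
    change HasFDerivAt (fun y => (cylCoord α y) 2) _ _
    rw [he]
    convert! h using 1
    ext v
    simp [rowCLM_apply, cylCoordJacobian, Fin.sum_univ_three]
    ring

lemma continuous_complex_mk :
    Continuous fun y : EuclideanSpace ℝ (Fin 3) => (⟨y 0, y 1⟩ : ℂ) :=
  Complex.equivRealProdCLM.symm.continuous.comp
    ((contDiff_coord 0).continuous.prodMk (contDiff_coord 1).continuous)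

lemma measurable_euclidean_of_coord {S : EuclideanSpace ℝ (Fin 3) → EuclideanSpace ℝ (Fin 3)}
    (h : ∀ i, Measurable fun y => S y i) : Measurable S :=
  (PiLp.volume_preserving_toLp (Fin 3)).measurable.comp (measurable_pi_iff.2 h)

lemma measurable_coord (i : Fin 3) : Measurable fun y : EuclideanSpace ℝ (Fin 3) => y i :=
  (contDiff_coord i).continuous.measurable

lemma measurable_horizontalNorm_rpow (β : ℝ) :
    Measurable fun y : EuclideanSpace ℝ (Fin 3) => horizontalNorm y ^ β :=
  continuous_horizontalNorm.measurable.pow_const β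

lemma measurable_cylMap (α : ℝ) : Measurable (cylMap α) := by
  have h0 := measurable_coord 0
  have h1 := measurable_coord 1
  have h2 := measurable_coord 2
  refine measurable_euclidean_of_coord fun i => ?_
  fin_cases i
  · exact ((h0.const_mul 2).const_add 1).mul (Real.measurable_cos.comp (h1.const_mul _))
  · exact ((h0.const_mul 2).const_add 1).mul (Real.measurable_sin.comp (h1.const_mul _))
  · exact (((h0.const_mul 2).const_add 1).pow_const α).mul ((h2.const_mul 4).sub_const 1)

lemma measurable_cylCoord (α : ℝ) : Measurable (cylCoord α) := by
  refine measurable_euclidean_of_coord fun i => ?_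
  fin_cases i
  · exact (continuous_horizontalNorm.measurable.sub_const 1).div_const 2
  · exact (Complex.measurable_arg.comp continuous_complex_mk.measurable).div_const _
  · exact (((measurable_coord 2).mul (measurable_horizontalNorm_rpow _)).add_const 1).div_const 4

lemma measurable_cylCofactor (α : ℝ) (m : Fin 3) : Measurable (cylCofactor α m) := by
  have hr := measurable_horizontalNorm_rpow
  have hx := measurable_coord
  refine measurable_pi_iff.2 fun j => ?_
  fin_cases m <;> fin_cases j <;>
    first
    | exact measurable_const
    | exact ((hr _).const_mul _).mul (hx _)
    | exact (hr _).const_mul _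

lemma continuousAt_cylCoordJacobian (α : ℝ) {x : EuclideanSpace ℝ (Fin 3)}
    (hx : 0 < horizontalNorm x) (n i : Fin 3) :
    ContinuousAt (fun y => cylCoordJacobian α y n i) x := by
  have hr : ∀ β : ℝ, ContinuousAt (fun y => horizontalNorm y ^ β) x := fun β =>
    (contDiffAt_horizontalNorm_rpow hx β).continuousAt
  have hc : ∀ i, ContinuousAt (fun y : EuclideanSpace ℝ (Fin 3) => y i) x := fun i =>
    (contDiff_coord i).continuous.continuousAt
  fin_cases n <;> fin_cases i
  · exact ((hc 0).mul (hr _)).div_const _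
  · exact ((hc 1).mul (hr _)).div_const _
  · exact continuousAt_const
  · exact (((hc 1).mul (hr _)).div_const _).neg
  · exact ((hc 0).mul (hr _)).div_const _
  · exact continuousAt_const
  · exact ((((continuousAt_const.mul (hc 2)).mul (hr _)).mul (hc 0)).div_const _).neg
  · exact ((((continuousAt_const.mul (hc 2)).mul (hr _)).mul (hc 1)).div_const _).neg
  · exact (hr _).div_const _

lemma measurable_cylCoordJacobian (α : ℝ) : Measurable (cylCoordJacobian α) := by
  have hr := measurable_horizontalNorm_rpow
  have hx := measurable_coord
  refine measurable_pi_iff.2 fun n => measurable_pi_iff.2 fun i => ?_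
  fin_cases n <;> fin_cases i
  · exact ((hx 0).mul (hr _)).div_const _
  · exact ((hx 1).mul (hr _)).div_const _
  · exact measurable_const
  · exact (((hx 1).mul (hr _)).div_const _).neg
  · exact ((hx 0).mul (hr _)).div_const _
  · exact measurable_const
  · exact (((((hx 2).const_mul _).mul (hr _)).mul (hx 0)).div_const _).neg
  · exact (((((hx 2).const_mul _).mul (hr _)).mul (hx 1)).div_const _).neg
  · exact (hr _).div_const _

lemma contDiffAt_arg {x : EuclideanSpace ℝ (Fin 3)}
    (hx : (⟨x 0, x 1⟩ : ℂ) ∈ Complex.slitPlane) :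
    ContDiffAt ℝ ∞ (fun y : EuclideanSpace ℝ (Fin 3) => Complex.arg ⟨y 0, y 1⟩) x := by
  have h1 : ContDiff ℝ ∞ fun y : EuclideanSpace ℝ (Fin 3) => (⟨y 0, y 1⟩ : ℂ) :=
    Complex.equivRealProdCLM.symm.contDiff.comp ((contDiff_coord 0).prodMk (contDiff_coord 1))
  have h2 : ContDiffAt ℝ ∞ Complex.log (⟨x 0, x 1⟩ : ℂ) :=
    (Complex.contDiffAt_log hx).restrict_scalars ℝ
  have h3 := Complex.imCLM.contDiff.contDiffAt.comp x (h2.comp x h1.contDiffAt)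
  simpa only [Function.comp_def, Complex.imCLM_apply, Complex.log_im] using h3

lemma contDiffAt_cylCoord (α : ℝ) {x : EuclideanSpace ℝ (Fin 3)} (hx : 0 < horizontalNorm x)
    (hs : (⟨x 0, x 1⟩ : ℂ) ∈ Complex.slitPlane) : ContDiffAt ℝ ∞ (cylCoord α) x := by
  have h1 := contDiffAt_horizontalNorm_rpow hx 1
  simp only [Real.rpow_one] at h1
  rw [contDiffAt_euclidean]
  intro i
  fin_cases i
  · exact (h1.sub contDiffAt_const).div_const 2
  · exact (contDiffAt_arg hs).div_const _
  · exact (((contDiff_coord 2).contDiffAt.mul (contDiffAt_horizontalNorm_rpow hx _)).add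
      contDiffAt_const).div_const 4

lemma contDiffAt_cylCoordOpp (α : ℝ) {x : EuclideanSpace ℝ (Fin 3)} (hx : 0 < horizontalNorm x)
    (hs : -(⟨x 0, x 1⟩ : ℂ) ∈ Complex.slitPlane) : ContDiffAt ℝ ∞ (cylCoordOpp α) x := by
  have h1 := contDiffAt_horizontalNorm_rpow hx 1
  simp only [Real.rpow_one] at h1
  have hneg : ∀ y : EuclideanSpace ℝ (Fin 3), (⟨(-y) 0, (-y) 1⟩ : ℂ) = -⟨y 0, y 1⟩ := fun y => by
    apply Complex.ext <;> simp
  have h2 : ContDiffAt ℝ ∞ (fun y : EuclideanSpace ℝ (Fin 3) =>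
      Complex.arg (-⟨y 0, y 1⟩)) x := by
    have := (contDiffAt_arg (x := -x) (by rwa [hneg])).comp x contDiff_neg.contDiffAt
    simpa only [Function.comp_def, hneg] using this
  rw [contDiffAt_euclidean]
  intro i
  fin_cases i
  · exact (h1.sub contDiffAt_const).div_const 2
  · exact (h2.div_const _).add contDiffAt_const
  · exact (((contDiff_coord 2).contDiffAt.mul (contDiffAt_horizontalNorm_rpow hx _)).add
      contDiffAt_const).div_const 4

lemma complex_mk_ne_zero {x : EuclideanSpace ℝ (Fin 3)} (hx : 0 < horizontalNorm x) :
    (⟨x 0, x 1⟩ : ℂ) ≠ 0 := by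
  intro h
  have h0 : x 0 = 0 := congrArg Complex.re h
  have h1 : x 1 = 0 := congrArg Complex.im h
  simp [horizontalNorm, h0, h1] at hx

/-- `arg (-z)` and `arg z + π` agree modulo `2π`, so the two branches differ by a period of the
angular variable. -/
lemma exists_cylCoordOpp_eq (α : ℝ) {x : EuclideanSpace ℝ (Fin 3)} (hx : 0 < horizontalNorm x) :
    ∃ k : ℤ, cylCoordOpp α x = cylCoord α x + EuclideanSpace.single 1 (k : ℝ) := by
  have h := Complex.arg_neg_coe_angle (complex_mk_ne_zero hx)
  rw [← Real.Angle.coe_add, Real.Angle.angle_eq_iff_two_pi_dvd_sub] at h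
  obtain ⟨k, hk⟩ := h
  refine ⟨k + 1, ?_⟩
  have hπ := Real.pi_ne_zero
  have key : Complex.arg (-⟨x 0, x 1⟩) / (2 * Real.pi) + 1 / 2 =
      Complex.arg ⟨x 0, x 1⟩ / (2 * Real.pi) + (k + 1) := by
    rw [sub_eq_iff_eq_add.1 hk]
    field_simp
    ring
  ext i
  fin_cases i
  · simp [cylCoord, cylCoordOpp]
  · simpa [cylCoord, cylCoordOpp] using key
  · simp [cylCoord, cylCoordOpp]

/-! ### Transfer of the divergence equation to the domain with `R = 1`. -/

/-- The vector field on the aperture domain with `R = 1` which corresponds to `W`. -/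
noncomputable def cylField (α : ℝ) (W : EuclideanSpace ℝ (Fin 3) → Fin 3 → ℝ)
    (x : EuclideanSpace ℝ (Fin 3)) (j : Fin 3) : ℝ :=
  ∑ m, cylCofactor α m x j * W (cylCoord α x) m

lemma cylCoord_zero_eq (α : ℝ) (x : EuclideanSpace ℝ (Fin 3)) :
    cylCoord α x 0 = (horizontalNorm x - 1) / 2 := rfl

lemma cylCoord_one_mem (α : ℝ) (x : EuclideanSpace ℝ (Fin 3)) :
    cylCoord α x 1 ∈ Set.Ioc (-(1 / 2) : ℝ) (1 / 2) := by
  have h := Complex.arg_mem_Ioc ⟨x 0, x 1⟩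
  have hπ := Real.pi_pos
  change Complex.arg ⟨x 0, x 1⟩ / (2 * Real.pi) ∈ _
  constructor
  · rw [lt_div_iff₀ (by positivity)]
    linarith [h.1]
  · rw [div_le_iff₀ (by positivity)]
    linarith [h.2]

/-- The two possible singularities are harmless. Near the axis the field is zero, because `W`
vanishes for `y 0 < 0`; across the slit of the argument, periodicity allows replacing `cylCoord` by
the branch `cylCoordOpp`, which is smooth there. -/
lemma contDiff_cylField (α : ℝ) {W : EuclideanSpace ℝ (Fin 3) → Fin 3 → ℝ}
    (hW : ∀ m, ContDiff ℝ ∞ fun y => W y m)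
    (hper : ∀ (k : ℤ) y, W (y + EuclideanSpace.single 1 (k : ℝ)) = W y)
    (h0 : ∀ y : EuclideanSpace ℝ (Fin 3), y 0 < 0 → W y = 0) (j : Fin 3) :
    ContDiff ℝ ∞ fun x => cylField α W x j := by
  rw [contDiff_iff_contDiffAt]
  intro x
  rcases lt_or_ge (horizontalNorm x) 1 with hx | hx
  · have : (fun x => cylField α W x j) =ᶠ[𝓝 x] fun _ => 0 := by
      filter_upwards [continuous_horizontalNorm.continuousAt.eventually (gt_mem_nhds hx)] with y hy
      have hy0 : cylCoord α y 0 < 0 := by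
        rw [cylCoord_zero_eq]
        linarith
      simp [cylField, h0 _ hy0]
    exact contDiffAt_const.congr_of_eventuallyEq this
  · have hx0 : 0 < horizontalNorm x := by linarith
    have hWc : ∀ m z, ContDiffAt ℝ ∞ (fun y => W y m) z := fun m z => (hW m).contDiffAt
    by_cases hs : (⟨x 0, x 1⟩ : ℂ) ∈ Complex.slitPlane
    · exact ContDiffAt.sum fun m _ => (contDiffAt_cylCofactor α hx0 m j).mul
        ((hWc m _).comp x (contDiffAt_cylCoord α hx0 hs))
    · have hs' : -(⟨x 0, x 1⟩ : ℂ) ∈ Complex.slitPlane :=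
        (Complex.mem_slitPlane_or_neg_mem_slitPlane (complex_mk_ne_zero hx0)).resolve_left hs
      have : (fun x => cylField α W x j) =ᶠ[𝓝 x]
          fun x => ∑ m, cylCofactor α m x j * W (cylCoordOpp α x) m := by
        filter_upwards [continuous_horizontalNorm.continuousAt.eventually (lt_mem_nhds hx0)]
          with y hy
        obtain ⟨k, hk⟩ := exists_cylCoordOpp_eq α hy
        simp only [cylField, hk, hper]
      refine ContDiffAt.congr_of_eventuallyEq ?_ this
      exact ContDiffAt.sum fun m _ => (contDiffAt_cylCofactor α hx0 m j).mul
        ((hWc m _).comp x (contDiffAt_cylCoordOpp α hx0 hs'))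

lemma jet_cylField (α : ℝ) {W : EuclideanSpace ℝ (Fin 3) → Fin 3 → ℝ}
    (hW : ∀ m, ContDiff ℝ ∞ fun y => W y m) {x : EuclideanSpace ℝ (Fin 3)}
    (hx : 0 < horizontalNorm x) (hs : (⟨x 0, x 1⟩ : ℂ) ∈ Complex.slitPlane) :
    jet (cylField α W) x = piolaJet (cylCoordJacobian α x) (fun m => jet (cylCofactor α m) x)
      (jet W (cylCoord α x)) := by
  refine (jet_piola (hasFDerivAt_cylCoord α hx hs)
    (fun m => (hW m).differentiable (by simp) _)
    fun m j => (contDiffAt_cylCofactor α hx m j).differentiableAt (by simp)).trans ?_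
  simp only [matrixCLM_single]

/-- The interior of the aperture domain with `R = 1`. -/
def openAperture (α : ℝ) : Set (EuclideanSpace ℝ (Fin 3)) :=
  {x | 1 < horizontalNorm x ∧ horizontalNorm x < 2 ∧ |x 2| < horizontalNorm x ^ α}

lemma isOpen_openAperture {α : ℝ} (hα : 0 ≤ α) : IsOpen (openAperture α) := by
  refine (isOpen_lt continuous_const continuous_horizontalNorm).and
    ((isOpen_lt continuous_horizontalNorm continuous_const).and (isOpen_lt ?_ ?_))
  · exact (contDiff_coord 2).continuous.abs
  · exact continuous_horizontalNorm.rpow_const fun _ => Or.inr hα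

lemma openAperture_subset_interior {α : ℝ} (hα : 0 ≤ α) :
    openAperture α ⊆ interior (apertureDomain α 1) :=
  interior_maximal (fun _ hx => ⟨hx.1.le, by linarith [hx.2.1], hx.2.2.le⟩) (isOpen_openAperture hα)

lemma cylMap_mem_openAperture (α : ℝ) {y : EuclideanSpace ℝ (Fin 3)}
    (h0 : y 0 ∈ Set.Ioo (0 : ℝ) (1 / 2)) (h2 : y 2 ∈ Set.Ioo (0 : ℝ) (1 / 2)) :
    cylMap α y ∈ openAperture α := by
  have hy : 0 < 1 + 2 * y 0 := by linarith [h0.1]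
  have hr := horizontalNorm_cylMap α hy
  refine ⟨by rw [hr]; linarith [h0.1], by rw [hr]; linarith [h0.2], ?_⟩
  rw [hr]
  change |(1 + 2 * y 0) ^ α * (4 * y 2 - 1)| < _
  have hp := Real.rpow_pos_of_pos hy α
  rw [abs_mul, abs_of_pos hp]
  refine mul_lt_of_lt_one_right hp (abs_lt.2 ⟨by linarith [h2.1], by linarith [h2.2]⟩)

lemma cylCoord_mem_closedBox {α : ℝ} {x : EuclideanSpace ℝ (Fin 3)}
    (hx : x ∈ apertureDomain α 1) :
    cylCoord α x ∈ closedBox ![0, -(1 / 2), 0] fun _ => 1 / 2 := by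
  have hr : 0 < horizontalNorm x := by linarith [hx.1]
  have hp := Real.rpow_pos_of_pos hr α
  have habs : |x 2 * horizontalNorm x ^ (-α)| ≤ 1 := by
    rw [Real.rpow_neg hr.le, ← div_eq_mul_inv, abs_div, abs_of_pos hp, div_le_one hp]
    exact hx.2.2
  have h2 := abs_le.1 habs
  intro i
  fin_cases i
  · change (horizontalNorm x - 1) / 2 ∈ Set.Icc 0 (1 / 2 : ℝ)
    constructor <;> linarith [hx.1, hx.2.1]
  · exact Set.Ioc_subset_Icc_self (cylCoord_one_mem α x)
  · change (x 2 * horizontalNorm x ^ (-α) + 1) / 4 ∈ Set.Icc 0 (1 / 2 : ℝ)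
    constructor <;> linarith [h2.1, h2.2]

lemma closedBox_pos {y : EuclideanSpace ℝ (Fin 3)}
    (hy : y ∈ closedBox ![0, -(1 / 2), 0] fun _ => 1 / 2) : 0 < 1 + 2 * y 0 := by
  have := (hy 0).1
  simp at this
  linarith

lemma apertureDomain_subset_image (α : ℝ) :
    apertureDomain α 1 ⊆ cylMap α '' closedBox ![0, -(1 / 2), 0] fun _ => 1 / 2 := fun x hx =>
  ⟨cylCoord α x, cylCoord_mem_closedBox hx, cylMap_cylCoord α (by linarith [hx.1])⟩

lemma isCompact_cylMap_image (α : ℝ) {s : Set (EuclideanSpace ℝ (Fin 3))} (hs : IsCompact s)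
    (h : ∀ y ∈ s, 0 < 1 + 2 * y 0) : IsCompact (cylMap α '' s) :=
  hs.image_of_continuousOn fun y hy =>
    (hasFDerivAt_cylMap α (h y hy)).continuousAt.continuousWithinAt

/-- The support lies in the image of a compact box which keeps the margin `δ` in the radial and
vertical variables and is full in the angle; this image is compact inside the open aperture. -/
lemma isTestFunction_cylField {α : ℝ} (hα : 0 ≤ α) {W : EuclideanSpace ℝ (Fin 3) → Fin 3 → ℝ}
    (hW : ∀ m, ContDiff ℝ ∞ fun y => W y m)
    (hper : ∀ (k : ℤ) y, W (y + EuclideanSpace.single 1 (k : ℝ)) = W y)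
    {δ : ℝ} (hδ : 0 < δ) (h0 : ∀ y : EuclideanSpace ℝ (Fin 3),
      ((y 0 < δ ∨ 1 / 2 - δ < y 0) ∨ y 2 < δ ∨ 1 / 2 - δ < y 2) → W y = 0) (j : Fin 3) :
    IsTestFunction (interior (apertureDomain α 1)) fun x => cylField α W x j := by
  set s := closedBox ![δ, -(1 / 2), δ] ![1 / 2 - δ, 1 / 2, 1 / 2 - δ] with hs
  have hpos : ∀ y ∈ s, 0 < 1 + 2 * y 0 := fun y hy => by
    have : δ ≤ y 0 := (hy 0).1
    linarith
  have hT := isCompact_cylMap_image α (isCompact_closedBox _ _) hpos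
  have hsupp : Function.support (fun x => cylField α W x j) ⊆ cylMap α '' s := by
    intro x hx
    have hne : W (cylCoord α x) ≠ 0 := fun h => hx (by simp [cylField, h])
    have h1 : δ ≤ cylCoord α x 0 := not_lt.1 fun h => hne (h0 _ (Or.inl (Or.inl h)))
    have h2 : cylCoord α x 0 ≤ 1 / 2 - δ := not_lt.1 fun h => hne (h0 _ (Or.inl (Or.inr h)))
    have h3 : δ ≤ cylCoord α x 2 := not_lt.1 fun h => hne (h0 _ (Or.inr (Or.inl h)))
    have h4 : cylCoord α x 2 ≤ 1 / 2 - δ := not_lt.1 fun h => hne (h0 _ (Or.inr (Or.inr h)))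
    have hr : 0 < horizontalNorm x := by
      rw [cylCoord_zero_eq] at h1
      linarith
    refine ⟨cylCoord α x, fun i => ?_, cylMap_cylCoord α hr⟩
    fin_cases i
    · exact ⟨h1, h2⟩
    · exact Set.Ioc_subset_Icc_self (cylCoord_one_mem α x)
    · exact ⟨h3, h4⟩
  have hts : tsupport (fun x => cylField α W x j) ⊆ cylMap α '' s :=
    closure_minimal hsupp hT.isClosed
  refine ⟨contDiff_cylField α hW hper (fun y hy => h0 y (Or.inl (Or.inl (hy.trans hδ)))) j,
    hT.of_isClosed_subset (isClosed_tsupport _) hts, hts.trans ?_⟩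
  rintro _ ⟨y, hy, rfl⟩
  have hy0 : y 0 ∈ Set.Icc δ (1 / 2 - δ) := hy 0
  have hy2 : y 2 ∈ Set.Icc δ (1 / 2 - δ) := hy 2
  exact openAperture_subset_interior hα (cylMap_mem_openAperture α
    ⟨by linarith [hy0.1], by linarith [hy0.2]⟩ ⟨by linarith [hy2.1], by linarith [hy2.2]⟩)

lemma quarterCell_pos {y : EuclideanSpace ℝ (Fin 3)} (hy : y ∈ quarterCell) : 0 < 1 + 2 * y 0 :=
  closedBox_pos (openBox_subset_closedBox _ _ hy)

lemma cylCoord_cylMap_of_mem (α : ℝ) {y : EuclideanSpace ℝ (Fin 3)} (hy : y ∈ quarterCell) :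
    cylCoord α (cylMap α y) = y :=
  cylCoord_cylMap α (quarterCell_pos hy) (Set.Ioo_subset_Ioc_self (hy 1))

lemma injOn_cylMap (α : ℝ) : Set.InjOn (cylMap α) quarterCell := fun y hy z hz h => by
  rw [← cylCoord_cylMap_of_mem α hy, h, cylCoord_cylMap_of_mem α hz]

lemma cylMap_image_subset_interior {α : ℝ} (hα : 0 ≤ α) :
    cylMap α '' quarterCell ⊆ interior (apertureDomain α 1) := by
  rintro _ ⟨y, hy, rfl⟩
  exact openAperture_subset_interior hα (cylMap_mem_openAperture α (hy 0) (hy 2))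

lemma measurableSet_quarterCell : MeasurableSet quarterCell := measurableSet_openBox _ _

/-- Whatever the image of the open cell misses lies in the image of the faces of the closed box, and
a differentiable map sends null sets to null sets. This disposes of the boundary and of the slit at
once. -/
lemma apertureDomain_ae_eq_image {α : ℝ} (hα : 0 ≤ α) :
    apertureDomain α 1 =ᵐ[volume] cylMap α '' quarterCell := by
  refine EventuallyLE.antisymm ?_
    ((cylMap_image_subset_interior hα).trans interior_subset).eventuallyLE
  rw [ae_le_set]
  set s := (closedBox ![0, -(1 / 2), 0] fun _ => 1 / 2) \ quarterCell with hs
  have h1 : volume s = 0 := ae_le_set.1 (closedBox_ae_eq_openBox _ _).le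
  have h2 : volume (cylMap α '' s) = 0 :=
    addHaar_image_eq_zero_of_differentiableOn_of_addHaar_eq_zero volume
      (fun y hy => (hasFDerivAt_cylMap α (closedBox_pos hy.1)).differentiableAt.differentiableWithinAt)
      h1
  refine measure_mono_null ?_ h2
  rintro x ⟨hx, hx'⟩
  obtain ⟨y, hy, rfl⟩ := apertureDomain_subset_image α hx
  exact ⟨y, ⟨hy, fun h => hx' ⟨y, h, rfl⟩⟩, rfl⟩

lemma interior_ae_eq_apertureDomain {α : ℝ} (hα : 0 ≤ α) :
    interior (apertureDomain α 1) =ᵐ[volume] apertureDomain α 1 :=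
  EventuallyLE.antisymm interior_subset.eventuallyLE
    ((apertureDomain_ae_eq_image hα).le.trans (cylMap_image_subset_interior hα).eventuallyLE)

lemma restrict_apertureDomain {α : ℝ} (hα : 0 ≤ α) :
    (volume.restrict (apertureDomain α 1) : Measure (EuclideanSpace ℝ (Fin 3))) =
      volume.restrict (cylMap α '' quarterCell) :=
  Measure.restrict_congr_set (apertureDomain_ae_eq_image hα)

lemma measurableSet_cylMap_image (α : ℝ) : MeasurableSet (cylMap α '' quarterCell) :=
  measurable_image_of_fderivWithin measurableSet_quarterCell
    (fun _ hy => (hasFDerivAt_cylMap α (quarterCell_pos hy)).hasFDerivWithinAt) (injOn_cylMap α)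

/-- The determinant is `16 π r^(α+1)` with `1 < r < 2`; since `α ≤ 1` and `π < 4` it is at most `16
* 4 * 4`. -/
lemma det_cylMap_bounds {α : ℝ} (hα : α ∈ Set.Icc (0 : ℝ) 1) {y : EuclideanSpace ℝ (Fin 3)}
    (hy : y ∈ quarterCell) : 1 ≤ (matrixCLM (cylMapJacobian α y)).det ∧
      (matrixCLM (cylMapJacobian α y)).det ≤ 256 := by
  rw [det_cylMapJacobian]
  have h0 : (0 : ℝ) < y 0 := (hy 0).1
  have h1 : y 0 < 1 / 2 := (hy 0).2
  have h2 : 1 ≤ (1 + 2 * y 0) ^ α := Real.one_le_rpow (by linarith) hα.1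
  have h3 : (1 + 2 * y 0) ^ α ≤ 1 + 2 * y 0 := by
    have := Real.rpow_le_rpow_of_exponent_le (show 1 ≤ 1 + 2 * y 0 by linarith) hα.2
    rwa [Real.rpow_one] at this
  have h4 := Real.pi_gt_three
  have h5 := Real.pi_lt_four
  have h6 : 1 ≤ (1 + 2 * y 0) ^ α * (1 + 2 * y 0) := by nlinarith
  have h7 : (1 + 2 * y 0) ^ α * (1 + 2 * y 0) ≤ 4 := by nlinarith
  constructor <;> nlinarith

lemma map_cylMap_le {α : ℝ} (hα : α ∈ Set.Icc (0 : ℝ) 1) :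
    Measure.map (cylMap α) (volume.restrict quarterCell) ≤
      ENNReal.ofReal 1 • volume.restrict (apertureDomain α 1) := by
  rw [restrict_apertureDomain hα.1]
  refine map_le_smul_of_det_ge measurableSet_quarterCell (measurable_cylMap α)
    (fun y hy => hasFDerivAt_cylMap α (quarterCell_pos hy)) (injOn_cylMap α)
    (Set.mapsTo_image _ _) one_pos fun y hy => ?_
  rw [inv_one]
  exact (det_cylMap_bounds hα hy).1.trans (le_abs_self _)

lemma map_cylCoord_le {α : ℝ} (hα : α ∈ Set.Icc (0 : ℝ) 1) :
    Measure.map (cylCoord α) (volume.restrict (apertureDomain α 1)) ≤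
      ENNReal.ofReal 256 • volume.restrict quarterCell := by
  rw [restrict_apertureDomain hα.1]
  refine Measure.le_iff.2 fun A hA => ?_
  rw [Measure.map_apply (measurable_cylCoord α) hA, Measure.smul_apply,
    Measure.restrict_apply (measurable_cylCoord α hA), Measure.restrict_apply hA, smul_eq_mul]
  have h1 : cylCoord α ⁻¹' A ∩ cylMap α '' quarterCell = cylMap α '' (A ∩ quarterCell) := by
    ext x
    constructor
    · rintro ⟨hx, y, hy, rfl⟩
      rw [Set.mem_preimage, cylCoord_cylMap_of_mem α hy] at hx
      exact ⟨y, ⟨hx, hy⟩, rfl⟩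
    · rintro ⟨y, ⟨hyA, hy⟩, rfl⟩
      refine ⟨?_, y, hy, rfl⟩
      rwa [Set.mem_preimage, cylCoord_cylMap_of_mem α hy]
  have hm : MeasurableSet (A ∩ quarterCell) := hA.inter measurableSet_quarterCell
  rw [h1, ← lintegral_abs_det_fderiv_eq_addHaar_image volume hm
    (fun y hy => (hasFDerivAt_cylMap α (quarterCell_pos hy.2)).hasFDerivWithinAt)
    ((injOn_cylMap α).mono Set.inter_subset_right), ← setLIntegral_const]
  refine setLIntegral_mono' hm fun y hy => ENNReal.ofReal_le_ofReal ?_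
  have h2 := det_cylMap_bounds hα hy.2
  rw [abs_of_pos (by linarith [h2.1])]
  exact h2.2

/-- The slit corresponds to the angular coordinate `1/2`, which the open cell excludes. -/
lemma mem_slitPlane_of_mem_image {α : ℝ} {x : EuclideanSpace ℝ (Fin 3)}
    (hx : x ∈ cylMap α '' quarterCell) : (⟨x 0, x 1⟩ : ℂ) ∈ Complex.slitPlane := by
  obtain ⟨y, hy, rfl⟩ := hx
  have hr : 0 < horizontalNorm (cylMap α y) := by
    rw [horizontalNorm_cylMap α (quarterCell_pos hy)]
    exact quarterCell_pos hy
  rw [Complex.mem_slitPlane_iff_arg]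
  refine ⟨fun h => ?_, complex_mk_ne_zero hr⟩
  have h1 : cylCoord α (cylMap α y) 1 = y 1 := by rw [cylCoord_cylMap_of_mem α hy]
  have h2 : cylCoord α (cylMap α y) 1 = Real.pi / (2 * Real.pi) := by
    change Complex.arg _ / (2 * Real.pi) = _
    rw [h]
  have h3 : Real.pi / (2 * Real.pi) = 1 / 2 := by
    have := Real.pi_ne_zero
    field_simp
  have h4 : y 1 < 1 / 2 := (hy 1).2
  rw [← h1, h2, h3] at h4
  exact lt_irrefl _ h4

/-- The coefficients of the transform are continuous away from the axis, hence bounded on a compact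
set containing the domain. The explicit Jacobian has no jump at the slit. -/
lemma exists_norm_piolaJet_cyl_le (α : ℝ) : ∃ C : ℝ, 0 ≤ C ∧ ∀ x ∈ apertureDomain α 1, ∀ p : Jet,
    ‖piolaJet (cylCoordJacobian α x) (fun m => jet (cylCofactor α m) x) p‖ ≤ C * ‖p‖ := by
  set K := cylMap α '' closedBox ![0, -(1 / 2), 0] fun _ => 1 / 2 with hK
  have hKc : IsCompact K := isCompact_cylMap_image α (isCompact_closedBox _ _) fun y => closedBox_pos
  have hpos : ∀ x ∈ K, 0 < horizontalNorm x := by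
    rintro _ ⟨y, hy, rfl⟩
    rw [horizontalNorm_cylMap α (closedBox_pos hy)]
    exact closedBox_pos hy
  have hjet : ∀ m, ContinuousOn (jet (cylCofactor α m)) K := fun m x hx => by
    refine ContinuousAt.continuousWithinAt (ContinuousAt.prodMk ?_ ?_)
    · exact continuousAt_pi.2 fun j => (contDiffAt_cylCofactor α (hpos x hx) m j).continuousAt
    · refine continuousAt_pi.2 fun i => continuousAt_pi.2 fun j => ?_
      exact ((contDiffAt_cylCofactor α (hpos x hx) m j).fderiv_right (m := 0)
        (by simp)).continuousAt.clm_apply continuousAt_const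
  choose c1 hc1 using fun t : Fin 3 × Fin 3 => hKc.exists_bound_of_continuousOn
    (f := fun x => cylCoordJacobian α x t.1 t.2) fun x hx =>
      (continuousAt_cylCoordJacobian α (hpos x hx) t.1 t.2).continuousWithinAt
  choose c2 hc2 using fun m => hKc.exists_bound_of_continuousOn (hjet m)
  set c := ∑ t, |c1 t| + ∑ t, |c2 t| with hc
  have hs1 : 0 ≤ ∑ t, |c1 t| := Finset.sum_nonneg fun _ _ => abs_nonneg _
  have hs2 : 0 ≤ ∑ t, |c2 t| := Finset.sum_nonneg fun _ _ => abs_nonneg _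
  have h1 : ∀ t, c1 t ≤ c := fun t => (le_abs_self _).trans <|
    (Finset.single_le_sum (f := fun t => |c1 t|) (fun _ _ => abs_nonneg _)
      (Finset.mem_univ t)).trans (le_add_of_nonneg_right hs2)
  have h2 : ∀ t, c2 t ≤ c := fun t => (le_abs_self _).trans <|
    (Finset.single_le_sum (f := fun t => |c2 t|) (fun _ _ => abs_nonneg _)
      (Finset.mem_univ t)).trans (le_add_of_nonneg_left hs1)
  have hc0 : 0 ≤ c := add_nonneg hs1 hs2
  refine ⟨3 * c + 9 * c ^ 2, by positivity, fun x hx p => ?_⟩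
  have hx' := apertureDomain_subset_image α hx
  exact norm_piolaJet_le hc0 (fun n i => (hc1 (n, i) x hx').trans (h1 _))
    (fun m => (hc2 m x hx').trans (h2 _)) p

lemma measurableSet_apertureDomain {α : ℝ} (hα : 0 ≤ α) (R : ℝ) :
    MeasurableSet (apertureDomain α R) := by
  have hr := continuous_horizontalNorm
  have h : IsClosed (apertureDomain α R) := by
    refine (isClosed_le continuous_const hr).and ((isClosed_le hr continuous_const).and
      (isClosed_le (contDiff_coord 2).continuous.abs (hr.rpow_const fun _ => Or.inr hα)))
  exact h.measurableSet

/-- The divergence equation on the aperture domain with `R = 1`. -/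
theorem exists_unitAperture_divergence {α : ℝ} (hα : α ∈ Set.Icc (0 : ℝ) 1) : ∃ C : ℝ, 1 ≤ C ∧
    ∀ f : EuclideanSpace ℝ (Fin 3) → ℝ, MemLp f 2 (volume.restrict (apertureDomain α 1)) →
      ∫ x in apertureDomain α 1, f x = 0 →
      ∃ (U : ℕ → EuclideanSpace ℝ (Fin 3) → Fin 3 → ℝ) (p : EuclideanSpace ℝ (Fin 3) → Jet),
        (∀ n j, IsTestFunction (interior (apertureDomain α 1)) fun x => U n x j) ∧
        Measurable p ∧
        Tendsto (fun n => eLpNorm (fun x => jet (U n) x - p x) 2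
          (volume.restrict (apertureDomain α 1))) atTop (𝓝 0) ∧
        (∀ᵐ x ∂(volume.restrict (apertureDomain α 1)), jetDiv (p x) = f x) ∧
        eLpNorm p 2 (volume.restrict (apertureDomain α 1)) ≤
          ENNReal.ofReal C * eLpNorm f 2 (volume.restrict (apertureDomain α 1)) := by
  obtain ⟨C₁, hC₁, hbox⟩ := exists_quarterCell_divergence_of_support
  obtain ⟨C₂, hC₂, hpiola⟩ := exists_norm_piolaJet_cyl_le α
  -- The factors are, in order: the Piola coefficients, composition with `cylCoord`, the solution on
  -- the cell, and the weight `J` in the datum `g`. The summand `1` only ensures `1 ≤ C`.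
  refine ⟨C₂ * (256 * (C₁ * 256)) + 1, by nlinarith [mul_nonneg hC₂ (by linarith : 0 ≤ C₁)],
    fun f hf hf0 => ?_⟩
  set μ := volume.restrict (apertureDomain α 1) with hμ
  set ν := (volume.restrict quarterCell : Measure (EuclideanSpace ℝ (Fin 3))) with hν
  set J : EuclideanSpace ℝ (Fin 3) → ℝ := fun y => (matrixCLM (cylMapJacobian α y)).det with hJ
  have hQ := ae_restrict_mem (μ := (volume : Measure (EuclideanSpace ℝ (Fin 3))))
    measurableSet_quarterCell
  have hJm : Measurable J := by
    simp only [hJ, det_cylMapJacobian]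
    have h0 := ((measurable_coord 0).const_mul 2).const_add 1
    exact ((h0.pow_const α).mul h0).const_mul _
  -- The weight `J` makes the integral of `g` equal that of `f`, and cancels the Jacobian of
  -- `cylCoord` that the Piola transform produces.
  set g : EuclideanSpace ℝ (Fin 3) → ℝ := fun y => J y * f (cylMap α y) with hg
  have hac : Measure.map (cylMap α) ν ≪ μ :=
    (Measure.absolutelyContinuous_of_le (map_cylMap_le hα)).trans Measure.smul_absolutelyContinuous
  have hfm : AEStronglyMeasurable (fun y => f (cylMap α y)) ν :=
    (hf.1.mono_ac hac).comp_measurable (measurable_cylMap α)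
  have hgnorm : eLpNorm g 2 ν ≤ ENNReal.ofReal 256 * eLpNorm f 2 μ := by
    have h1 : eLpNorm g 2 ν ≤ ENNReal.ofReal 256 * eLpNorm (fun y => f (cylMap α y)) 2 ν := by
      refine eLpNorm_le_mul_eLpNorm_of_ae_le_mul ?_ 2
      filter_upwards [hQ] with y hy
      have h2 := det_cylMap_bounds hα hy
      rw [hg, norm_mul, Real.norm_of_nonneg (by linarith [h2.1])]
      gcongr
      exact h2.2
    refine h1.trans ?_
    gcongr
    simpa using eLpNorm_comp_le_of_map_le (measurable_cylMap α) le_rfl (map_cylMap_le hα) hf.1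
  have hgL : MemLp g 2 ν :=
    ⟨hJm.aestronglyMeasurable.mul hfm, hgnorm.trans_lt (ENNReal.mul_lt_top (by simp) hf.2)⟩
  have hg0 : ∫ y in quarterCell, g y = 0 := by
    rw [← hf0, hμ, restrict_apertureDomain hα.1,
      integral_image_eq_integral_abs_det_fderiv_smul volume measurableSet_quarterCell
        (fun y hy => (hasFDerivAt_cylMap α (quarterCell_pos hy)).hasFDerivWithinAt)
        (injOn_cylMap α)]
    refine setIntegral_congr_fun measurableSet_quarterCell fun y hy => ?_
    change J y * f (cylMap α y) = |J y| • f (cylMap α y)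
    rw [abs_of_pos (by linarith [(det_cylMap_bounds hα hy).1]), smul_eq_mul]
  obtain ⟨W, q, hW, hper, hsupp, hqm, htend, hdiv, hbound⟩ := hbox g hgL hg0
  have hO : ∀ᵐ x ∂μ, x ∈ apertureDomain α 1 :=
    ae_restrict_mem (measurableSet_apertureDomain hα.1 1)
  have hO' : ∀ᵐ x ∂μ, x ∈ cylMap α '' quarterCell := by
    rw [hμ, restrict_apertureDomain hα.1]
    exact ae_restrict_mem (measurableSet_cylMap_image α)
  have hpull : ∀ r : EuclideanSpace ℝ (Fin 3) → Jet, Measurable r →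
      eLpNorm (fun x => piolaJet (cylCoordJacobian α x) (fun m => jet (cylCofactor α m) x)
        (r (cylCoord α x))) 2 μ ≤ ENNReal.ofReal (C₂ * 256) * eLpNorm r 2 ν := fun r hr => by
    refine (eLpNorm_le_mul_eLpNorm_of_ae_le_mul (g := fun x => r (cylCoord α x)) (c := C₂)
      ?_ 2).trans ?_
    · filter_upwards [hO] with x hx
      exact hpiola x hx _
    · rw [ENNReal.ofReal_mul hC₂, mul_assoc]
      gcongr
      exact eLpNorm_comp_le_of_map_le (measurable_cylCoord α) (by norm_num) (map_cylCoord_le hα)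
        hr.aestronglyMeasurable
  refine ⟨fun n => cylField α (W n), fun x => piolaJet (cylCoordJacobian α x)
    (fun m => jet (cylCofactor α m) x) (q (cylCoord α x)), fun n j => ?_, ?_, ?_, ?_, ?_⟩
  · obtain ⟨δ, hδ, h⟩ := hsupp n
    exact isTestFunction_cylField hα.1 (hW n) (hper n) hδ h j
  · exact measurable_piolaJet (measurable_cylCoordJacobian α)
      (fun m => measurable_jet (measurable_cylCofactor α m)) (hqm.comp (measurable_cylCoord α))
  · have h1 : Tendsto (fun n => ENNReal.ofReal (C₂ * 256) *
        eLpNorm (fun y => jet (W n) y - q y) 2 ν) atTop (𝓝 0) := by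
      have := ENNReal.Tendsto.const_mul htend (Or.inr (ENNReal.ofReal_ne_top (r := C₂ * 256)))
      rwa [mul_zero] at this
    refine tendsto_of_tendsto_of_tendsto_of_le_of_le tendsto_const_nhds h1 (fun _ => zero_le)
      fun n => le_trans (le_of_eq (eLpNorm_congr_ae ?_))
        (hpull _ ((continuous_jet (hW n)).measurable.sub hqm))
    filter_upwards [hO, hO'] with x hx hx'
    rw [jet_cylField α (hW n) (by linarith [hx.1]) (mem_slitPlane_of_mem_image hx'), piolaJet_sub]
  · have hacc : Measure.map (cylCoord α) μ ≪ ν :=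
      (Measure.absolutelyContinuous_of_le (map_cylCoord_le hα)).trans
        Measure.smul_absolutelyContinuous
    have hdiv' : ∀ᵐ x ∂μ, jetDiv (q (cylCoord α x)) = g (cylCoord α x) :=
      (⟨measurable_cylCoord α, hacc⟩ : Measure.QuasiMeasurePreserving (cylCoord α) μ ν).ae hdiv
    filter_upwards [hO, hdiv'] with x hx h
    have hr : 0 < horizontalNorm x := by linarith [hx.1]
    rw [jetDiv_piolaJet (fun m => jetDiv_cylCofactor α hr m) (sum_cylCoordJacobian_mul α hr), h]
    simp only [hg, hJ]
    rw [det_cylMapJacobian, cylMap_cylCoord α hr, cylCoord_zero_eq]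
    have e : 1 + 2 * ((horizontalNorm x - 1) / 2) = horizontalNorm x := by ring
    -- The Jacobians of `cylCoord` and `cylMap` are reciprocal.
    have e2 : horizontalNorm x ^ (-α - 1) * (horizontalNorm x ^ α * horizontalNorm x) = 1 := by
      rw [← mul_assoc, ← Real.rpow_add hr, ← Real.rpow_add_one hr.ne']
      ring_nf
      exact Real.rpow_zero _
    rw [e]
    have hπ := Real.pi_ne_zero
    field_simp
    linear_combination f x * e2
  · refine (hpull q hqm).trans ?_
    calc ENNReal.ofReal (C₂ * 256) * eLpNorm q 2 ν
        ≤ ENNReal.ofReal (C₂ * 256) * (ENNReal.ofReal C₁ *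
          (ENNReal.ofReal 256 * eLpNorm f 2 μ)) := by
          gcongr
          exact hbound.trans (by gcongr)
      _ = ENNReal.ofReal (C₂ * 256 * (C₁ * 256)) * eLpNorm f 2 μ := by
          rw [ENNReal.ofReal_mul (by positivity : 0 ≤ C₂ * 256),
            ENNReal.ofReal_mul (by linarith : 0 ≤ C₁)]
          ring
      _ ≤ _ := by
          gcongr
          linarith

/-! ### Anisotropic scaling to general `R`. -/

/-- The anisotropic scales `(R, R, R^α)`. -/
noncomputable def apertureScale (α R : ℝ) : Fin 3 → ℝ := ![R, R, R ^ α]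

lemma apertureScale_pos (α : ℝ) {R : ℝ} (hR : 1 ≤ R) (i : Fin 3) : 0 < apertureScale α R i := by
  have h0 : 0 < R := by linarith
  have h1 := Real.rpow_pos_of_pos h0 α
  fin_cases i <;> simp [apertureScale, h0, h1]

lemma matrixCLM_diagonal_apply (d : Fin 3 → ℝ) (x : EuclideanSpace ℝ (Fin 3)) (i : Fin 3) :
    matrixCLM (Matrix.diagonal d) x i = d i * x i := by
  exact Matrix.mulVec_diagonal d x.ofLp i

/-- The rescaling `x ↦ (x_i / d_i)_i`. -/
noncomputable def rescaleEquiv (d : Fin 3 → ℝ) (hd : ∀ i, 0 < d i) :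
    EuclideanSpace ℝ (Fin 3) ≃L[ℝ] EuclideanSpace ℝ (Fin 3) :=
  ContinuousLinearEquiv.equivOfInverse (matrixCLM (Matrix.diagonal fun i => (d i)⁻¹))
    (matrixCLM (Matrix.diagonal d))
    (fun x => by
      ext i
      rw [matrixCLM_diagonal_apply, matrixCLM_diagonal_apply, mul_inv_cancel_left₀ (hd i).ne'])
    (fun x => by
      ext i
      rw [matrixCLM_diagonal_apply, matrixCLM_diagonal_apply, inv_mul_cancel_left₀ (hd i).ne'])

lemma rescaleEquiv_apply (d : Fin 3 → ℝ) (hd : ∀ i, 0 < d i) (x : EuclideanSpace ℝ (Fin 3))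
    (i : Fin 3) : rescaleEquiv d hd x i = (d i)⁻¹ * x i :=
  matrixCLM_diagonal_apply _ x i

/-- The value of the factor is irrelevant: it multiplies the norms of datum and solution equally and
cancels in the estimate. -/
lemma exists_map_volume_eq_smul (e : EuclideanSpace ℝ (Fin 3) ≃L[ℝ] EuclideanSpace ℝ (Fin 3)) :
    ∃ c : ℝ≥0∞, c ≠ 0 ∧ c ≠ ⊤ ∧ Measure.map e volume = c • volume := by
  have hdet : LinearMap.det (e.toLinearEquiv : EuclideanSpace ℝ (Fin 3) →ₗ[ℝ] _) ≠ 0 :=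
    e.toLinearEquiv.isUnit_det'.ne_zero
  refine ⟨_, ?_, ENNReal.ofReal_ne_top, Measure.map_linearMap_addHaar_eq_smul_addHaar volume hdet⟩
  rw [Ne, ENNReal.ofReal_eq_zero, not_le]
  exact abs_pos.2 (inv_ne_zero hdet)

/-- The vertical bound is homogeneous: dividing `x_h` by `R` divides `|x_h|^α` by `R^α`, the scale
chosen for `x_3`. -/
lemma preimage_apertureDomain {α R : ℝ} (hR : 1 ≤ R) :
    rescaleEquiv (apertureScale α R) (apertureScale_pos α hR) ⁻¹' apertureDomain α 1 =
      apertureDomain α R := by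
  have h0 : 0 < R := by linarith
  ext x
  have h1 : horizontalNorm (rescaleEquiv (apertureScale α R) (apertureScale_pos α hR) x) =
      R⁻¹ * horizontalNorm x := by
    rw [horizontalNorm, Real.sqrt_eq_iff_mul_self_eq (by positivity)
      (mul_nonneg (by positivity) (horizontalNorm_nonneg x))]
    simp only [rescaleEquiv_apply, apertureScale, Matrix.cons_val_zero, Matrix.cons_val_one]
    linear_combination -(R⁻¹ ^ 2 * horizontalNorm_sq x)
  have h2 : |rescaleEquiv (apertureScale α R) (apertureScale_pos α hR) x 2| =
      (R ^ α)⁻¹ * |x 2| := by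
    rw [rescaleEquiv_apply, abs_mul, abs_inv, abs_of_pos (apertureScale_pos α hR 2)]
    rfl
  simp only [Set.mem_preimage, apertureDomain, Set.mem_ofPred_eq]
  rw [h1, h2, Real.mul_rpow (by positivity) (horizontalNorm_nonneg x), Real.inv_rpow h0.le,
    mul_le_mul_iff_right₀ (by positivity), le_inv_mul_iff₀ h0, inv_mul_le_iff₀ h0]
  simp only [mul_one, mul_comm R 2]

lemma interior_ae_eq_apertureDomain_of_one_le {α R : ℝ} (hα : 0 ≤ α) (hR : 1 ≤ R) :
    interior (apertureDomain α R) =ᵐ[volume] apertureDomain α R := by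
  set e := rescaleEquiv (apertureScale α R) (apertureScale_pos α hR)
  obtain ⟨c, -, -, hc⟩ := exists_map_volume_eq_smul e
  have hq : Measure.QuasiMeasurePreserving e volume volume :=
    ⟨e.continuous.measurable, hc ▸ Measure.smul_absolutelyContinuous⟩
  rw [← preimage_apertureDomain (α := α) hR]
  have h := e.toHomeomorph.preimage_interior (apertureDomain α 1)
  rw [ContinuousLinearEquiv.coe_toHomeomorph] at h
  rw [← h]
  exact hq.preimage_ae_eq (interior_ae_eq_apertureDomain hα)

/-- The ratios are `1`, `R^(1-α)` and `R^(α-1)`. The worst one, the vertical derivative of a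
horizontal component, is the origin of the power of `R` in the theorem. -/
lemma apertureScale_div_le {α R : ℝ} (hα : α ∈ Set.Icc (0 : ℝ) 1) (hR : 1 ≤ R) (i j : Fin 3) :
    apertureScale α R j * (apertureScale α R i)⁻¹ ≤ R ^ (1 - α) := by
  have h0 : 0 < R := by linarith
  have h1 : 1 ≤ R ^ (1 - α) := Real.one_le_rpow hR (by linarith [hα.2])
  have hp := Real.rpow_pos_of_pos h0 α
  have h2 : R * (R ^ α)⁻¹ ≤ R ^ (1 - α) := by
    rw [Real.rpow_sub h0, Real.rpow_one, div_eq_mul_inv]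
  have h3 : R ^ α * R⁻¹ ≤ R ^ (1 - α) := by
    refine le_trans ?_ h1
    rw [mul_inv_le_iff₀ h0, one_mul]
    simpa using Real.rpow_le_rpow_of_exponent_le hR hα.2
  fin_cases i <;> fin_cases j <;>
    simp [apertureScale, h0.ne', hp.ne', h1, h2, h3]

lemma apertureScale_le {α R : ℝ} (hα : α ∈ Set.Icc (0 : ℝ) 1) (hR : 1 ≤ R) (i : Fin 3) :
    apertureScale α R i ≤ R := by
  have h : R ^ α ≤ R := by simpa using Real.rpow_le_rpow_of_exponent_le hR hα.2
  fin_cases i <;> simp [apertureScale, h]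

lemma one_le_apertureScale {α R : ℝ} (hα : 0 ≤ α) (hR : 1 ≤ R) (i : Fin 3) :
    1 ≤ apertureScale α R i := by
  have h : 1 ≤ R ^ α := Real.one_le_rpow hR hα
  fin_cases i <;> simp [apertureScale, h, hR]

lemma IsTestFunction.const_mul_comp {Ω : Set (EuclideanSpace ℝ (Fin 3))}
    {φ : EuclideanSpace ℝ (Fin 3) → ℝ} (h : IsTestFunction Ω φ) (c : ℝ)
    (e : EuclideanSpace ℝ (Fin 3) ≃L[ℝ] EuclideanSpace ℝ (Fin 3)) :
    IsTestFunction (e ⁻¹' Ω) fun x => c * φ (e x) := by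
  refine ⟨contDiff_const.mul (h.1.comp e.contDiff),
    (h.2.1.comp_homeomorph e.toHomeomorph).mul_left, ?_⟩
  refine (tsupport_mul_subset_right (f := fun _ => c)).trans ?_
  refine (tsupport_comp_subset_preimage φ e.continuous).trans (Set.preimage_mono h.2.2)

theorem exists_aperture_divergence {α : ℝ} (hα : α ∈ Set.Icc (0 : ℝ) 1) :
    ∃ C : ℝ, 1 ≤ C ∧ ∀ R : ℝ, 1 ≤ R → ∀ f : EuclideanSpace ℝ (Fin 3) → ℝ,
      MemLp f 2 (volume.restrict (apertureDomain α R)) → ∫ x in apertureDomain α R, f x = 0 →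
      ∃ (U : ℕ → EuclideanSpace ℝ (Fin 3) → Fin 3 → ℝ) (p : EuclideanSpace ℝ (Fin 3) → Jet),
        (∀ n j, IsTestFunction (interior (apertureDomain α R)) fun x => U n x j) ∧
        MemLp p 2 (volume.restrict (apertureDomain α R)) ∧
        Tendsto (fun n => eLpNorm (fun x => jet (U n) x - p x) 2
          (volume.restrict (apertureDomain α R))) atTop (𝓝 0) ∧
        (∀ᵐ x ∂volume.restrict (apertureDomain α R), jetDiv (p x) = f x) ∧
        eLpNorm (fun x => (p x).2) 2 (volume.restrict (apertureDomain α R)) ≤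
          ENNReal.ofReal (C * R ^ (1 - α)) *
            eLpNorm f 2 (volume.restrict (apertureDomain α R)) := by
  obtain ⟨C, hC, H⟩ := exists_unitAperture_divergence hα
  refine ⟨C, hC, fun R hR f hf hf0 => ?_⟩
  have hR0 : 0 < R := by linarith
  set d := apertureScale α R
  have hd : ∀ i, 0 < d i := apertureScale_pos α hR
  set e := rescaleEquiv d hd with he
  obtain ⟨c, hc0, hct, hc⟩ := exists_map_volume_eq_smul e
  have hpre : e ⁻¹' apertureDomain α 1 = apertureDomain α R := preimage_apertureDomain hR
  set μ := volume.restrict (apertureDomain α R) with hμ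
  set ν := volume.restrict (apertureDomain α 1) with hν
  have hmap : Measure.map e μ = c • ν := by
    rw [hμ, ← hpre, ← Measure.restrict_map e.continuous.measurable
      (measurableSet_apertureDomain hα.1 1), hc, Measure.restrict_smul]
  have hemb : MeasurableEmbedding e := e.toHomeomorph.measurableEmbedding
  set k : ℝ≥0∞ := c ^ (1 / (2 : ℝ≥0∞)).toReal
  have hk0 : k ≠ 0 := by simp [k, hc0, hct]
  have hkt : k ≠ ⊤ := by simp [k, hc0, hct]
  have hnorm : ∀ {F : Type} [NormedAddCommGroup F] (h : EuclideanSpace ℝ (Fin 3) → F),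
      eLpNorm (fun x => h (e x)) 2 μ = k * eLpNorm h 2 ν := fun h => by
    have h1 := hemb.eLpNorm_map_measure (g := h) (p := 2) (μ := μ)
    rw [hmap, eLpNorm_smul_measure_of_ne_top (by simp)] at h1
    exact h1.symm
  set f₁ : EuclideanSpace ℝ (Fin 3) → ℝ := fun y => f (e.symm y) with hf₁
  have hff : (fun x => f₁ (e x)) = f := by
    ext x
    simp [f₁]
  have hfn : eLpNorm f 2 μ = k * eLpNorm f₁ 2 ν := by rw [← hnorm f₁, hff]
  have hf₁m : MemLp f₁ 2 ν := by
    have h1 : MemLp f₁ 2 (Measure.map e μ) := by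
      rw [hemb.memLp_map_measure_iff]
      exact (congrArg (MemLp · 2 μ) hff).mpr hf
    rw [hmap] at h1
    refine MemLp.of_measure_le_smul (c := c⁻¹) (by simpa using hc0) ?_ h1
    rw [smul_smul, ENNReal.inv_mul_cancel hc0 hct, one_smul]
  have hf₁0 : ∫ y in apertureDomain α 1, f₁ y = 0 := by
    have h1 := hemb.integral_map (μ := μ) f₁
    rw [hmap, integral_smul_measure, hff, hf0] at h1
    exact (smul_eq_zero.1 h1).resolve_left (by simp [ENNReal.toReal_eq_zero_iff, hc0, hct])
  obtain ⟨U, p, hU, hpm, hUp, hdiv, hpn⟩ := H f₁ hf₁m hf₁0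
  set P : Fin 3 → Fin 3 → ℝ := fun n i => if n = i then (d i)⁻¹ else 0 with hP
  -- The columns of the inverse of `P` take the place of those of its adjugate, so the factor in the
  -- divergence is `1`.
  set b : Fin 3 → Jet := fun m => (fun j => if j = m then d m else 0, 0) with hb
  have hPR : ∀ n i, |P n i| ≤ R := fun n i => by
    simp only [hP]
    split_ifs
    · rw [abs_of_pos (by have := hd i; positivity)]
      exact (inv_le_one_of_one_le₀ (one_le_apertureScale hα.1 hR i)).trans hR
    · simpa using hR0.le
  have hbR : ∀ m, ‖b m‖ ≤ R := fun m => by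
    refine jet_norm_le hR0.le (fun j => ?_) fun i j => by simpa [hb] using hR0.le
    simp only [hb]
    split_ifs
    · rw [abs_of_pos (hd m)]
      exact apertureScale_le hα hR m
    · simpa using hR0.le
  have hjet : ∀ n x, jet (fun x j => d j * U n (e x) j) x = piolaJet P b (jet (U n) (e x)) := by
    intro n x
    have h1 := jet_piola (V := U n) (Ψ := e) (Ψ' := e) (x := x) (B := fun m _ => (b m).1)
      e.hasFDerivAt (fun m => ((hU n m).1.differentiable (by simp)).differentiableAt)
      (fun m j => differentiableAt_const _)
    have h2 : (fun (y : EuclideanSpace ℝ (Fin 3)) j => ∑ m, (b m).1 j * U n (e y) m) =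
        fun x j => d j * U n (e x) j := by
      ext y j
      simp [hb]
    have h3 : (fun n i => (e : EuclideanSpace ℝ (Fin 3) →L[ℝ] EuclideanSpace ℝ (Fin 3))
        (EuclideanSpace.single i 1) n) = P := by
      ext n i
      change rescaleEquiv d hd (EuclideanSpace.single i 1) n = _
      rw [rescaleEquiv_apply]
      by_cases hni : n = i <;> simp [hP, hni]
    have h4 : (fun m => jet (fun _ => (b m).1) x) = b := by
      ext m : 1
      refine Prod.ext rfl ?_
      ext i j
      simp [jet, partialDeriv, hb]
    rw [h2, h3, h4] at h1
    exact h1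
  have hsnd : ∀ q i j, (piolaJet P b q).2 i j = d j * (d i)⁻¹ * q.2 i j := fun q i j => by
    simp [piolaJet, hP, hb, mul_assoc]
  have hK : 0 ≤ 3 * R + 9 * R ^ 2 := by positivity
  -- This bound is crude in `R`; it serves only for finiteness of the norm and for convergence. The
  -- sharp gradient bound uses the entries given by `hsnd`.
  have hlip : ∀ h : EuclideanSpace ℝ (Fin 3) → Jet, eLpNorm (fun x => piolaJet P b (h (e x))) 2 μ ≤
      ENNReal.ofReal (3 * R + 9 * R ^ 2) * (k * eLpNorm h 2 ν) := fun h => by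
    rw [← hnorm h]
    exact eLpNorm_le_mul_eLpNorm_of_ae_le_mul
      (Eventually.of_forall fun x => norm_piolaJet_le hR0.le hPR hbR _) 2
  have hpt : eLpNorm p 2 ν ≠ ⊤ := ne_top_of_le_ne_top
    (ENNReal.mul_ne_top ENNReal.ofReal_ne_top hf₁m.2.ne) hpn
  refine ⟨fun n x j => d j * U n (e x) j, fun x => piolaJet P b (p (e x)), fun n j => ?_,
    ⟨?_, ?_⟩, ?_, ?_, ?_⟩
  · have h := e.toHomeomorph.preimage_interior (apertureDomain α 1)
    rw [ContinuousLinearEquiv.coe_toHomeomorph] at h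
    rw [← hpre, ← h]
    exact (hU n j).const_mul_comp (d j) e
  · exact (measurable_piolaJet (P := fun _ => P) (b := fun m _ => b m) measurable_const
      (fun _ => measurable_const) (hpm.comp e.continuous.measurable)).aestronglyMeasurable
  · exact (hlip p).trans_lt (ENNReal.mul_lt_top ENNReal.ofReal_lt_top
      (ENNReal.mul_lt_top hkt.lt_top hpt.lt_top))
  · simp only [hjet, ← piolaJet_sub]
    refine tendsto_of_tendsto_of_tendsto_of_le_of_le tendsto_const_nhds ?_ (fun _ => zero_le)
      fun n => hlip fun y => jet (U n) y - p y
    have h1 := ENNReal.Tendsto.const_mul hUp (Or.inr hkt)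
    have h2 := ENNReal.Tendsto.const_mul h1
      (Or.inr (ENNReal.ofReal_ne_top (r := 3 * R + 9 * R ^ 2)))
    simpa using h2
  · have hq : Measure.QuasiMeasurePreserving e μ ν :=
      ⟨e.continuous.measurable, hmap ▸ Measure.smul_absolutelyContinuous⟩
    filter_upwards [hq.ae hdiv] with x hx
    have h1 : f₁ (e x) = f x := congrFun hff x
    rw [← h1, ← hx, jetDiv, jetDiv]
    refine Finset.sum_congr rfl fun i _ => ?_
    rw [hsnd, mul_inv_cancel₀ (hd i).ne', one_mul]
  · have h1 : eLpNorm (fun x => (piolaJet P b (p (e x))).2) 2 μ ≤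
        ENNReal.ofReal (R ^ (1 - α)) * eLpNorm (fun x => p (e x)) 2 μ := by
      refine eLpNorm_le_mul_eLpNorm_of_ae_le_mul (Eventually.of_forall fun x => ?_) 2
      have h0 : 0 ≤ R ^ (1 - α) * ‖p (e x)‖ := by positivity
      refine (pi_norm_le_iff_of_nonneg h0).2 fun i => (pi_norm_le_iff_of_nonneg h0).2 fun j => ?_
      rw [hsnd, Real.norm_eq_abs, abs_mul]
      refine mul_le_mul ?_ (abs_snd_le_norm _ i j) (abs_nonneg _) (by positivity)
      rw [abs_of_pos (mul_pos (hd j) (inv_pos.2 (hd i)))]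
      exact apertureScale_div_le hα hR i j
    refine h1.trans ?_
    rw [hnorm p, hfn, mul_comm C, ENNReal.ofReal_mul (by positivity)]
    calc _ ≤ ENNReal.ofReal (R ^ (1 - α)) * (k * (ENNReal.ofReal C * eLpNorm f₁ 2 ν)) := by
          gcongr
      _ = _ := by ring

/-! ### Limits of jets of test fields are Sobolev fields. -/

lemma tendsto_integral_mul_of_tendsto_eLpNorm {X : Type*} [MeasurableSpace X] {μ : Measure X}
    {u : ℕ → X → ℝ} {v ψ : X → ℝ} (hu : ∀ n, MemLp (u n) 2 μ) (hv : MemLp v 2 μ)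
    (hψ : MemLp ψ 2 μ) (h : Tendsto (fun n => eLpNorm (fun x => u n x - v x) 2 μ) atTop (𝓝 0)) :
    Tendsto (fun n => ∫ x, u n x * ψ x ∂μ) atTop (𝓝 (∫ x, v x * ψ x ∂μ)) := by
  refine tendsto_integral_of_L1' _ (hv.integrable_mul hψ).1
    (Eventually.of_forall fun n => (hu n).integrable_mul hψ) ?_
  have h1 : Tendsto (fun n => eLpNorm (fun x => u n x - v x) 2 μ * eLpNorm ψ 2 μ) atTop (𝓝 0) := by
    simpa using ENNReal.Tendsto.mul_const h (Or.inr hψ.2.ne)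
  refine tendsto_of_tendsto_of_tendsto_of_le_of_le tendsto_const_nhds h1 (fun _ => zero_le)
    fun n => ?_
  have h2 := eLpNorm_smul_le_mul_eLpNorm (p := 2) (q := 2) (r := 1) hψ.1 ((hu n).sub hv).1
  refine le_trans (le_of_eq (congrArg (eLpNorm · 1 μ) ?_)) h2
  ext x
  simp [sub_mul]

/-- Both integrands vanish outside `Ω`, so this is integration by parts on the whole space. -/
lemma IsTestFunction.integral_mul_partialDeriv {Ω : Set (EuclideanSpace ℝ (Fin 3))}
    {φ ψ : EuclideanSpace ℝ (Fin 3) → ℝ} (hφ : IsTestFunction Ω φ) (hψ : IsTestFunction Ω ψ)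
    (i : Fin 3) :
    ∫ x in Ω, φ x * partialDeriv i ψ x = -∫ x in Ω, partialDeriv i φ x * ψ x := by
  have hz : ∀ x, x ∉ Ω → ψ x = 0 := fun x hx =>
    image_eq_zero_of_notMem_tsupport fun h => hx (hψ.2.2 h)
  have hz' : ∀ x, x ∉ Ω → φ x = 0 := fun x hx =>
    image_eq_zero_of_notMem_tsupport fun h => hx (hφ.2.2 h)
  rw [setIntegral_eq_integral_of_forall_compl_eq_zero fun x hx => by rw [hz' x hx, zero_mul],
    setIntegral_eq_integral_of_forall_compl_eq_zero fun x hx => by rw [hz x hx, mul_zero]]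
  have c1 := hφ.1.continuous
  have c2 := hψ.1.continuous
  have d1 := continuous_partialDeriv i hφ.1
  have d2 := continuous_partialDeriv i hψ.1
  refine integral_mul_fderiv_eq_neg_fderiv_mul_of_integrable ?_ ?_ ?_
    (fun x _ => (hφ.1.differentiable (by simp)).differentiableAt)
    (fun x _ => (hψ.1.differentiable (by simp)).differentiableAt)
  · exact (d1.mul c2).integrable_of_hasCompactSupport hψ.2.1.mul_left
  · exact (c1.mul d2).integrable_of_hasCompactSupport hφ.2.1.mul_right
  · exact (c1.mul c2).integrable_of_hasCompactSupport hφ.2.1.mul_right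

lemma IsTestFunction.memLp {Ω : Set (EuclideanSpace ℝ (Fin 3))}
    {φ : EuclideanSpace ℝ (Fin 3) → ℝ} (h : IsTestFunction Ω φ) (μ : Measure (EuclideanSpace ℝ (Fin 3)))
    [IsFiniteMeasureOnCompacts μ] : MemLp φ 2 μ :=
  h.1.continuous.memLp_of_hasCompactSupport h.2.1

lemma IsTestFunction.memLp_partialDeriv {Ω : Set (EuclideanSpace ℝ (Fin 3))}
    {φ : EuclideanSpace ℝ (Fin 3) → ℝ} (h : IsTestFunction Ω φ) (i : Fin 3)
    (μ : Measure (EuclideanSpace ℝ (Fin 3))) [IsFiniteMeasureOnCompacts μ] :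
    MemLp (partialDeriv i φ) 2 μ :=
  (continuous_partialDeriv i h.1).memLp_of_hasCompactSupport (h.2.1.fderiv_apply ℝ _)

lemma tendsto_eLpNorm_of_abs_le {X : Type*} [MeasurableSpace X] {μ : Measure X}
    {u : ℕ → X → ℝ} {h : ℕ → X → Jet} (hle : ∀ n x, |u n x| ≤ ‖h n x‖)
    (hh : Tendsto (fun n => eLpNorm (h n) 2 μ) atTop (𝓝 0)) :
    Tendsto (fun n => eLpNorm (u n) 2 μ) atTop (𝓝 0) :=
  tendsto_of_tendsto_of_tendsto_of_le_of_le tendsto_const_nhds hh (fun _ => zero_le)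
    fun n => eLpNorm_mono (hle n)

section JetLimit

variable {Ω : Set (EuclideanSpace ℝ (Fin 3))} {U : ℕ → EuclideanSpace ℝ (Fin 3) → Fin 3 → ℝ}
  {p : EuclideanSpace ℝ (Fin 3) → Jet}

lemma MemLp.jet_fst {μ : Measure (EuclideanSpace ℝ (Fin 3))} (hp : MemLp p 2 μ) (j : Fin 3) :
    MemLp (fun x => (p x).1 j) 2 μ :=
  hp.mono ((((continuous_apply j).comp continuous_fst).comp_aestronglyMeasurable hp.1))
    (Eventually.of_forall fun x => abs_fst_le_norm (p x) j)

lemma MemLp.jet_snd {μ : Measure (EuclideanSpace ℝ (Fin 3))} (hp : MemLp p 2 μ) (i j : Fin 3) :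
    MemLp (fun x => (p x).2 i j) 2 μ :=
  hp.mono (Continuous.comp_aestronglyMeasurable (g := fun q : Jet => q.2 i j)
    ((continuous_apply_apply i j).comp continuous_snd) hp.1)
    (Eventually.of_forall fun x => abs_snd_le_norm (p x) i j)

lemma tendsto_eLpNorm_jet_fst {μ : Measure (EuclideanSpace ℝ (Fin 3))}
    (h : Tendsto (fun n => eLpNorm (fun x => jet (U n) x - p x) 2 μ) atTop (𝓝 0)) (j : Fin 3) :
    Tendsto (fun n => eLpNorm (fun x => U n x j - (p x).1 j) 2 μ) atTop (𝓝 0) :=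
  tendsto_eLpNorm_of_abs_le (fun n x => abs_fst_le_norm (jet (U n) x - p x) j) h

lemma tendsto_eLpNorm_jet_snd {μ : Measure (EuclideanSpace ℝ (Fin 3))}
    (h : Tendsto (fun n => eLpNorm (fun x => jet (U n) x - p x) 2 μ) atTop (𝓝 0)) (i j : Fin 3) :
    Tendsto (fun n => eLpNorm (fun x => partialDeriv i (fun y => U n y j) x - (p x).2 i j) 2 μ)
      atTop (𝓝 0) :=
  tendsto_eLpNorm_of_abs_le (fun n x => abs_snd_le_norm (jet (U n) x - p x) i j) h

/-- Integration by parts holds for the approximating fields, and both sides are continuous under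
`L²` convergence by Hölder's inequality. Finite volume turns `L²` into local integrability. -/
lemma hasWeakPartial_of_tendsto_jet (hΩ : volume Ω ≠ ⊤)
    (hU : ∀ n j, IsTestFunction Ω fun x => U n x j) (hp : MemLp p 2 (volume.restrict Ω))
    (h : Tendsto (fun n => eLpNorm (fun x => jet (U n) x - p x) 2 (volume.restrict Ω)) atTop (𝓝 0))
    (i j : Fin 3) :
    HasWeakPartial Ω i (fun x => (p x).1 j) (fun x => (p x).2 i j) := by
  have : IsFiniteMeasure (volume.restrict Ω) := ⟨by simpa using hΩ.lt_top⟩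
  refine ⟨IntegrableOn.locallyIntegrableOn ((MemLp.jet_fst hp j).integrable (by norm_num)),
    IntegrableOn.locallyIntegrableOn ((MemLp.jet_snd hp i j).integrable (by norm_num)),
    fun ψ hψ => ?_⟩
  have h1 := tendsto_integral_mul_of_tendsto_eLpNorm
    (fun n => (hU n j).memLp (volume.restrict Ω)) (MemLp.jet_fst hp j)
    (hψ.memLp_partialDeriv i (volume.restrict Ω)) (tendsto_eLpNorm_jet_fst h j)
  have h2 := tendsto_integral_mul_of_tendsto_eLpNorm
    (fun n => (hU n j).memLp_partialDeriv i (volume.restrict Ω)) (MemLp.jet_snd hp i j)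
    (hψ.memLp (volume.restrict Ω)) (tendsto_eLpNorm_jet_snd h i j)
  refine tendsto_nhds_unique h1 (h2.neg.congr fun n => ?_)
  exact ((hU n j).integral_mul_partialDeriv hψ i).symm

lemma memSobolevZero_of_tendsto_jet (hΩ : volume Ω ≠ ⊤)
    (hU : ∀ n j, IsTestFunction Ω fun x => U n x j) (hp : MemLp p 2 (volume.restrict Ω))
    (h : Tendsto (fun n => eLpNorm (fun x => jet (U n) x - p x) 2 (volume.restrict Ω)) atTop (𝓝 0))
    (j : Fin 3) : MemSobolevZero 2 Ω fun x => (p x).1 j :=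
  ⟨MemLp.jet_fst hp j, fun i x => (p x).2 i j,
    fun i => ⟨MemLp.jet_snd hp i j, hasWeakPartial_of_tendsto_jet hΩ hU hp h i j⟩,
    fun n x => U n x j, fun n => hU n j, tendsto_eLpNorm_jet_fst h j,
    fun i => tendsto_eLpNorm_jet_snd h i j⟩

end JetLimit

/-! ### The Frobenius norm and the conclusion. -/

lemma matrixLength_le {A : Matrix (Fin 3) (Fin 3) ℝ} {c : ℝ} (hc : 0 ≤ c)
    (h : ∀ j i, |A j i| ≤ c) : matrixLength A ≤ 3 * c := by
  refine Real.sqrt_le_iff.2 ⟨by positivity, ?_⟩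
  have h1 : ∀ j i, A j i ^ 2 ≤ c ^ 2 := fun j i => sq_le_sq.2 (by rw [abs_of_nonneg hc]; exact h j i)
  calc ∑ j, ∑ i, A j i ^ 2 ≤ ∑ _j : Fin 3, ∑ _i : Fin 3, c ^ 2 :=
        Finset.sum_le_sum fun j _ => Finset.sum_le_sum fun i _ => h1 j i
    _ = (3 * c) ^ 2 := by simp; ring

lemma volume_apertureDomain_ne_top (α : ℝ) {R : ℝ} (hR : 1 ≤ R) :
    volume (apertureDomain α R) ≠ ⊤ := by
  have hK := (rescaleEquiv _ (apertureScale_pos α hR)).toHomeomorph.isCompact_preimage.2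
    (isCompact_cylMap_image α (isCompact_closedBox ![0, -(1 / 2), 0] fun _ => 1 / 2)
      fun _ => closedBox_pos)
  refine measure_ne_top_of_subset ?_ hK.measure_lt_top.ne
  rw [← preimage_apertureDomain hR]
  exact Set.preimage_mono (apertureDomain_subset_image α)

theorem propositionP4p1 (α : ℝ) (hα : α ∈ Set.Icc (0 : ℝ) 1) :
    ∃ C : ℝ, 0 < C ∧ ∀ R : ℝ, 1 ≤ R →
      ∀ f : EuclideanSpace ℝ (Fin 3) → ℝ,
        MemLp f 2 (volume.restrict (apertureDomain α R)) →
        ∫ x in apertureDomain α R, f x = 0 →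
        ∃ (V : EuclideanSpace ℝ (Fin 3) → EuclideanSpace ℝ (Fin 3))
          (D : EuclideanSpace ℝ (Fin 3) → Matrix (Fin 3) (Fin 3) ℝ),
          (∀ j, MemSobolevZero 2 (interior (apertureDomain α R)) (fun x => V x j)) ∧
          HasWeakJacobian (interior (apertureDomain α R)) V D ∧
          (∀ᵐ x ∂(volume.restrict (apertureDomain α R)), (D x).trace = f x) ∧
          eLpNorm (fun x => matrixLength (D x)) 2 (volume.restrict (apertureDomain α R)) ≤
            ENNReal.ofReal (C * R ^ (1 - α)) *
              eLpNorm f 2 (volume.restrict (apertureDomain α R)) := by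
  obtain ⟨C, hC, H⟩ := exists_aperture_divergence hα
  -- The factor `3 = √9` compares the Frobenius length with the maximum of the nine entries.
  refine ⟨3 * C, by positivity, fun R hR f hf hf0 => ?_⟩
  obtain ⟨U, p, hU, hp, hUp, hdiv, hpn⟩ := H R hR f hf hf0
  have hΩ : volume (interior (apertureDomain α R)) ≠ ⊤ :=
    measure_ne_top_of_subset interior_subset (volume_apertureDomain_ne_top α hR)
  -- The boundary is a null set, so `L²` statements on the closed domain hold on its interior, where
  -- the Sobolev space is defined.
  have hres := Measure.restrict_congr_set (interior_ae_eq_apertureDomain_of_one_le hα.1 hR)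
  rw [← hres] at hp hUp
  refine ⟨fun x => WithLp.toLp 2 (p x).1, fun x => Matrix.of fun j i => (p x).2 i j,
    fun j => memSobolevZero_of_tendsto_jet hΩ hU hp hUp j,
    fun i j => hasWeakPartial_of_tendsto_jet hΩ hU hp hUp i j, hdiv, ?_⟩
  have h3 : eLpNorm (fun x => matrixLength (Matrix.of fun j i => (p x).2 i j)) 2
      (volume.restrict (apertureDomain α R)) ≤ ENNReal.ofReal 3 *
        eLpNorm (fun x => (p x).2) 2 (volume.restrict (apertureDomain α R)) := by
    refine eLpNorm_le_mul_eLpNorm_of_ae_le_mul (Eventually.of_forall fun x => ?_) 2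
    rw [Real.norm_eq_abs, abs_of_nonneg (by exact Real.sqrt_nonneg _)]
    exact matrixLength_le (norm_nonneg _) fun j i =>
      (norm_le_pi_norm ((p x).2 i) j).trans (norm_le_pi_norm (p x).2 i)
  refine h3.trans ((mul_le_mul_right hpn _).trans_eq ?_)
  rw [← mul_assoc, ← ENNReal.ofReal_mul (by norm_num), mul_assoc 3]
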